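/- Let $d\ge 2$ and let $E$ be the set of undirected nearest-neighbour edges of $\mathbb{Z}^d$. Let $\{t_e : e\in E\}$ be i.i.d. nonnegative random variables on a probability space $(\Omega,\mathcal F,P)$, and let $$a_n=\inf_{\gamma}\sum_{e\in\gamma}t_e ,$$ where the infimum is over all finite nearest-neighbour paths $\gamma$ in $\mathbb{Z}^d$ from $0$ to $(n,0,\dots,0)$, an edge being counted as often as $\gamma$ traverses it. Here $\log$ denotes the logarithm to base $2$, with $\log 0=-\infty$. Assume that for some $M_0\in(0,\infty)$ there is a positive nondecreasing function $f$ on $(M_0,\infty)$ such that $$\log P(t_e>x)=-x^d f(x)\qquad\text{for all } x>M_0 .$$ Then there is a constant $\nu\in[0,\infty)$ with $\lim_{n\to\infty}a_n/n=\nu$ almost surely, and there is $\varepsilon_0>0$ such that for every $\varepsilon\in(0,\varepsilon_0)$, $$\limsup_{n\to\infty}\frac1{n^d}\log P\bigl(a_n\ge(\nu+\varepsilon)n\bigr)<0 \quad\Longleftrightarrow\quad \sum_{n=1}^{\infty}\frac1{f(2^n)^{1/(d-1)}}<\infty .$$ (The finitely many terms of the series with $2^n\le M_0$ play no role.) -/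

import Mathlib

open MeasureTheory ProbabilityTheory Filter Topology
open scoped ENNReal

namespace FPP

/-- The nearest-neighbour graph on `ℤ^d`: `x` and `y` are adjacent iff `|x - y|₁ = 1`. -/
def lattice (d : ℕ) : SimpleGraph (Fin d → ℤ) where
  Adj x y := ∑ i, |x i - y i| = 1
  symm := ⟨fun x y h => by
    rw [← h]
    exact Finset.sum_congr rfl fun i _ => abs_sub_comm _ _⟩
  loopless := ⟨fun x h => by simp at h⟩

/-- The set `E` of undirected nearest-neighbour edges of `ℤ^d`. -/
abbrev Edge (d : ℕ) : Type := (lattice d).edgeSet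

/-- The point `(n, 0, …, 0)` of `ℤ^d`. -/
def axisPoint (d n : ℕ) : Fin d → ℤ := fun i => if (i : ℕ) = 0 then (n : ℤ) else 0

/-- The value `∑_{e ∈ γ} τ_e` of a finite nearest-neighbour path `γ` in the environment `τ`;
an edge is counted as often as `γ` traverses it. -/
noncomputable def pathValue {d : ℕ} (τ : Edge d → ℝ) {x y : Fin d → ℤ}
    (γ : (lattice d).Walk x y) : ℝ :=
  (γ.darts.map fun a => τ ⟨a.edge, a.edge_mem⟩).sum

/-- The point-to-point passage time `a_n`: the infimum of the values of all finite
nearest-neighbour paths from `0` to `(n, 0, …, 0)`. -/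
noncomputable def passageTime {d : ℕ} (τ : Edge d → ℝ) (n : ℕ) : ℝ :=
  ⨅ γ : (lattice d).Walk 0 (axisPoint d n), pathValue τ γ

/-- The logarithm to base `2` with values in `[-∞, ∞]`; in particular `log2 0 = -∞`. -/
noncomputable def log2 (p : ℝ≥0∞) : EReal := ENNReal.log p / ((Real.log 2 : ℝ) : EReal)

end FPP

/-!
Path values are controlled from both sides by elementary means.

*Time constant.* The constant is `ν = inf E a_m / m`. The tail assumption gives all exponential
moments of the edge variables. The minimum over finitely many paths from `0` to `(m, 0, …, 0)` is a
functional of finitely many edges whose mean is close to `E a_m`; sums of its translates satisfy a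
Chernoff bound (`IIDEnv.measure_sum_translates_ge_le`), because translates in one residue class of the
lattice are independent. With the Borel–Cantelli lemma this yields `limsup a_n / n ≤ ν`. For the
lower limit, `φ = liminf a_n / n` does not increase when the starting point moves along the axis;
chaining steps of cost at most `φ + η` per unit length from all sites but a small proportion of bad
ones gives `ν ≤ E φ` (`TailEnv.timeConstant_le_integral_lowerRate`), hence `φ = ν` almost surely.

*Summable case.* A journey from `0` to `(n, 0, …, 0)` is averaged over detours through the points `w`
of a cube of side `δ n`: from `0` to `w`, along a line parallel to the axis, and back from the opposite
cube. The middle parts are about `n ^ d` local functionals, and their average exceeds its mean by a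
fixed proportion only with probability at most of order `exp (-c n ^ d)`. The route from `w` to `0`
repeatedly halves all coordinates, so that the average of the first parts is at most `∑ q_e t_e` with
`q_e` of order `|e| ^ (-(d - 1))` (`sum_minTime_cube_le_weighted`). Its moment generating function at `β ^ (d - 1) n ^ (d - 1)` factorises;
splitting each factor into dyadic layers and summing first over the edges, the layer of values near
`2 ^ j` contributes at most a multiple of `β ^ d n ^ d f(2 ^ j) ^ (-1 / (d - 1))` to its logarithm
(`TailEnv.sum_layerBound_le`). The sum over `j` converges, and for small `β` it is dominated by the
linear gain `β ^ (d - 1) ε n ^ d` (`TailEnv.measure_sum_minTime_cube_le`).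

*Non-summable case.* If all edges at distance about `n / 2 ^ j` from the origin cost
`c_j 2 ^ j` with `∑ c_j = A`, the passage time is at least of order `A n`, and by independence the base
two logarithm of the probability of this is at least `-C n ^ d ∑ c_j ^ d f(2 ^ j)`. For `c_j`
proportional to `f(2 ^ j) ^ (-1 / (d - 1))`, the sum is `A ^ d` divided by a power of
`∑ f(2 ^ j) ^ (-1 / (d - 1))`, which is arbitrarily large
(`TailEnv.exists_upper_tail_ge`).
-/

namespace FPP

/-! ### Geometry of the lattice and elementary properties of passage times -/

theorem lattice_adj_single {d : ℕ} (x : Fin d → ℤ) (i : Fin d) :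
    (lattice d).Adj x (x + Pi.single i 1) := by
  change ∑ j, |x j - (x + Pi.single i 1 : Fin d → ℤ) j| = 1
  rw [Finset.sum_eq_single i] <;> simp +contextual

/-- The edge from `x` to its neighbour in the positive `i`-th coordinate direction. Every edge of
the lattice is of this form for exactly one pair `(x, i)`. -/
def edgeAt {d : ℕ} (x : Fin d → ℤ) (i : Fin d) : Edge d :=
  ⟨s(x, x + Pi.single i 1), lattice_adj_single x i⟩

theorem edgeAt_injective {d : ℕ} :
    Function.Injective fun p : (Fin d → ℤ) × Fin d => edgeAt p.1 p.2 := by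
  rintro ⟨x, i⟩ ⟨y, j⟩ h
  have h' := congrArg Subtype.val h
  simp only [edgeAt, Sym2.eq_iff] at h'
  rcases h' with ⟨rfl, h2⟩ | ⟨h1, h2⟩
  · have h3 := congrFun (add_left_cancel h2) i
    by_cases hij : i = j
    · rw [hij]
    · simp [hij] at h3
  · exfalso
    rw [h1] at h2
    have h3 := congrFun h2 i
    by_cases hij : i = j
    · subst hij; simp at h3; omega
    · simp [hij] at h3

theorem exists_single_of_adj {d : ℕ} {x y : Fin d → ℤ} (h : (lattice d).Adj x y) :
    ∃ i, y = x + Pi.single i 1 ∨ x = y + Pi.single i 1 := by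
  have h : ∑ j, |x j - y j| = 1 := h
  obtain ⟨i, hi⟩ : ∃ i, x i ≠ y i := by
    by_contra! hc
    simp [hc] at h
  have h1 : 1 ≤ |x i - y i| := Int.one_le_abs (sub_ne_zero.2 hi)
  rw [← Finset.add_sum_erase _ _ (Finset.mem_univ i)] at h
  have h2 : 0 ≤ ∑ j ∈ Finset.univ.erase i, |x j - y j| := Finset.sum_nonneg fun _ _ => abs_nonneg _
  have h3 : ∑ j ∈ Finset.univ.erase i, |x j - y j| = 0 := by omega
  have h4 : ∀ j, j ≠ i → x j = y j := by
    intro j hj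
    have := (Finset.sum_eq_zero_iff_of_nonneg fun _ _ => abs_nonneg _).1 h3 j
      (Finset.mem_erase.2 ⟨hj, Finset.mem_univ _⟩)
    exact sub_eq_zero.1 (abs_eq_zero.1 this)
  have h5 : |x i - y i| = 1 := by omega
  refine ⟨i, ?_⟩
  rcases (abs_eq zero_le_one).1 h5 with h6 | h6
  · right
    ext j
    by_cases hj : j = i
    · subst hj; simp; omega
    · simp [hj, h4 j hj]
  · left
    ext j
    by_cases hj : j = i
    · subst hj; simp; omega
    · simp [hj, h4 j hj]

/-- The displacements reachable from every vertex form a subgroup that contains the unit vectors. -/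
theorem lattice_reachable {d : ℕ} (x y : Fin d → ℤ) : (lattice d).Reachable x y := by
  let H : AddSubgroup (Fin d → ℤ) :=
    { carrier := {v | ∀ u, (lattice d).Reachable u (u + v)}
      add_mem' := fun {a b} ha hb u => by
        rw [← add_assoc]; exact (ha u).trans (hb _)
      zero_mem' := fun u => by rw [add_zero]
      neg_mem' := fun {a} ha u => by
        have := (ha (u + -a)).symm
        rwa [neg_add_cancel_right] at this }
  have hs : ∀ i : Fin d, Pi.single i (1 : ℤ) ∈ H := fun i u => (lattice_adj_single u i).reachable
  have hall : ∀ v : Fin d → ℤ, v ∈ H := by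
    intro v
    have : v = ∑ i, v i • Pi.single i (1 : ℤ) := by
      ext j; simp [Finset.sum_apply, Pi.single_apply]
    rw [this]
    exact H.sum_mem fun i _ => H.zsmul_mem (hs i) _
  simpa using hall (y - x) x

instance {d : ℕ} (x y : Fin d → ℤ) : Nonempty ((lattice d).Walk x y) := lattice_reachable x y

instance {d : ℕ} (x y : Fin d → ℤ) : Countable ((lattice d).Walk x y) :=
  Function.Injective.countable (f := fun γ : (lattice d).Walk x y => γ.support)
    fun _ _ h => SimpleGraph.Walk.ext_support h

@[simp] theorem pathValue_nil {d : ℕ} (τ : Edge d → ℝ) (x : Fin d → ℤ) :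
    pathValue τ (SimpleGraph.Walk.nil : (lattice d).Walk x x) = 0 := by
  simp [pathValue]

@[simp] theorem pathValue_cons {d : ℕ} (τ : Edge d → ℝ) {x y z : Fin d → ℤ}
    (h : (lattice d).Adj x y) (γ : (lattice d).Walk y z) :
    pathValue τ (SimpleGraph.Walk.cons h γ) = τ ⟨s(x, y), h⟩ + pathValue τ γ := by
  simp [pathValue, SimpleGraph.Dart.edge]

theorem pathValue_append {d : ℕ} (τ : Edge d → ℝ) {x y z : Fin d → ℤ}
    (γ : (lattice d).Walk x y) (γ' : (lattice d).Walk y z) :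
    pathValue τ (γ.append γ') = pathValue τ γ + pathValue τ γ' := by
  simp [pathValue]

theorem pathValue_reverse {d : ℕ} (τ : Edge d → ℝ) {x y : Fin d → ℤ}
    (γ : (lattice d).Walk x y) : pathValue τ γ.reverse = pathValue τ γ := by
  induction γ with
  | nil => rfl
  | cons h p ih =>
    rw [SimpleGraph.Walk.reverse_cons, pathValue_append, ih, pathValue_cons, pathValue_cons,
      pathValue_nil, add_zero, add_comm]
    congr 2
    exact Subtype.ext Sym2.eq_swap

theorem pathValue_nonneg {d : ℕ} {τ : Edge d → ℝ} (hτ : ∀ e, 0 ≤ τ e) {x y : Fin d → ℤ}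
    (γ : (lattice d).Walk x y) : 0 ≤ pathValue τ γ := by
  refine List.sum_nonneg fun a ha => ?_
  obtain ⟨b, -, rfl⟩ := List.mem_map.1 ha
  exact hτ _

theorem pathValue_congr {d : ℕ} {τ τ' : Edge d → ℝ} {x y : Fin d → ℤ}
    (γ : (lattice d).Walk x y) (h : ∀ a ∈ γ.darts, τ ⟨a.edge, a.edge_mem⟩ = τ' ⟨a.edge, a.edge_mem⟩) :
    pathValue τ γ = pathValue τ' γ := by
  unfold pathValue
  rw [List.map_congr_left h]

theorem measurable_pathValue {d : ℕ} {x y : Fin d → ℤ} (γ : (lattice d).Walk x y) :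
    Measurable fun τ : Edge d → ℝ => pathValue τ γ := by
  induction γ with
  | nil => simp
  | cons h p ih =>
    simp only [pathValue_cons]
    exact (measurable_pi_apply _).add ih

/-- The passage time from `x` to `y` in the environment `τ`: the infimum of the values of all
lattice paths from `x` to `y`. -/
noncomputable def minTime {d : ℕ} (τ : Edge d → ℝ) (x y : Fin d → ℤ) : ℝ :=
  ⨅ γ : (lattice d).Walk x y, pathValue τ γ

theorem passageTime_eq_minTime {d : ℕ} (τ : Edge d → ℝ) (n : ℕ) :
    passageTime τ n = minTime τ 0 (axisPoint d n) := rfl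

theorem measurable_minTime {d : ℕ} (x y : Fin d → ℤ) :
    Measurable fun τ : Edge d → ℝ => minTime τ x y :=
  Measurable.iInf fun γ => measurable_pathValue γ

section Nonneg

variable {d : ℕ} {τ : Edge d → ℝ}

theorem bddBelow_pathValue (hτ : ∀ e, 0 ≤ τ e) (x y : Fin d → ℤ) :
    BddBelow (Set.range fun γ : (lattice d).Walk x y => pathValue τ γ) :=
  ⟨0, by rintro _ ⟨γ, rfl⟩; exact pathValue_nonneg hτ γ⟩

theorem minTime_le (hτ : ∀ e, 0 ≤ τ e) {x y : Fin d → ℤ} (γ : (lattice d).Walk x y) :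
    minTime τ x y ≤ pathValue τ γ := ciInf_le (bddBelow_pathValue hτ x y) γ

theorem minTime_nonneg (hτ : ∀ e, 0 ≤ τ e) (x y : Fin d → ℤ) : 0 ≤ minTime τ x y :=
  le_ciInf fun γ => pathValue_nonneg hτ γ

theorem minTime_self (hτ : ∀ e, 0 ≤ τ e) (x : Fin d → ℤ) : minTime τ x x = 0 :=
  le_antisymm ((minTime_le hτ SimpleGraph.Walk.nil).trans_eq (pathValue_nil τ x))
    (minTime_nonneg hτ x x)

theorem minTime_symm (hτ : ∀ e, 0 ≤ τ e) (x y : Fin d → ℤ) : minTime τ x y = minTime τ y x :=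
  le_antisymm
    (le_ciInf fun γ => (minTime_le hτ γ.reverse).trans_eq (pathValue_reverse τ γ))
    (le_ciInf fun γ => (minTime_le hτ γ.reverse).trans_eq (pathValue_reverse τ γ))

theorem minTime_triangle (hτ : ∀ e, 0 ≤ τ e) (x y z : Fin d → ℤ) :
    minTime τ x z ≤ minTime τ x y + minTime τ y z := by
  rw [← sub_le_iff_le_add']
  refine le_ciInf fun γ' => ?_
  rw [sub_le_iff_le_add', ← sub_le_iff_le_add]
  refine le_ciInf fun γ => ?_
  rw [sub_le_iff_le_add, ← pathValue_append]
  exact minTime_le hτ _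

theorem minTime_edgeAt (hτ : ∀ e, 0 ≤ τ e) (x : Fin d → ℤ) (i : Fin d) :
    minTime τ x (x + Pi.single i 1) ≤ τ (edgeAt x i) :=
  (minTime_le hτ (SimpleGraph.Walk.cons (lattice_adj_single x i) SimpleGraph.Walk.nil)).trans_eq
    (by simp [edgeAt])

/-- Travelling `k` steps in a coordinate direction costs at most the sum of the edges used. -/
theorem minTime_line (hτ : ∀ e, 0 ≤ τ e) (x : Fin d → ℤ) (i : Fin d) (k : ℕ) :
    minTime τ x (x + Pi.single i (k : ℤ)) ≤
      ∑ l ∈ Finset.range k, τ (edgeAt (x + Pi.single i (l : ℤ)) i) := by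
  induction k with
  | zero => simp [minTime_self hτ]
  | succ k ih =>
    rw [Finset.sum_range_succ]
    refine (minTime_triangle hτ x (x + Pi.single i (k : ℤ)) _).trans (add_le_add ih ?_)
    have := minTime_edgeAt hτ (x + Pi.single i (k : ℤ)) i
    rwa [add_assoc, ← Pi.single_add] at this

end Nonneg

/-- A function on the vertices whose increments along edges are dominated by the environment
bounds path values from below. -/
theorem sub_le_pathValue {d : ℕ} {τ : Edge d → ℝ} (H : (Fin d → ℤ) → ℝ)
    (hH : ∀ x i, |H (x + Pi.single i 1) - H x| ≤ τ (edgeAt x i)) {x y : Fin d → ℤ}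
    (γ : (lattice d).Walk x y) : H y - H x ≤ pathValue τ γ := by
  induction γ with
  | nil => simp
  | @cons u v w h p ih =>
    rw [pathValue_cons]
    have : H v - H u ≤ τ ⟨s(u, v), h⟩ := by
      obtain ⟨i, hi⟩ := exists_single_of_adj h
      rcases hi with rfl | rfl
      · exact (le_abs_self _).trans (hH u i)
      · refine ((le_abs_self _).trans (abs_sub_comm _ _).le).trans ((hH v i).trans_eq ?_)
        congr 1
        exact Subtype.ext Sym2.eq_swap
    linarith

/-- Translation of the lattice by `z`. -/
def shift {d : ℕ} (z : Fin d → ℤ) : lattice d ≃g lattice d where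
  toEquiv := Equiv.addRight z
  map_rel_iff' := by intro a b; simp [lattice]

/-- Reflection of the lattice in the `i`-th coordinate, `x i ↦ n - x i`. -/
def reflect {d : ℕ} (i : Fin d) (n : ℤ) : lattice d ≃g lattice d where
  toEquiv :=
    { toFun := fun x => Function.update x i (n - x i)
      invFun := fun x => Function.update x i (n - x i)
      left_inv := fun x => by simp
      right_inv := fun x => by simp }
  map_rel_iff' := by
    intro a b
    have : ∀ j, |Function.update a i (n - a i) j - Function.update b i (n - b i) j|
        = |a j - b j| := by
      intro j
      by_cases hj : j = i
      · subst hj; simp [abs_sub_comm]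
      · simp [hj]
    simp [lattice, this]

@[simp] theorem shift_apply {d : ℕ} (z x : Fin d → ℤ) : shift z x = x + z := rfl

@[simp] theorem reflect_apply {d : ℕ} (i : Fin d) (n : ℤ) (x : Fin d → ℤ) :
    reflect i n x = Function.update x i (n - x i) := rfl

theorem pathValue_map {d : ℕ} (φ : lattice d ≃g lattice d) (τ : Edge d → ℝ) {x y : Fin d → ℤ}
    (γ : (lattice d).Walk x y) :
    pathValue τ (γ.map φ.toHom) = pathValue (fun e => τ (φ.mapEdgeSet e)) γ := by
  induction γ with
  | nil => simp
  | cons h p ih => rw [SimpleGraph.Walk.map_cons, pathValue_cons, pathValue_cons, ih]; rfl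

theorem minTime_comp {d : ℕ} (φ : lattice d ≃g lattice d) {τ : Edge d → ℝ}
    (hτ : ∀ e, 0 ≤ τ e) (x y : Fin d → ℤ) :
    minTime (fun e => τ (φ.mapEdgeSet e)) x y = minTime τ (φ x) (φ y) := by
  have key : ∀ (φ : lattice d ≃g lattice d) {τ : Edge d → ℝ} (_ : ∀ e, 0 ≤ τ e) (x y),
      minTime τ (φ x) (φ y) ≤ minTime (fun e => τ (φ.mapEdgeSet e)) x y := by
    intro φ τ hτ x y
    refine le_ciInf fun γ => ?_
    rw [← pathValue_map]
    exact minTime_le hτ (γ.map φ.toHom)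
  refine le_antisymm ?_ (key φ hτ x y)
  have := key φ.symm (τ := fun e => τ (φ.mapEdgeSet e)) (fun e => hτ _) (φ x) (φ y)
  rw [RelIso.symm_apply_apply, RelIso.symm_apply_apply] at this
  refine this.trans_eq ?_
  congr 1
  ext e
  exact congrArg τ (φ.mapEdgeSet.apply_symm_apply e)

theorem shift_edgeAt {d : ℕ} (z x : Fin d → ℤ) (i : Fin d) :
    (shift z).mapEdgeSet (edgeAt x i) = edgeAt (x + z) i := by
  apply Subtype.ext
  change Sym2.map (shift z) s(x, x + Pi.single i 1) = s(x + z, x + z + Pi.single i 1)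
  rw [Sym2.map_mk]
  simp [add_right_comm]

/-! ### Random environments -/

/-- An i.i.d. family of nonnegative edge passage times. Nonnegativity is required everywhere rather
than almost surely; it can be arranged by passing to positive parts. -/
structure IIDEnv {d : ℕ} {Ω : Type*} [MeasurableSpace Ω] (P : Measure Ω)
    (t : Edge d → Ω → ℝ) : Prop where
  meas : ∀ e, Measurable (t e)
  nonneg : ∀ e ω, 0 ≤ t e ω
  indep : iIndepFun t P
  ident : ∀ e e', IdentDistrib (t e) (t e') P P

/-- An i.i.d. environment whose upper tail is `P(t_e > x) = 2 ^ (-x ^ d f(x))` for `x > M₀`, with `f`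
positive and nondecreasing. -/
structure TailEnv {d : ℕ} {Ω : Type*} [MeasurableSpace Ω] (P : Measure Ω)
    (t : Edge d → Ω → ℝ) (M₀ : ℝ) (f : ℝ → ℝ) : Prop extends IIDEnv P t where
  f_pos : ∀ x, M₀ < x → 0 < f x
  f_mono : MonotoneOn f (Set.Ioi M₀)
  tail : ∀ e, ∀ x, M₀ < x → P {ω | x < t e ω} = ENNReal.ofReal ((2 : ℝ) ^ (-(x ^ d * f x)))

section Env

variable {d : ℕ} {Ω : Type*} [MeasurableSpace Ω] {P : Measure Ω} {t : Edge d → Ω → ℝ}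

theorem IIDEnv.reindex (h : IIDEnv P t) {σ : Edge d → Edge d} (hσ : Function.Injective σ) :
    IIDEnv P fun e => t (σ e) :=
  ⟨fun _ => h.meas _, fun _ => h.nonneg _, h.indep.precomp hσ, fun _ _ => h.ident _ _⟩

theorem TailEnv.reindex {M₀ : ℝ} {f : ℝ → ℝ} (h : TailEnv P t M₀ f) {σ : Edge d → Edge d}
    (hσ : Function.Injective σ) : TailEnv P (fun e => t (σ e)) M₀ f :=
  ⟨h.toIIDEnv.reindex hσ, h.f_pos, h.f_mono, fun _ => h.tail _⟩

theorem IIDEnv.measurable_env (h : IIDEnv P t) : Measurable fun ω e => t e ω :=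
  measurable_pi_iff.2 h.meas

theorem IIDEnv.measurable_minTime (h : IIDEnv P t) (x y : Fin d → ℤ) :
    Measurable fun ω => minTime (fun e => t e ω) x y :=
  (FPP.measurable_minTime x y).comp h.measurable_env

/-- The law of an i.i.d. environment is invariant under injective relabellings of the edges. -/
theorem IIDEnv.identDistrib [IsProbabilityMeasure P] (h : IIDEnv P t) {σ : Edge d → Edge d}
    (hσ : Function.Injective σ) :
    IdentDistrib (fun ω e => t (σ e) ω) (fun ω e => t e ω) P P where
  aemeasurable_fst := (h.reindex hσ).measurable_env.aemeasurable
  aemeasurable_snd := h.measurable_env.aemeasurable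
  map_eq := by
    rw [h.indep.map_fun_eq_infinitePi_map h.meas,
      (h.reindex hσ).indep.map_fun_eq_infinitePi_map (h.reindex hσ).meas]
    congr 1
    ext1 e
    exact (h.ident _ _).map_eq

end Env

/-- Functionals of pairwise disjoint finite blocks of independent random variables are independent,
in the form of a product formula for expectations. -/
theorem lintegral_prod_of_disjoint_blocks {ι κ Ω : Type*} [MeasurableSpace Ω] {P : Measure Ω}
    [IsProbabilityMeasure P] {t : ι → Ω → ℝ} (hm : ∀ i, Measurable (t i)) (hi : iIndepFun t P)
    (J : Finset κ) (F : κ → Finset ι) (hF : (J : Set κ).PairwiseDisjoint F)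
    (Y : κ → (ι → ℝ) → ℝ≥0∞) (hY : ∀ k, Measurable (Y k))
    (hloc : ∀ k τ τ', (∀ i ∈ F k, τ i = τ' i) → Y k τ = Y k τ') :
    ∫⁻ ω, ∏ k ∈ J, Y k (fun i => t i ω) ∂P = ∏ k ∈ J, ∫⁻ ω, Y k (fun i => t i ω) ∂P := by
  classical
  -- a block functional is a measurable function of the coordinates in the block
  let ext : ∀ S : Finset ι, (S → ℝ) → ι → ℝ := fun S u i => if h : i ∈ S then u ⟨i, h⟩ else 0
  have hext : ∀ S, Measurable (ext S) := by
    intro S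
    refine measurable_pi_iff.2 fun i => ?_
    by_cases h : i ∈ S
    · simpa [ext, h] using measurable_pi_apply (⟨i, h⟩ : S)
    · simp [ext, h]
  have hfac : ∀ (S : Finset ι) (k : κ), F k ⊆ S → ∀ τ, Y k τ = Y k (ext S fun i => τ i) := by
    intro S k hk τ
    refine hloc k _ _ fun i hi => ?_
    simp [ext, hk hi]
  induction J using Finset.induction_on with
  | empty => simp
  | insert k J hk ih =>
    have hJ : (J : Set κ).PairwiseDisjoint F := hF.subset (by simp)
    simp only [Finset.prod_insert hk]
    rw [← ih hJ]
    have hdis : Disjoint (F k) (J.biUnion F) := by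
      rw [Finset.disjoint_biUnion_right]
      intro j hj
      exact hF (by simp) (by simp [hj]) (by rintro rfl; exact hk hj)
    have h2 := hi.indepFun_finset _ _ hdis hm
    have hmA : Measurable fun u : F k → ℝ => Y k (ext _ u) := (hY k).comp (hext _)
    have hmB : Measurable fun u : J.biUnion F → ℝ => ∏ j ∈ J, Y j (ext _ u) :=
      Finset.measurable_prod _ fun j _ => (hY j).comp (hext _)
    have h3 := h2.comp hmA hmB
    have eA : (fun ω => Y k fun i => t i ω) =
        (fun u : F k → ℝ => Y k (ext _ u)) ∘ fun ω (i : F k) => t i ω := by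
      ext ω
      exact hfac _ k subset_rfl fun i => t i ω
    have eB : (fun ω => ∏ j ∈ J, Y j fun i => t i ω) =
        (fun u : J.biUnion F → ℝ => ∏ j ∈ J, Y j (ext _ u)) ∘
          fun ω (i : J.biUnion F) => t i ω := by
      ext ω
      exact Finset.prod_congr rfl fun j hj =>
        hfac _ j (Finset.subset_biUnion_of_mem F hj) fun i => t i ω
    rw [← eA, ← eB] at h3
    have hmt : Measurable fun ω i => t i ω := measurable_pi_iff.2 hm
    exact lintegral_mul_eq_lintegral_mul_lintegral_of_indepFun ((hY k).comp hmt)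
      (Finset.measurable_prod _ fun j _ => (hY j).comp hmt) h3

/-! ### The base-two logarithm -/

theorem log_ofReal_two_rpow (y : ℝ) :
    ENNReal.log (ENNReal.ofReal ((2 : ℝ) ^ y)) = ((y * Real.log 2 : ℝ) : EReal) := by
  rw [ENNReal.log_ofReal, if_neg (not_le.2 (by positivity)), Real.log_rpow two_pos]

theorem le_log2_iff (y : ℝ) (p : ℝ≥0∞) :
    (y : EReal) ≤ log2 p ↔ ENNReal.ofReal ((2 : ℝ) ^ y) ≤ p := by
  have h2 : (0 : EReal) < ((Real.log 2 : ℝ) : EReal) := by exact_mod_cast Real.log_pos one_lt_two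
  rw [log2, EReal.le_div_iff_mul_le h2 (EReal.coe_ne_top _), ← EReal.coe_mul,
    ← log_ofReal_two_rpow, ENNReal.log_le_log_iff]

theorem log2_le_iff (y : ℝ) (p : ℝ≥0∞) :
    log2 p ≤ (y : EReal) ↔ p ≤ ENNReal.ofReal ((2 : ℝ) ^ y) := by
  have h2 : (0 : EReal) < ((Real.log 2 : ℝ) : EReal) := by exact_mod_cast Real.log_pos one_lt_two
  rw [log2, EReal.div_le_iff_le_mul h2 (EReal.coe_ne_top _), ← EReal.coe_mul, mul_comm (Real.log 2),
    ← log_ofReal_two_rpow, ENNReal.log_le_log_iff]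

theorem log2_eq_iff (y : ℝ) (p : ℝ≥0∞) :
    log2 p = (y : EReal) ↔ p = ENNReal.ofReal ((2 : ℝ) ^ y) := by
  rw [le_antisymm_iff, le_antisymm_iff, le_log2_iff, log2_le_iff]

/-! ### Exponential moments -/

/-- A single layer: either `u ≤ y` and the term is at most `exp (-y)`, or `y < u` and then `b < u`, so
that `1 + exp u ≤ exp (u + 1)` is absorbed by a multiple of `u`. -/
theorem one_add_exp_le {u y b : ℝ} (hu : 0 ≤ u) (hb : 0 < b) (hy : b ≤ y) :
    1 + Real.exp (u - 2 * y) ≤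
      Real.exp (Real.exp (-y) + if y < u then (1 + 1 / b) * u else 0) := by
  split_ifs with h
  · have h1 : Real.exp (u - 2 * y) ≤ Real.exp u := Real.exp_le_exp.2 (by linarith)
    have h2 : 1 ≤ Real.exp u := Real.one_le_exp hu
    have h3 : (2 : ℝ) ≤ Real.exp 1 := by have := Real.add_one_le_exp (1 : ℝ); linarith
    have h4 : Real.exp (u + 1) ≤ Real.exp (Real.exp (-y) + (1 + 1 / b) * u) := by
      refine Real.exp_le_exp.2 ?_
      have : 1 ≤ 1 / b * u := by
        rw [one_div, inv_mul_eq_div, le_div_iff₀ hb]; linarith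
      have := Real.exp_pos (-y)
      linarith
    rw [Real.exp_add] at h4
    nlinarith
  · have h1 : Real.exp (u - 2 * y) ≤ Real.exp (-y) := Real.exp_le_exp.2 (by linarith)
    have := Real.add_one_le_exp (Real.exp (-y))
    rw [add_zero]
    linarith

/-- The contribution of the `j`-th dyadic layer to a bound for the logarithm of a moment generating
function in which this layer contributes at most `exp (u j - 2 * y j)`. The lower bound `b` of the
`y j` serves to absorb additive constants. -/
noncomputable def layerBound (b : ℝ) (u y : ℕ → ℝ) (j : ℕ) : ℝ :=
  Real.exp (-y j) + if y j < u j then (1 + 1 / b) * u j else 0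

theorem layerBound_nonneg {b : ℝ} (hb : 0 < b) {u y : ℕ → ℝ} (hu : ∀ j, 0 ≤ u j) (j : ℕ) :
    0 ≤ layerBound b u y j := by
  have := hu j
  unfold layerBound
  split_ifs <;> positivity

theorem one_add_tsum_exp_le {b : ℝ} (hb : 0 < b) {u y : ℕ → ℝ} (hu : ∀ j, 0 ≤ u j)
    (hy : ∀ j, b ≤ y j) (hs : Summable (layerBound b u y)) :
    1 + ∑' j, ENNReal.ofReal (Real.exp (u j - 2 * y j)) ≤
      ENNReal.ofReal (Real.exp (∑' j, layerBound b u y j)) := by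
  have key : ∀ N, 1 + ∑ j ∈ Finset.range N, Real.exp (u j - 2 * y j) ≤
      Real.exp (∑ j ∈ Finset.range N, layerBound b u y j) := by
    intro N
    induction N with
    | zero => simp
    | succ N ih =>
      rw [Finset.sum_range_succ, Finset.sum_range_succ, Real.exp_add]
      have h1 := one_add_exp_le (hu N) hb (hy N)
      have h2 : 0 ≤ ∑ j ∈ Finset.range N, Real.exp (u j - 2 * y j) :=
        Finset.sum_nonneg fun _ _ => (Real.exp_pos _).le
      have h3 := Real.exp_pos (u N - 2 * y N)
      refine le_trans ?_ (mul_le_mul ih h1 (by positivity) (Real.exp_pos _).le)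
      nlinarith
  rw [ENNReal.tsum_eq_iSup_nat, ENNReal.add_iSup]
  refine iSup_le fun N => ?_
  rw [← ENNReal.ofReal_sum_of_nonneg fun _ _ => (Real.exp_pos _).le, ← ENNReal.ofReal_one,
    ← ENNReal.ofReal_add zero_le_one (Finset.sum_nonneg fun _ _ => (Real.exp_pos _).le)]
  refine ENNReal.ofReal_le_ofReal ((key N).trans (Real.exp_le_exp.2 ?_))
  exact hs.sum_le_tsum _ fun j _ => layerBound_nonneg hb hu j

/-- Dyadic layer-cake bound for the exponential moment of the excess `(X - 2 ^ J)⁺`. -/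
theorem lintegral_exp_excess_le {Ω : Type*} [MeasurableSpace Ω] {P : Measure Ω}
    [IsProbabilityMeasure P] {X : Ω → ℝ} (hX : Measurable X) (J : ℕ) {s : ℝ} (hs : 0 ≤ s) :
    ∫⁻ ω, ENNReal.ofReal (Real.exp (s * max (X ω - 2 ^ J) 0)) ∂P ≤
      1 + ∑' j : ℕ, ENNReal.ofReal (Real.exp (s * 2 ^ (J + j + 1))) *
        P {ω | (2 : ℝ) ^ (J + j) < X ω} := by
  have hset : ∀ j : ℕ, MeasurableSet {ω | (2 : ℝ) ^ (J + j) < X ω} := fun j =>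
    measurableSet_lt measurable_const hX
  have hpt : ∀ ω, ENNReal.ofReal (Real.exp (s * max (X ω - 2 ^ J) 0)) ≤
      1 + ∑' j : ℕ, {ω | (2 : ℝ) ^ (J + j) < X ω}.indicator
        (fun _ => ENNReal.ofReal (Real.exp (s * 2 ^ (J + j + 1)))) ω := by
    intro ω
    rcases le_or_gt (X ω) (2 ^ J) with h | h
    · rw [max_eq_right (by linarith)]
      simp
    · -- the layer `2 ^ (J + j) < X ≤ 2 ^ (J + j + 1)` containing the value
      have hex : ∃ j : ℕ, X ω ≤ 2 ^ (J + j) := by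
        obtain ⟨n, hn⟩ := pow_unbounded_of_one_lt (X ω) (one_lt_two (α := ℝ))
        exact ⟨n, hn.le.trans (pow_le_pow_right₀ one_le_two (by omega))⟩
      classical
      have h1 := Nat.find_spec hex
      have h0 : Nat.find hex ≠ 0 := by
        intro h0
        rw [h0] at h1
        simp at h1
        linarith
      obtain ⟨j, hj⟩ := Nat.exists_eq_succ_of_ne_zero h0
      have h2 : (2 : ℝ) ^ (J + j) < X ω := not_le.1 (Nat.find_min hex (by omega))
      rw [hj] at h1
      refine le_trans ?_ le_add_self
      refine le_trans ?_ (ENNReal.le_tsum j)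
      rw [Set.indicator_of_mem (by exact h2)]
      refine ENNReal.ofReal_le_ofReal (Real.exp_le_exp.2 (mul_le_mul_of_nonneg_left ?_ hs))
      have : (0 : ℝ) < 2 ^ J := by positivity
      refine max_le ?_ (by positivity)
      calc X ω - 2 ^ J ≤ X ω := by linarith
        _ ≤ _ := h1
  refine (lintegral_mono hpt).trans ?_
  rw [lintegral_add_left measurable_const, lintegral_const, measure_univ, mul_one,
    lintegral_tsum fun j => (measurable_const.indicator (hset j)).aemeasurable]
  refine add_le_add le_rfl (ENNReal.tsum_le_tsum fun j => ?_)
  rw [lintegral_indicator_const (hset j)]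

section Tail

variable {d : ℕ} {Ω : Type*} [MeasurableSpace Ω] {P : Measure Ω} {t : Edge d → Ω → ℝ}
  {M₀ : ℝ} {f : ℝ → ℝ}

/-- Half of the exponent `log 2 * x ^ d * f x` of the tail probability at `x = 2 ^ (J + j)`. -/
noncomputable def halfCost (d : ℕ) (f : ℝ → ℝ) (J j : ℕ) : ℝ :=
  Real.log 2 / 2 * ((2 ^ (J + j)) ^ d * f (2 ^ (J + j)))

theorem TailEnv.halfCost_ge (h : TailEnv P t M₀ f) (hd : 2 ≤ d) {J : ℕ} (hJ : M₀ < 2 ^ J) (j : ℕ) :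
    halfCost d f J 0 * 4 ^ j ≤ halfCost d f J j := by
  have hl : 0 < Real.log 2 := Real.log_pos one_lt_two
  have hmono : ∀ j : ℕ, (2 : ℝ) ^ J ≤ 2 ^ (J + j) := fun j =>
    pow_le_pow_right₀ one_le_two (by omega)
  have hf : f (2 ^ J) ≤ f (2 ^ (J + j)) := h.f_mono hJ (lt_of_lt_of_le hJ (hmono j)) (hmono j)
  have hf0 : 0 < f (2 ^ J) := h.f_pos _ hJ
  have h4 : (4 : ℝ) ^ j ≤ (2 ^ j) ^ d := by
    rw [show (4 : ℝ) = 2 ^ 2 by norm_num, ← pow_mul, ← pow_mul]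
    exact pow_le_pow_right₀ one_le_two (by nlinarith)
  unfold halfCost
  rw [add_zero, pow_add, mul_pow]
  calc Real.log 2 / 2 * ((2 ^ J) ^ d * f (2 ^ J)) * 4 ^ j
      = Real.log 2 / 2 * ((2 ^ J) ^ d * 4 ^ j * f (2 ^ J)) := by ring
    _ ≤ _ := by
      rw [pow_add] at hf
      gcongr

theorem TailEnv.halfCost_zero_pos (h : TailEnv P t M₀ f) {J : ℕ} (hJ : M₀ < 2 ^ J) :
    0 < halfCost d f J 0 := by
  have hl : 0 < Real.log 2 := Real.log_pos one_lt_two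
  have hf0 : 0 < f (2 ^ J) := h.f_pos _ hJ
  unfold halfCost
  rw [add_zero]
  positivity

theorem TailEnv.summable_exp_neg_halfCost (h : TailEnv P t M₀ f) (hd : 2 ≤ d) {J : ℕ}
    (hJ : M₀ < 2 ^ J) : Summable fun j => Real.exp (-halfCost d f J j) := by
  have hb := h.halfCost_zero_pos hJ
  refine Summable.of_nonneg_of_le (fun _ => (Real.exp_pos _).le) (fun j => ?_)
    (Real.summable_exp_nat_mul_iff.2 (neg_neg_iff_pos.2 hb))
  refine Real.exp_le_exp.2 ?_
  have h1 := h.halfCost_ge hd hJ j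
  have h2 : (j : ℝ) ≤ 4 ^ j := by
    exact_mod_cast (Nat.lt_pow_self (by norm_num : 1 < 4)).le
  nlinarith

theorem TailEnv.summable_layerBound (h : TailEnv P t M₀ f) (hd : 2 ≤ d) {J : ℕ}
    (hJ : M₀ < 2 ^ J) (s : ℝ) :
    Summable (layerBound (halfCost d f J 0) (fun j => s * 2 ^ (J + j + 1)) (halfCost d f J)) := by
  have hb := h.halfCost_zero_pos hJ
  refine (h.summable_exp_neg_halfCost hd hJ).add ?_
  obtain ⟨N, hN⟩ := pow_unbounded_of_one_lt (|s| * 2 ^ (J + 1) / halfCost d f J 0)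
    (one_lt_two (α := ℝ))
  refine summable_of_hasFiniteSupport ((Finset.range N).finite_toSet.subset fun j hj => ?_)
  by_contra hjN
  simp only [Finset.coe_range, Set.mem_Iio, not_lt] at hjN
  refine hj (if_neg (not_lt.2 ?_))
  refine le_trans ?_ (h.halfCost_ge hd hJ j)
  have h1 : |s| * 2 ^ (J + 1) / halfCost d f J 0 ≤ 2 ^ j :=
    hN.le.trans (pow_le_pow_right₀ one_le_two hjN)
  rw [div_le_iff₀ hb] at h1
  have h4 : (4 : ℝ) ^ j = 2 ^ j * 2 ^ j := by rw [← mul_pow]; norm_num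
  change s * 2 ^ (J + j + 1) ≤ _
  rw [h4, add_right_comm, pow_add]
  have h2 : (0 : ℝ) < 2 ^ j := by positivity
  calc s * (2 ^ (J + 1) * 2 ^ j) ≤ |s| * (2 ^ (J + 1) * 2 ^ j) := by gcongr; exact le_abs_self s
    _ = |s| * 2 ^ (J + 1) * 2 ^ j := by ring
    _ ≤ 2 ^ j * halfCost d f J 0 * 2 ^ j := by gcongr
    _ = _ := by ring

/-- Exponential moments of the excess of a passage time over the level `2 ^ J`. -/
theorem TailEnv.lintegral_exp_excess_le [IsProbabilityMeasure P] (h : TailEnv P t M₀ f)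
    (hd : 2 ≤ d) {J : ℕ} (hJ : M₀ < 2 ^ J) (e : Edge d) {s : ℝ} (hs : 0 ≤ s) :
    ∫⁻ ω, ENNReal.ofReal (Real.exp (s * max (t e ω - 2 ^ J) 0)) ∂P ≤
      ENNReal.ofReal (Real.exp (∑' j, layerBound (halfCost d f J 0)
        (fun j => s * 2 ^ (J + j + 1)) (halfCost d f J) j)) := by
  have hb := h.halfCost_zero_pos hJ
  refine (FPP.lintegral_exp_excess_le (h.meas e) J hs).trans
    (le_trans (le_of_eq ?_) (one_add_tsum_exp_le hb (fun j => by positivity) (fun j => ?_)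
      (h.summable_layerBound hd hJ s)))
  · congr 1
    refine tsum_congr fun j => ?_
    rw [h.tail e _ (lt_of_lt_of_le hJ (pow_le_pow_right₀ one_le_two (by omega))),
      ← ENNReal.ofReal_mul (Real.exp_pos _).le]
    congr 1
    rw [Real.rpow_def_of_pos two_pos, ← Real.exp_add]
    congr 1
    unfold halfCost
    ring
  · refine le_trans ?_ (h.halfCost_ge hd hJ j)
    exact le_mul_of_one_le_right hb.le (one_le_pow₀ (by norm_num))

/-- All exponential moments of the passage times are finite. -/
theorem TailEnv.integrable_exp [IsProbabilityMeasure P] (h : TailEnv P t M₀ f)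
    (hd : 2 ≤ d) (e : Edge d) (s : ℝ) : Integrable (fun ω => Real.exp (s * t e ω)) P := by
  obtain ⟨J, hJ⟩ := pow_unbounded_of_one_lt M₀ (one_lt_two (α := ℝ))
  have hm : Measurable fun ω => Real.exp (|s| * max (t e ω - 2 ^ J) 0) :=
    Real.measurable_exp.comp ((((h.meas e).sub_const _).max measurable_const).const_mul _)
  have h1 : Integrable (fun ω => Real.exp (|s| * max (t e ω - 2 ^ J) 0)) P := by
    refine ⟨hm.aestronglyMeasurable, ?_⟩
    rw [hasFiniteIntegral_iff_ofReal (ae_of_all _ fun ω => (Real.exp_pos _).le)]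
    exact (h.lintegral_exp_excess_le hd hJ e (abs_nonneg s)).trans_lt ENNReal.ofReal_lt_top
  refine (h1.const_mul (Real.exp (|s| * 2 ^ J))).mono'
    (Real.measurable_exp.comp ((h.meas e).const_mul _)).aestronglyMeasurable (ae_of_all _ fun ω => ?_)
  rw [Real.norm_eq_abs, Real.abs_exp, ← Real.exp_add, ← mul_add]
  refine Real.exp_le_exp.2 ?_
  have h2 : t e ω ≤ 2 ^ J + max (t e ω - 2 ^ J) 0 := by
    have := le_max_left (t e ω - 2 ^ J) 0
    linarith
  calc s * t e ω ≤ |s| * t e ω := mul_le_mul_of_nonneg_right (le_abs_self s) (h.nonneg e ω)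
    _ ≤ _ := mul_le_mul_of_nonneg_left h2 (abs_nonneg s)

theorem TailEnv.integrable [IsProbabilityMeasure P] (h : TailEnv P t M₀ f)
    (hd : 2 ≤ d) (e : Edge d) : Integrable (t e) P := by
  refine (h.integrable_exp hd e 1).mono' (h.meas e).aestronglyMeasurable (ae_of_all _ fun ω => ?_)
  rw [Real.norm_eq_abs, abs_of_nonneg (h.nonneg e ω), one_mul]
  have := Real.add_one_le_exp (t e ω)
  linarith

end Tail

/-! ### Large deviations for sums of translated local functionals -/

/-- Chernoff bounds are effective at every level above the mean, since the mean is the derivative of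
the moment generating function at `0`. -/
theorem exists_mgf_le {Ω : Type*} [MeasurableSpace Ω] {P : Measure Ω} [IsProbabilityMeasure P]
    {X : Ω → ℝ} (hexp : ∀ s : ℝ, Integrable (fun ω => Real.exp (s * X ω)) P) {η : ℝ} (hη : 0 < η) :
    ∃ θ : ℝ, 0 < θ ∧ mgf X P θ ≤ Real.exp (θ * (∫ ω, X ω ∂P + η)) := by
  have hset : integrableExpSet X P = Set.univ := Set.eq_univ_of_forall fun s => hexp s
  have h1 : HasDerivAt (mgf X P) (∫ ω, X ω ∂P) 0 := by
    have := hasDerivAt_mgf (X := X) (μ := P) (t := 0) (by rw [hset]; simp)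
    simpa using this
  have h2 : HasDerivAt (fun θ : ℝ => Real.exp (θ * (∫ ω, X ω ∂P + η))) (∫ ω, X ω ∂P + η) 0 := by
    have := ((hasDerivAt_id (0 : ℝ)).mul_const (∫ ω, X ω ∂P + η)).exp
    simpa using this
  have h3 := (h1.sub h2).tendsto_slope_zero_right
  have h4 := h3.eventually (gt_mem_nhds (show ∫ ω, X ω ∂P - (∫ ω, X ω ∂P + η) < 0 by linarith))
  obtain ⟨θ, hθ, hθ0⟩ := (h4.and self_mem_nhdsWithin).exists
  refine ⟨θ, hθ0, ?_⟩
  have hθ0 : 0 < θ := hθ0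
  simp only [zero_add, Pi.sub_apply, mgf_zero, zero_mul, Real.exp_zero, sub_self, sub_zero,
    smul_eq_mul] at hθ
  by_contra hc
  have : 0 < θ⁻¹ * (mgf X P θ - Real.exp (θ * (∫ ω, X ω ∂P + η))) := by
    have := inv_pos.2 hθ0
    have : 0 < mgf X P θ - Real.exp (θ * (∫ ω, X ω ∂P + η)) := by linarith
    positivity
  linarith

/-- Residues of `z` modulo `2 * R + 1`: two different translates by vectors of equal colour of a set
inside the box of radius `R` are disjoint. -/
def colour {d : ℕ} (R : ℕ) (z : Fin d → ℤ) : Fin d → ℤ := fun i => z i % (2 * R + 1)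

theorem disjoint_image_shift {d : ℕ} [DecidableEq (Edge d)] {R : ℕ} {F : Finset (Edge d)}
    (hF : ∀ e ∈ F, ∀ v ∈ (e : Sym2 (Fin d → ℤ)), ∀ i, |v i| ≤ R) {z z' : Fin d → ℤ}
    (hz : z ≠ z') (hc : colour R z = colour R z') :
    Disjoint (F.image (shift z).mapEdgeSet) (F.image (shift z').mapEdgeSet) := by
  rw [Finset.disjoint_left]
  intro a ha ha'
  obtain ⟨e, he, rfl⟩ := Finset.mem_image.1 ha
  obtain ⟨e', he', hee⟩ := Finset.mem_image.1 ha'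
  refine hz ?_
  obtain ⟨v, hv⟩ : ∃ v, v ∈ (e : Sym2 (Fin d → ℤ)) := ⟨_, Sym2.out_fst_mem _⟩
  have h1 : v + z ∈ Sym2.map (shift z) (e : Sym2 (Fin d → ℤ)) := Sym2.mem_map.2 ⟨v, hv, rfl⟩
  have h2 : Sym2.map (shift z) (e : Sym2 (Fin d → ℤ)) =
    Sym2.map (shift z') (e' : Sym2 (Fin d → ℤ)) := (congrArg Subtype.val hee).symm
  rw [h2] at h1
  obtain ⟨v', hv', h3⟩ := Sym2.mem_map.1 h1
  rw [shift_apply] at h3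
  ext i
  have h4 := congrFun h3 i
  have h5 := abs_le.1 (hF e he v hv i)
  have h6 := abs_le.1 (hF e' he' v' hv' i)
  have h7 : z i % (2 * R + 1) = z' i % (2 * R + 1) := congrFun hc i
  simp only [Pi.add_apply] at h4
  have h8 := Int.eq_zero_of_abs_lt_dvd (Int.ModEq.dvd h7) (by rw [abs_lt]; omega)
  omega

theorem exists_radius {d : ℕ} (F : Finset (Edge d)) :
    ∃ R : ℕ, ∀ e ∈ F, ∀ v ∈ (e : Sym2 (Fin d → ℤ)), ∀ i, |v i| ≤ R := by
  classical
  let V : Finset (Fin d → ℤ) := F.biUnion fun e => (e : Sym2 (Fin d → ℤ)).toFinset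
  refine ⟨∑ v ∈ V, ∑ i, (v i).natAbs, fun e he v hv i => ?_⟩
  have h1 : v ∈ V := Finset.mem_biUnion.2 ⟨e, he, Sym2.mem_toFinset.2 hv⟩
  have h2 : (v i).natAbs ≤ ∑ v ∈ V, ∑ i, (v i).natAbs :=
    (Finset.single_le_sum (f := fun i => (v i).natAbs) (fun _ _ => Nat.zero_le _)
      (Finset.mem_univ i)).trans
      (Finset.single_le_sum (f := fun v : Fin d → ℤ => ∑ i, (v i).natAbs)
        (fun _ _ => Nat.zero_le _) h1)
  rw [Int.abs_eq_natAbs]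
  exact_mod_cast h2

/-- A Chernoff bound for sums of translates of a functional `G` of finitely many edges: the sites
are split into boundedly many colour classes, in each of which the translates are independent. -/
theorem IIDEnv.measure_sum_translates_ge_le {d : ℕ} {Ω : Type*} [MeasurableSpace Ω]
    {P : Measure Ω} [IsProbabilityMeasure P] {t : Edge d → Ω → ℝ} (h : IIDEnv P t)
    {G : (Edge d → ℝ) → ℝ} (hG : Measurable G) (F : Finset (Edge d))
    (hloc : ∀ τ τ' : Edge d → ℝ, (∀ e ∈ F, τ e = τ' e) → G τ = G τ')
    (hexp : ∀ s : ℝ, Integrable (fun ω => Real.exp (s * G fun e => t e ω)) P)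
    {η : ℝ} (hη : 0 < η) :
    ∃ C c : ℝ, 0 < C ∧ 0 < c ∧ ∀ {κ : Type} (J : Finset κ) (pos : κ → Fin d → ℤ),
      Set.InjOn pos J →
      P {ω | (J.card : ℝ) * (∫ ω, G (fun e => t e ω) ∂P + η) ≤
        ∑ k ∈ J, G fun e => t ((shift (pos k)).mapEdgeSet e) ω} ≤
      ENNReal.ofReal (C * Real.exp (-(c * J.card))) := by
  classical
  obtain ⟨R, hR⟩ := exists_radius F
  let cols : Finset (Fin d → ℤ) := Fintype.piFinset fun _ => Finset.Ico (0 : ℤ) (2 * R + 1)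
  have hcol : ∀ z, colour R z ∈ cols := by
    intro z
    rw [Fintype.mem_piFinset]
    intro i
    rw [Finset.mem_Ico]
    exact ⟨Int.emod_nonneg _ (by omega), Int.emod_lt_of_pos _ (by omega)⟩
  have hK : 0 < (cols.card : ℝ) := by
    exact_mod_cast Finset.card_pos.2 ⟨_, hcol 0⟩
  set K : ℝ := (cols.card : ℝ) with hKdef
  set μ : ℝ := ∫ ω, G (fun e => t e ω) ∂P with hμ
  obtain ⟨θ, hθ, hmgf⟩ := exists_mgf_le hexp (show 0 < η / (2 * K) by positivity)
  refine ⟨K, θ * (η / (2 * K)), hK, by positivity, ?_⟩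
  intro κ J pos hpos
  let Y : κ → (Edge d → ℝ) → ℝ≥0∞ := fun k τ =>
    ENNReal.ofReal (Real.exp (θ * G fun e => τ ((shift (pos k)).mapEdgeSet e)))
  have hYm : ∀ k, Measurable (Y k) := fun k =>
    (Real.measurable_exp.comp ((hG.comp
      (measurable_pi_iff.2 fun e => measurable_pi_apply _)).const_mul θ)).ennreal_ofReal
  have hYint : ∀ k, ∫⁻ ω, Y k (fun e => t e ω) ∂P ≤
      ENNReal.ofReal (Real.exp (θ * (μ + η / (2 * K)))) := by
    intro k
    have h1 := (h.identDistrib (σ := (shift (pos k)).mapEdgeSet)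
      (shift (pos k)).mapEdgeSet.injective).comp
      (u := fun τ => ENNReal.ofReal (Real.exp (θ * G τ)))
      (Real.measurable_exp.comp (hG.const_mul θ)).ennreal_ofReal
    refine (h1.lintegral_eq.trans_le ?_)
    change ∫⁻ ω, ENNReal.ofReal (Real.exp (θ * G fun e => t e ω)) ∂P ≤ _
    rw [← ofReal_integral_eq_lintegral_ofReal (hexp θ) (ae_of_all _ fun _ => (Real.exp_pos _).le)]
    exact ENNReal.ofReal_le_ofReal hmgf
  let Jc : (Fin d → ℤ) → Finset κ := fun c => J.filter fun k => colour R (pos k) = c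
  have hclass : ∀ c ∈ cols, P {ω | (Jc c).card * μ + η * J.card / K ≤
      ∑ k ∈ Jc c, G fun e => t ((shift (pos k)).mapEdgeSet e) ω} ≤
      ENNReal.ofReal (Real.exp (-(θ * (η / (2 * K)) * J.card))) := by
    intro c _
    have hprod := lintegral_prod_of_disjoint_blocks h.meas h.indep (Jc c)
      (fun k => F.image (shift (pos k)).mapEdgeSet)
      (fun k hk l hl hkl => by
        simp only [Jc, Finset.coe_filter, Set.mem_ofPred_eq] at hk hl
        exact disjoint_image_shift hR (fun hp => hkl (hpos hk.1 hl.1 hp))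
          (hk.2.trans hl.2.symm)) Y hYm
      (fun k τ τ' hτ => by
        simp only [Y]
        rw [hloc _ _ fun e he => hτ _ (Finset.mem_image_of_mem _ he)])
    set a : ℝ := (Jc c).card * μ + η * J.card / K with ha
    have hle : ∫⁻ ω, ∏ k ∈ Jc c, Y k (fun e => t e ω) ∂P ≤
        ENNReal.ofReal (Real.exp ((Jc c).card * (θ * (μ + η / (2 * K))))) := by
      rw [hprod, Real.exp_nat_mul, ENNReal.ofReal_pow (Real.exp_pos _).le]
      exact Finset.prod_le_pow_card _ _ _ fun k _ => hYint k
    have hsub : {ω | a ≤ ∑ k ∈ Jc c, G fun e => t ((shift (pos k)).mapEdgeSet e) ω} ⊆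
        {ω | ENNReal.ofReal (Real.exp (θ * a)) ≤ ∏ k ∈ Jc c, Y k (fun e => t e ω)} := by
      intro ω hω
      simp only [Set.mem_ofPred_eq, Y] at hω ⊢
      rw [← ENNReal.ofReal_prod_of_nonneg fun _ _ => (Real.exp_pos _).le, ← Real.exp_sum,
        ← Finset.mul_sum]
      exact ENNReal.ofReal_le_ofReal (Real.exp_le_exp.2 (mul_le_mul_of_nonneg_left hω hθ.le))
    refine (measure_mono hsub).trans ?_
    have hmk := mul_meas_ge_le_lintegral (μ := P)
      (Finset.measurable_prod (Jc c) fun k _ => (hYm k).comp h.measurable_env)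
      (ENNReal.ofReal (Real.exp (θ * a)))
    simp only [Function.comp_apply] at hmk
    have h0 : ENNReal.ofReal (Real.exp (θ * a)) ≠ 0 := by simp [Real.exp_pos]
    rw [mul_comm, ← ENNReal.le_div_iff_mul_le (Or.inl h0) (Or.inl ENNReal.ofReal_ne_top)] at hmk
    refine hmk.trans ((ENNReal.div_le_div_right hle _).trans ?_)
    rw [← ENNReal.ofReal_div_of_pos (Real.exp_pos _), ← Real.exp_sub]
    refine ENNReal.ofReal_le_ofReal (Real.exp_le_exp.2 ?_)
    have hcard : ((Jc c).card : ℝ) ≤ J.card := by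
      exact_mod_cast Finset.card_le_card (Finset.filter_subset _ _)
    have e1 : (Jc c).card * (θ * (μ + η / (2 * K))) - θ * a =
        -(θ * (η / (2 * K)) * (2 * J.card - (Jc c).card)) := by
      rw [ha]; field_simp; ring
    rw [e1]
    have : 0 < θ * (η / (2 * K)) := by positivity
    nlinarith
  have hsub : {ω | (J.card : ℝ) * (μ + η) ≤
      ∑ k ∈ J, G fun e => t ((shift (pos k)).mapEdgeSet e) ω} ⊆
      ⋃ c ∈ cols, {ω | (Jc c).card * μ + η * J.card / K ≤
      ∑ k ∈ Jc c, G fun e => t ((shift (pos k)).mapEdgeSet e) ω} := by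
    intro ω hω
    by_contra hc
    simp only [Set.mem_iUnion, Set.mem_ofPred_eq, not_exists, not_le] at hc hω
    have h1 := Finset.sum_lt_sum_of_nonempty ⟨_, hcol 0⟩ hc
    rw [Finset.sum_fiberwise_of_maps_to (fun k _ => hcol (pos k))] at h1
    rw [Finset.sum_add_distrib, ← Finset.sum_mul, Finset.sum_const, nsmul_eq_mul, ← Nat.cast_sum,
      ← Finset.card_eq_sum_card_fiberwise (f := fun k => colour R (pos k))
        (fun k _ => hcol (pos k)), ← hKdef] at h1
    rw [show K * (η * J.card / K) = J.card * η by field_simp] at h1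
    linarith
  refine (measure_mono hsub).trans ((measure_biUnion_finset_le _ _).trans ?_)
  refine (Finset.sum_le_sum hclass).trans ?_
  rw [Finset.sum_const, nsmul_eq_mul, ENNReal.ofReal_mul hK.le, hKdef, ENNReal.ofReal_natCast]

/-! ### The time constant and local approximations of passage times -/

/-- The point `(k, 0, …, 0)` of `ℤ^d`, for an integer `k`. -/
def axis (d : ℕ) [NeZero d] (k : ℤ) : Fin d → ℤ := Pi.single 0 k

theorem axisPoint_eq_axis (d : ℕ) [NeZero d] (n : ℕ) : axisPoint d n = axis d n := by
  ext i
  simp only [axisPoint, axis, Pi.single_apply]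
  by_cases hi : i = 0
  · simp [hi]
  · rw [if_neg hi, if_neg fun h => hi (Fin.ext (by simpa using h))]

theorem axis_add (d : ℕ) [NeZero d] (k l : ℤ) : axis d (k + l) = axis d k + axis d l :=
  Pi.single_add _ _ _

@[simp] theorem axis_zero (d : ℕ) [NeZero d] : axis d 0 = 0 := Pi.single_zero _

theorem axis_injective (d : ℕ) [NeZero d] : Function.Injective (axis d) :=
  Pi.single_injective (M := fun _ : Fin d => ℤ) 0

/-- The edge between `(k, 0, …, 0)` and `(k + 1, 0, …, 0)`. -/
def axisEdge (d : ℕ) [NeZero d] (k : ℤ) : Edge d := edgeAt (axis d k) 0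

theorem axisEdge_injective (d : ℕ) [NeZero d] : Function.Injective (axisEdge d) := fun k l h =>
  axis_injective d (Prod.mk.inj (edgeAt_injective (a₁ := (axis d k, 0)) (a₂ := (axis d l, 0)) h)).1

theorem shift_axisEdge (d : ℕ) [NeZero d] (k l : ℤ) :
    (shift (axis d k)).mapEdgeSet (axisEdge d l) = axisEdge d (l + k) := by
  rw [axisEdge, axisEdge, shift_edgeAt, axis_add]

theorem minTime_axis_le {d : ℕ} [NeZero d] {τ : Edge d → ℝ} (hτ : ∀ e, 0 ≤ τ e) (m : ℕ) :
    minTime τ 0 (axis d m) ≤ ∑ l ∈ Finset.range m, τ (axisEdge d l) := by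
  have := minTime_line hτ 0 (0 : Fin d) m
  simp only [zero_add] at this
  exact this

/-- The expected passage time from the origin to `(m, 0, …, 0)`. -/
noncomputable def meanTime {d : ℕ} [NeZero d] {Ω : Type*} [MeasurableSpace Ω] (P : Measure Ω)
    (t : Edge d → Ω → ℝ) (m : ℕ) : ℝ :=
  ∫ ω, minTime (fun e => t e ω) 0 (axis d m) ∂P

/-- The time constant, as the infimum of the normalised expected passage times. -/
noncomputable def timeConstant {d : ℕ} [NeZero d] {Ω : Type*} [MeasurableSpace Ω] (P : Measure Ω)
    (t : Edge d → Ω → ℝ) : ℝ :=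
  ⨅ m : ℕ, meanTime P t (m + 1) / ((m + 1 : ℕ) : ℝ)

section

variable {d : ℕ} [NeZero d] {Ω : Type*} [MeasurableSpace Ω] {P : Measure Ω}
  {t : Edge d → Ω → ℝ} {M₀ : ℝ} {f : ℝ → ℝ}

theorem IIDEnv.meanTime_nonneg (h : IIDEnv P t) (m : ℕ) : 0 ≤ meanTime P t m :=
  integral_nonneg fun _ => minTime_nonneg (fun _ => h.nonneg _ _) _ _

theorem IIDEnv.bddBelow_meanTime (h : IIDEnv P t) :
    BddBelow (Set.range fun m : ℕ => meanTime P t (m + 1) / ((m + 1 : ℕ) : ℝ)) :=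
  ⟨0, by rintro _ ⟨m, rfl⟩; exact div_nonneg (h.meanTime_nonneg _) (Nat.cast_nonneg _)⟩

theorem IIDEnv.timeConstant_nonneg (h : IIDEnv P t) : 0 ≤ timeConstant P t :=
  le_ciInf fun _ => div_nonneg (h.meanTime_nonneg _) (Nat.cast_nonneg _)

theorem IIDEnv.timeConstant_mul_le (h : IIDEnv P t) (m : ℕ) :
    timeConstant P t * m ≤ meanTime P t m := by
  rcases m with _ | m
  · simpa using h.meanTime_nonneg 0
  · rw [← le_div_iff₀ (by positivity)]
    exact ciInf_le h.bddBelow_meanTime m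

theorem exists_meanTime_lt (P : Measure Ω) (t : Edge d → Ω → ℝ) {ε : ℝ} (hε : 0 < ε) :
    ∃ m : ℕ, 0 < m ∧ meanTime P t m < (timeConstant P t + ε) * m := by
  obtain ⟨m, hm⟩ := exists_lt_of_ciInf_lt (lt_add_of_pos_right (timeConstant P t) hε)
  refine ⟨m + 1, Nat.succ_pos _, ?_⟩
  rwa [div_lt_iff₀ (by positivity)] at hm

theorem TailEnv.integrable_axisSum [IsProbabilityMeasure P] (h : TailEnv P t M₀ f) (hd : 2 ≤ d)
    (m : ℕ) : Integrable (fun ω => ∑ l ∈ Finset.range m, t (axisEdge d l) ω) P :=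
  integrable_finsetSum _ fun _ _ => h.integrable hd _

/-- The passage time to `(m, 0, …, 0)` is approximated from above, in mean, by the minimum over
finitely many paths, which is a functional of finitely many edges. -/
theorem TailEnv.exists_local_approx [IsProbabilityMeasure P] (h : TailEnv P t M₀ f) (hd : 2 ≤ d)
    (m : ℕ) {η : ℝ} (hη : 0 < η) :
    ∃ (G : (Edge d → ℝ) → ℝ) (F : Finset (Edge d)), Measurable G ∧
      (∀ τ τ' : Edge d → ℝ, (∀ e ∈ F, τ e = τ' e) → G τ = G τ') ∧
      (∀ τ : Edge d → ℝ, (∀ e, 0 ≤ τ e) → minTime τ 0 (axis d m) ≤ G τ) ∧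
      (∀ s : ℝ, Integrable (fun ω => Real.exp (s * G fun e => t e ω)) P) ∧
      ∫ ω, G (fun e => t e ω) ∂P ≤ meanTime P t m + η := by
  classical
  obtain ⟨γ, hγ⟩ := exists_surjective_nat ((lattice d).Walk 0 (axis d m))
  let S : (Edge d → ℝ) → ℝ := fun τ => ∑ l ∈ Finset.range m, τ (axisEdge d l)
  let W : ℕ → (Edge d → ℝ) → ℝ := fun N τ =>
    (Finset.range (N + 1)).inf' Finset.nonempty_range_add_one fun i => pathValue τ (γ i)
  let G : ℕ → (Edge d → ℝ) → ℝ := fun N τ => min (S τ) (W N τ)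
  have hSm : Measurable S := Finset.measurable_sum _ fun l _ => measurable_pi_apply _
  have hWm : ∀ N, Measurable (W N) := fun N => by
    have hW : W N = (Finset.range (N + 1)).inf' Finset.nonempty_range_add_one
        fun i τ => pathValue τ (γ i) := by
      ext τ
      exact (Finset.inf'_apply (C := fun _ : Edge d → ℝ => ℝ) _ (fun i τ => pathValue τ (γ i)) τ).symm
    rw [hW]
    exact Finset.inf'_induction (p := Measurable) Finset.nonempty_range_add_one
      (fun i (τ : Edge d → ℝ) => pathValue τ (γ i)) (fun a ha b hb => ha.inf hb)
      (fun i _ => measurable_pathValue (γ i)) 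
  have hGm : ∀ N, Measurable (G N) := fun N => hSm.min (hWm N)
  have hmin : ∀ N τ, (∀ e, 0 ≤ τ e) → minTime τ 0 (axis d m) ≤ G N τ := fun N τ hτ =>
    le_min (minTime_axis_le hτ m) (Finset.le_inf' _ _ fun i _ => minTime_le hτ (γ i))
  have hGS : ∀ N τ, G N τ ≤ S τ := fun N τ => min_le_left _ _
  have hlim : ∀ ω, Tendsto (fun N => G N fun e => t e ω) atTop
      (𝓝 (minTime (fun e => t e ω) 0 (axis d m))) := by
    intro ω
    rw [Metric.tendsto_atTop]
    intro ε hε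
    obtain ⟨p, hp⟩ := exists_lt_of_ciInf_lt
      (lt_add_of_pos_right (minTime (fun e => t e ω) 0 (axis d m)) hε)
    obtain ⟨i, rfl⟩ := hγ p
    refine ⟨i, fun N hN => ?_⟩
    have h1 := hmin N (fun e => t e ω) fun e => h.nonneg e ω
    have h2 : G N (fun e => t e ω) ≤ pathValue (fun e => t e ω) (γ i) :=
      (min_le_right _ _).trans (Finset.inf'_le _ (Finset.mem_range.2 (by omega)))
    rw [Real.dist_eq, abs_of_nonneg (by linarith)]
    linarith
  have hconv := tendsto_integral_of_dominated_convergence (μ := P)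
    (F := fun N ω => G N fun e => t e ω) (f := fun ω => minTime (fun e => t e ω) 0 (axis d m))
    (fun ω => S fun e => t e ω)
    (fun N => ((hGm N).comp h.measurable_env).aestronglyMeasurable)
    (h.integrable_axisSum hd m)
    (fun N => ae_of_all _ fun ω => by
      have h1 := hmin N (fun e => t e ω) fun e => h.nonneg e ω
      have h2 := minTime_nonneg (τ := fun e => t e ω) (fun e => h.nonneg e ω) 0 (axis d m)
      rw [Real.norm_eq_abs, abs_of_nonneg (h2.trans h1)]
      exact hGS N fun e => t e ω)
    (ae_of_all _ hlim)
  obtain ⟨N, hN⟩ := (hconv.eventually (gt_mem_nhds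
    (show meanTime P t m < meanTime P t m + η by linarith))).exists
  refine ⟨G N, (Finset.range m).image (fun l : ℕ => axisEdge d l) ∪
    (Finset.range (N + 1)).biUnion fun i =>
      ((γ i).darts.map fun a => (⟨a.edge, a.edge_mem⟩ : Edge d)).toFinset,
    hGm N, ?_, hmin N, ?_, hN.le⟩
  · intro τ τ' hτ
    have h1 : S τ = S τ' := Finset.sum_congr rfl fun l hl =>
      hτ _ (Finset.mem_union_left _ (Finset.mem_image_of_mem _ hl))
    have h2 : W N τ = W N τ' := by
      refine Finset.inf'_congr _ rfl fun i hi => pathValue_congr _ fun a ha => ?_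
      refine hτ _ (Finset.mem_union_right _ (Finset.mem_biUnion.2 ⟨i, hi, ?_⟩))
      exact List.mem_toFinset.2 (List.mem_map.2 ⟨a, ha, rfl⟩)
    simp only [G, h1, h2]
  · intro s
    have h1 := (h.indep.precomp (g := fun l : ℕ => axisEdge d l) fun a b hab => by
      exact_mod_cast axisEdge_injective d hab).integrable_exp_mul_sum (s := Finset.range m)
      (t := |s|) (fun l => h.meas _) fun l _ => h.integrable_exp hd _ _
    refine h1.mono' (Real.measurable_exp.comp
      (((hGm N).comp h.measurable_env).const_mul s)).aestronglyMeasurable (ae_of_all _ fun ω => ?_)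
    rw [Real.norm_eq_abs, Real.abs_exp]
    refine Real.exp_le_exp.2 ?_
    have h3 : 0 ≤ G N fun e => t e ω :=
      (minTime_nonneg (fun e => h.nonneg e ω) _ _).trans (hmin N _ fun e => h.nonneg e ω)
    have h4 := hGS N fun e => t e ω
    simp only [Finset.sum_apply]
    calc s * (G N fun e => t e ω) ≤ |s| * (G N fun e => t e ω) :=
          mul_le_mul_of_nonneg_right (le_abs_self s) h3
      _ ≤ _ := mul_le_mul_of_nonneg_left h4 (abs_nonneg s)

/-- Chaining translates of a crossing functional along a line parallel to the first axis. -/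
theorem minTime_chain {τ : Edge d → ℝ} (hτ : ∀ e, 0 ≤ τ e) {m : ℕ} {G : (Edge d → ℝ) → ℝ}
    (hG : ∀ τ : Edge d → ℝ, (∀ e, 0 ≤ τ e) → minTime τ 0 (axis d m) ≤ G τ)
    (x : Fin d → ℤ) (k : ℕ) :
    minTime τ x (x + axis d ((k * m : ℕ) : ℤ)) ≤ ∑ i ∈ Finset.range k,
      G fun e => τ ((shift (x + axis d ((i * m : ℕ) : ℤ))).mapEdgeSet e) := by
  induction k with
  | zero => simp [minTime_self hτ]
  | succ k ih =>
    rw [Finset.sum_range_succ]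
    refine (minTime_triangle hτ x (x + axis d ((k * m : ℕ) : ℤ)) _).trans (add_le_add ih ?_)
    refine le_trans (le_of_eq ?_) (hG _ fun e => hτ _)
    rw [minTime_comp (shift _) hτ, shift_apply, shift_apply, zero_add]
    congr 1
    rw [Nat.succ_mul, Nat.cast_add, axis_add]
    abel

/-! ### Almost sure convergence to the time constant -/

theorem TailEnv.ae_eventually_le_of_pos [IsProbabilityMeasure P] (h : TailEnv P t M₀ f)
    (hd : 2 ≤ d) {ε : ℝ} (hε : 0 < ε) :
    ∀ᵐ ω ∂P, ∀ᶠ n : ℕ in atTop,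
      minTime (fun e => t e ω) 0 (axis d n) ≤ (timeConstant P t + ε) * n := by
  set ν := timeConstant P t with hν
  have hν0 : 0 ≤ ν := h.timeConstant_nonneg
  obtain ⟨m, hm, hmean⟩ := exists_meanTime_lt P t (show 0 < ε / 4 by positivity)
  have hm' : (0 : ℝ) < m := by exact_mod_cast hm
  obtain ⟨G, F, hGm, hloc, hmin, hexp, hint⟩ :=
    h.exists_local_approx hd m (show 0 < m * (ε / 4) by positivity)
  obtain ⟨C, c, hC, hc, hdev⟩ := h.measure_sum_translates_ge_le hGm F hloc hexp
    (show 0 < m * (ε / 4) by positivity)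
  let A : ℕ → Set Ω := fun n => {ω | ((n / m : ℕ) : ℝ) * (∫ ω, G (fun e => t e ω) ∂P + m * (ε / 4)) ≤
    ∑ i ∈ Finset.range (n / m), G fun e => t ((shift (axis d ((n % m : ℕ) : ℤ) +
      axis d ((i * m : ℕ) : ℤ))).mapEdgeSet e) ω}
  have hA : ∀ n, P (A n) ≤ ENNReal.ofReal (C * Real.exp c * Real.exp (n * (-(c / m)))) := by
    intro n
    have h1 := hdev (Finset.range (n / m))
      (fun i : ℕ => axis d ((n % m : ℕ) : ℤ) + axis d ((i * m : ℕ) : ℤ)) (by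
        intro i _ j _ hij
        have h2 := axis_injective d (add_left_cancel hij)
        have h3 : i * m = j * m := by exact_mod_cast h2
        exact Nat.eq_of_mul_eq_mul_right hm h3)
    rw [Finset.card_range] at h1
    refine h1.trans (ENNReal.ofReal_le_ofReal ?_)
    rw [mul_assoc, ← Real.exp_add]
    refine mul_le_mul_of_nonneg_left (Real.exp_le_exp.2 ?_) hC.le
    have h4 : (n : ℝ) ≤ m * ((n / m : ℕ) : ℝ) + m := by
      have h5 := Nat.div_add_mod n m
      have h6 := Nat.mod_lt n hm
      have h7 : n ≤ m * (n / m) + m := by omega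
      exact_mod_cast h7
    have h5 : (n : ℝ) * (c / m) ≤ c * ((n / m : ℕ) : ℝ) + c := by
      rw [mul_div_assoc', div_le_iff₀ hm']
      nlinarith
    linarith
  have hsum : ∑' n, P (A n) ≠ ⊤ := by
    refine ne_top_of_le_ne_top ?_ (ENNReal.tsum_le_tsum hA)
    rw [← ENNReal.ofReal_tsum_of_nonneg (fun n => by positivity)
      ((Real.summable_exp_nat_mul_iff.2 (by
        have : 0 < c / m := by positivity
        linarith)).mul_left _)]
    exact ENNReal.ofReal_ne_top
  filter_upwards [ae_eventually_notMem hsum] with ω hω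
  have hlarge : ∀ᶠ n : ℕ in atTop,
      ∑ l ∈ Finset.range m, t (axisEdge d l) ω ≤ ε / 4 * n := by
    have := (tendsto_natCast_atTop_atTop (R := ℝ)).const_mul_atTop (show 0 < ε / 4 by positivity)
    exact this.eventually_ge_atTop _
  filter_upwards [hω, hlarge] with n hn hl
  have hτ : ∀ e, 0 ≤ t e ω := fun e => h.nonneg e ω
  simp only [A, Set.mem_ofPred_eq, not_le] at hn
  have h1 := minTime_chain (τ := fun e => t e ω) hτ hmin (axis d ((n % m : ℕ) : ℤ)) (n / m)
  rw [← axis_add, ← Nat.cast_add, Nat.mod_add_div'] at h1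
  have h2 := minTime_axis_le (τ := fun e => t e ω) hτ (n % m)
  have h3 : ∑ l ∈ Finset.range (n % m), t (axisEdge d l) ω ≤
      ∑ l ∈ Finset.range m, t (axisEdge d l) ω :=
    Finset.sum_le_sum_of_subset_of_nonneg (Finset.range_mono (Nat.mod_lt n hm).le)
      fun _ _ _ => hτ _
  have h4 := minTime_triangle (τ := fun e => t e ω) hτ 0 (axis d ((n % m : ℕ) : ℤ)) (axis d n)
  have h5 : ((n / m : ℕ) : ℝ) * (∫ ω, G (fun e => t e ω) ∂P + m * (ε / 4)) ≤
      (ν + 3 * (ε / 4)) * n := by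
    have h6 : ((n / m : ℕ) : ℝ) * m ≤ n := by exact_mod_cast Nat.div_mul_le_self n m
    calc _ ≤ ((n / m : ℕ) : ℝ) * ((ν + 3 * (ε / 4)) * m) := by
          refine mul_le_mul_of_nonneg_left ?_ (Nat.cast_nonneg _)
          linarith
      _ = (ν + 3 * (ε / 4)) * (((n / m : ℕ) : ℝ) * m) := by ring
      _ ≤ _ := mul_le_mul_of_nonneg_left h6 (by positivity)
  linarith

theorem TailEnv.ae_eventually_le [IsProbabilityMeasure P] (h : TailEnv P t M₀ f) (hd : 2 ≤ d) :
    ∀ᵐ ω ∂P, ∀ ε : ℝ, 0 < ε → ∀ᶠ n : ℕ in atTop,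
      minTime (fun e => t e ω) 0 (axis d n) ≤ (timeConstant P t + ε) * n := by
  have h1 : ∀ᵐ ω ∂P, ∀ j : ℕ, ∀ᶠ n : ℕ in atTop,
      minTime (fun e => t e ω) 0 (axis d n) ≤ (timeConstant P t + 1 / ((j : ℝ) + 1)) * n :=
    ae_all_iff.2 fun j => h.ae_eventually_le_of_pos hd (by positivity)
  filter_upwards [h1] with ω hω ε hε
  obtain ⟨j, hj⟩ := exists_nat_one_div_lt hε
  filter_upwards [hω j] with n hn
  exact hn.trans (mul_le_mul_of_nonneg_right (by linarith) (Nat.cast_nonneg _))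

/-- The lower limit of the normalised passage times in the environment `τ`. -/
noncomputable def lowerRate (τ : Edge d → ℝ) : ℝ :=
  liminf (fun n : ℕ => minTime τ 0 (axis d n) / n) atTop

theorem measurable_lowerRate : Measurable (lowerRate (d := d)) :=
  Measurable.liminf fun _ => (measurable_minTime _ _).div_const _

theorem lowerRate_bounds {τ : Edge d → ℝ} (hτ : ∀ e, 0 ≤ τ e) {b : ℝ}
    (hb : ∀ᶠ n : ℕ in atTop, minTime τ 0 (axis d n) ≤ b * n) :
    IsBoundedUnder (· ≤ ·) atTop (fun n : ℕ => minTime τ 0 (axis d n) / n) ∧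
    IsBoundedUnder (· ≥ ·) atTop (fun n : ℕ => minTime τ 0 (axis d n) / n) := by
  constructor
  · refine ⟨b, ?_⟩
    rw [eventually_map]
    filter_upwards [hb, eventually_gt_atTop 0] with n hn hn0
    rw [div_le_iff₀ (by exact_mod_cast hn0)]
    exact hn
  · exact isBoundedUnder_of ⟨0, fun _ => div_nonneg (minTime_nonneg hτ _ _) (Nat.cast_nonneg _)⟩

theorem lowerRate_nonneg {τ : Edge d → ℝ} (hτ : ∀ e, 0 ≤ τ e) {b : ℝ}
    (hb : ∀ᶠ n : ℕ in atTop, minTime τ 0 (axis d n) ≤ b * n) : 0 ≤ lowerRate τ :=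
  le_liminf_of_le (lowerRate_bounds hτ hb).1.isCoboundedUnder_ge
    (Eventually.of_forall fun _ => div_nonneg (minTime_nonneg hτ _ _) (Nat.cast_nonneg _))

theorem exists_lt_of_lowerRate_lt {τ : Edge d → ℝ} (hτ : ∀ e, 0 ≤ τ e) {b : ℝ}
    (hb : ∀ᶠ n : ℕ in atTop, minTime τ 0 (axis d n) ≤ b * n) {q : ℝ} (hq : lowerRate τ < q) :
    ∃ᶠ n : ℕ in atTop, minTime τ 0 (axis d n) < q * n := by
  have h1 := frequently_lt_of_liminf_lt (lowerRate_bounds hτ hb).1.isCoboundedUnder_ge hq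
  refine (h1.and_eventually (eventually_gt_atTop 0)).mono fun n hn => ?_
  have : (0 : ℝ) < n := by exact_mod_cast hn.2
  exact (div_lt_iff₀ this).1 hn.1

/-- Moving the starting point along the axis does not increase the lower rate. -/
theorem lowerRate_shift_le {τ : Edge d → ℝ} (hτ : ∀ e, 0 ≤ τ e) {b : ℝ}
    (hb : ∀ᶠ n : ℕ in atTop, minTime τ 0 (axis d n) ≤ b * n) (k : ℕ) :
    lowerRate (fun e => τ ((shift (axis d k)).mapEdgeSet e)) ≤ lowerRate τ := by
  refine le_of_forall_pos_le_add fun ε hε => ?_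
  have hφ := lowerRate_nonneg hτ hb
  have h1 := exists_lt_of_lowerRate_lt hτ hb
    (show lowerRate τ < lowerRate τ + ε / 2 by linarith)
  refine liminf_le_of_frequently_le ?_ (isBoundedUnder_of ⟨0, fun _ =>
    div_nonneg (minTime_nonneg (fun e => hτ _) _ _) (Nat.cast_nonneg _)⟩)
  have hlarge : ∀ᶠ n : ℕ in atTop, minTime τ (axis d k) 0 + (lowerRate τ + ε / 2) * k ≤
      ε / 2 * n := by
    have := (tendsto_natCast_atTop_atTop (R := ℝ)).const_mul_atTop (show 0 < ε / 2 by positivity)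
    exact this.eventually_ge_atTop _
  rw [frequently_atTop] at h1 ⊢
  obtain ⟨N, hN⟩ := eventually_atTop.1 hlarge
  intro a
  obtain ⟨n, hn, hlt⟩ := h1 (a + N + k + 1)
  obtain ⟨l, rfl⟩ : ∃ l, n = k + l := ⟨n - k, by omega⟩
  refine ⟨l, by omega, ?_⟩
  have hl0 : (0 : ℝ) < l := by exact_mod_cast (show 0 < l by omega)
  have h2 := hN l (by omega)
  rw [div_le_iff₀ hl0, minTime_comp (shift _) hτ, shift_apply, shift_apply, zero_add, add_comm,
    ← axis_add]
  have h3 := minTime_triangle hτ (axis d k) 0 (axis d ((k + l : ℕ) : ℤ))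
  push_cast at h3 hlt ⊢
  linarith

/-- The deterministic covering step: if from every site `k` that is not bad there is a cheap step of
length at most `N`, then the passage time to `M` is cheap up to the cost of the edges at bad sites and
of the last `N` edges. -/
theorem minTime_le_of_cheap_steps {τ : Edge d → ℝ} (hτ : ∀ e, 0 ≤ τ e) {ψ : ℝ}
    (hψ : 0 ≤ ψ) {N M : ℕ} (bad : ℕ → Prop) [DecidablePred bad]
    (hgood : ∀ k, ¬ bad k → ∃ n : ℕ, 1 ≤ n ∧ n ≤ N ∧
      minTime τ (axis d k) (axis d (k + n : ℕ)) ≤ ψ * n) (r j : ℕ) (hj : j + r = M) :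
    minTime τ (axis d j) (axis d M) ≤ ψ * r + ∑ k ∈ Finset.Ico j M,
      if bad k ∨ M < k + N then τ (axisEdge d k) else 0 := by
  induction r using Nat.strong_induction_on generalizing j with
  | _ r ih =>
  rcases Nat.eq_zero_or_pos r with rfl | hr
  · obtain rfl : j = M := by omega
    simp [minTime_self hτ]
  · by_cases hbad : bad j ∨ M < j + N
    · have h1 := ih (r - 1) (by omega) (j + 1) (by omega)
      have h2 := minTime_triangle hτ (axis d j) (axis d (j + 1 : ℕ)) (axis d M)
      have h3 : minTime τ (axis d j) (axis d (j + 1 : ℕ)) ≤ τ (axisEdge d j) := by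
        rw [Nat.cast_add, Nat.cast_one, axis_add]
        exact minTime_edgeAt hτ _ _
      have h4 : ψ * ((r - 1 : ℕ) : ℝ) ≤ ψ * r :=
        mul_le_mul_of_nonneg_left (by exact_mod_cast Nat.sub_le r 1) hψ
      rw [Finset.sum_eq_sum_Ico_succ_bot (by omega), if_pos hbad]
      linarith
    · obtain ⟨n, hn1, hnN, hn⟩ := hgood j fun hb => hbad (Or.inl hb)
      have hjn : j + n ≤ M := by
        have : ¬ M < j + N := fun hb => hbad (Or.inr hb)
        omega
      have h1 := ih (r - n) (by omega) (j + n) (by omega)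
      have h2 := minTime_triangle hτ (axis d j) (axis d (j + n : ℕ)) (axis d M)
      have h3 : ∑ k ∈ Finset.Ico (j + n) M, (if bad k ∨ M < k + N then τ (axisEdge d k) else 0) ≤
          ∑ k ∈ Finset.Ico j M, if bad k ∨ M < k + N then τ (axisEdge d k) else 0 := by
        refine Finset.sum_le_sum_of_subset_of_nonneg
          (Finset.Ico_subset_Ico_left (by omega)) fun k _ _ => ?_
        split_ifs
        exacts [hτ _, le_rfl]
      have h4 : ((r - n : ℕ) : ℝ) = r - n := Nat.cast_sub (by omega)
      rw [h4] at h1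
      linarith

end

section

variable {d : ℕ} [NeZero d] {Ω : Type*} [MeasurableSpace Ω] {P : Measure Ω}
  {t : Edge d → Ω → ℝ} {M₀ : ℝ} {f : ℝ → ℝ}

/-- The environment has no step of length at most `N` from the origin along the axis whose cost
is within `η` per unit length of the lower rate. -/
def NoCheapStep (η : ℝ) (N : ℕ) (τ : Edge d → ℝ) : Prop :=
  ∀ n : ℕ, 1 ≤ n → n ≤ N → (lowerRate τ + η) * n < minTime τ 0 (axis d n)

theorem measurableSet_noCheapStep (η : ℝ) (N : ℕ) :
    MeasurableSet {τ : Edge d → ℝ | NoCheapStep η N τ} := by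
  have : {τ : Edge d → ℝ | NoCheapStep η N τ} = ⋂ n : ℕ, ⋂ _ : 1 ≤ n, ⋂ _ : n ≤ N,
      {τ | (lowerRate τ + η) * n < minTime τ 0 (axis d n)} := by
    ext τ; simp [NoCheapStep]
  rw [this]
  exact MeasurableSet.iInter fun n => MeasurableSet.iInter fun _ => MeasurableSet.iInter fun _ =>
    measurableSet_lt ((measurable_lowerRate.add_const η).mul_const _) (measurable_minTime _ _)

open Classical in
/-- The cost of the first axis edge on the event that there is no cheap step. -/
noncomputable def badCost (η : ℝ) (N : ℕ) (τ : Edge d → ℝ) : ℝ :=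
  if NoCheapStep η N τ then τ (axisEdge d 0) else 0

theorem measurable_badCost (η : ℝ) (N : ℕ) : Measurable (badCost (d := d) η N) :=
  Measurable.ite (measurableSet_noCheapStep η N) (measurable_pi_apply _) measurable_const

theorem badCost_nonneg {τ : Edge d → ℝ} (hτ : ∀ e, 0 ≤ τ e) (η : ℝ) (N : ℕ) :
    0 ≤ badCost η N τ := by
  unfold badCost
  split_ifs
  exacts [hτ _, le_rfl]

theorem badCost_le {τ : Edge d → ℝ} (hτ : ∀ e, 0 ≤ τ e) (η : ℝ) (N : ℕ) :
    badCost η N τ ≤ τ (axisEdge d 0) := by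
  unfold badCost
  split_ifs
  exacts [le_rfl, hτ _]

theorem TailEnv.integrable_badCost [IsProbabilityMeasure P] (h : TailEnv P t M₀ f) (hd : 2 ≤ d)
    (η : ℝ) (N : ℕ) : Integrable (fun ω => badCost η N fun e => t e ω) P := by
  refine (h.integrable hd (axisEdge d 0)).mono'
    ((measurable_badCost η N).comp h.measurable_env).aestronglyMeasurable (ae_of_all _ fun ω => ?_)
  rw [Real.norm_eq_abs, abs_of_nonneg (badCost_nonneg (fun e => h.nonneg e ω) η N)]
  exact badCost_le (fun e => h.nonneg e ω) η N

theorem TailEnv.tendsto_integral_badCost [IsProbabilityMeasure P] (h : TailEnv P t M₀ f)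
    (hd : 2 ≤ d) {η : ℝ} (hη : 0 < η) :
    Tendsto (fun N => ∫ ω, badCost η N (fun e => t e ω) ∂P) atTop (𝓝 0) := by
  rw [← integral_zero Ω ℝ (μ := P)]
  refine tendsto_integral_of_dominated_convergence (fun ω => t (axisEdge d 0) ω)
    (fun N => ((measurable_badCost η N).comp h.measurable_env).aestronglyMeasurable)
    (h.integrable hd _) (fun N => ae_of_all _ fun ω => ?_) ?_
  · rw [Real.norm_eq_abs, abs_of_nonneg (badCost_nonneg (fun e => h.nonneg e ω) η N)]
    exact badCost_le (fun e => h.nonneg e ω) η N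
  · filter_upwards [h.ae_eventually_le hd] with ω hω
    have h1 := exists_lt_of_lowerRate_lt (fun e => h.nonneg e ω) (hω 1 one_pos)
      (lt_add_of_pos_right (lowerRate fun e => t e ω) hη)
    obtain ⟨n, hn, hn1⟩ := (h1.and_eventually (eventually_ge_atTop 1)).exists
    refine tendsto_const_nhds.congr' ?_
    filter_upwards [eventually_ge_atTop n] with N hN
    rw [badCost, if_neg]
    intro hb
    exact lt_asymm hn (hb n hn1 hN)

theorem TailEnv.integral_badCost_shift [IsProbabilityMeasure P] (h : TailEnv P t M₀ f)
    (η : ℝ) (N k : ℕ) :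
    ∫ ω, badCost η N (fun e => t ((shift (axis d k)).mapEdgeSet e) ω) ∂P =
      ∫ ω, badCost η N (fun e => t e ω) ∂P :=
  ((h.identDistrib (shift (axis d k)).mapEdgeSet.injective).comp
    (measurable_badCost η N)).integral_eq

theorem TailEnv.ae_lowerRate_le [IsProbabilityMeasure P] (h : TailEnv P t M₀ f) (hd : 2 ≤ d) :
    ∀ᵐ ω ∂P, 0 ≤ lowerRate (fun e => t e ω) ∧ lowerRate (fun e => t e ω) ≤ timeConstant P t := by
  filter_upwards [h.ae_eventually_le hd] with ω hω
  have hτ : ∀ e, 0 ≤ t e ω := fun e => h.nonneg e ω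
  refine ⟨lowerRate_nonneg (τ := fun e => t e ω) hτ (hω 1 one_pos),
    le_of_forall_pos_le_add fun ε hε => ?_⟩
  refine liminf_le_of_frequently_le (Eventually.frequently ?_)
    (lowerRate_bounds (τ := fun e => t e ω) hτ (hω 1 one_pos)).2
  filter_upwards [hω ε hε, eventually_gt_atTop 0] with n hn hn0
  rw [div_le_iff₀ (by exact_mod_cast hn0)]
  exact hn

theorem TailEnv.integrable_lowerRate [IsProbabilityMeasure P] (h : TailEnv P t M₀ f)
    (hd : 2 ≤ d) : Integrable (fun ω => lowerRate fun e => t e ω) P := by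
  refine (integrable_const (timeConstant P t)).mono'
    (measurable_lowerRate.comp h.measurable_env).aestronglyMeasurable ?_
  filter_upwards [h.ae_lowerRate_le hd] with ω hω
  rw [Real.norm_eq_abs, abs_of_nonneg hω.1]
  exact hω.2

/-- The covering argument for the lower limit of a subadditive process: chaining cheap steps
from all but a small proportion of the sites bounds mean passage times by the mean lower rate. -/
theorem TailEnv.timeConstant_le_integral_lowerRate [IsProbabilityMeasure P]
    (h : TailEnv P t M₀ f) (hd : 2 ≤ d) :
    timeConstant P t ≤ ∫ ω, lowerRate (fun e => t e ω) ∂P := by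
  classical
  set ν := timeConstant P t with hν
  set I := ∫ ω, lowerRate (fun e => t e ω) ∂P with hI
  refine le_of_forall_pos_le_add fun η hη => ?_
  have key : ∀ N : ℕ, ν ≤ I + η + ∫ ω, badCost η N (fun e => t e ω) ∂P := by
    intro N
    set β := ∫ ω, badCost η N (fun e => t e ω) ∂P with hβ
    set κ := ∫ ω, t (axisEdge d 0) ω ∂P with hκ
    have hM : ∀ M : ℕ, ν * M ≤ (I + η + β) * M + N * κ := by
      intro M
      have hpt : ∀ᵐ ω ∂P, minTime (fun e => t e ω) 0 (axis d M) ≤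
          (lowerRate (fun e => t e ω) + η) * M +
          ∑ k ∈ Finset.range M, badCost η N (fun e => t ((shift (axis d k)).mapEdgeSet e) ω) +
          ∑ k ∈ Finset.Ico (M - N) M, t (axisEdge d k) ω := by
        filter_upwards [h.ae_eventually_le hd, h.ae_lowerRate_le hd] with ω hω hω'
        have hτ : ∀ e, 0 ≤ t e ω := fun e => h.nonneg e ω
        have h1 := minTime_le_of_cheap_steps (τ := fun e => t e ω) hτ
          (ψ := lowerRate (fun e => t e ω) + η) (by linarith [hω'.1]) (N := N) (M := M)
          (fun k => NoCheapStep η N fun e => t ((shift (axis d k)).mapEdgeSet e) ω)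
          (fun k hk => by
            simp only [NoCheapStep, not_forall, not_lt] at hk
            obtain ⟨n, hn1, hnN, hn⟩ := hk
            refine ⟨n, hn1, hnN, ?_⟩
            rw [minTime_comp (shift (axis d k)) (τ := fun e => t e ω) hτ, shift_apply,
              shift_apply, zero_add, ← axis_add, add_comm] at hn
            rw [Nat.cast_add]
            refine hn.trans (mul_le_mul_of_nonneg_right ?_ (Nat.cast_nonneg _))
            have := lowerRate_shift_le (τ := fun e => t e ω) hτ (hω 1 one_pos) k
            linarith) M 0 (zero_add M)
        rw [Nat.cast_zero, axis_zero, ← Finset.range_eq_Ico] at h1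
        refine h1.trans ?_
        rw [add_assoc]
        refine add_le_add le_rfl ?_
        have h2 : ∑ k ∈ Finset.Ico (M - N) M, t (axisEdge d k) ω =
            ∑ k ∈ Finset.range M, if M - N ≤ k then t (axisEdge d k) ω else 0 := by
          rw [← Finset.sum_filter]
          refine Finset.sum_congr ?_ fun _ _ => rfl
          ext k
          simp [and_comm]
        rw [h2, ← Finset.sum_add_distrib]
        refine Finset.sum_le_sum fun k hk => ?_
        rw [badCost, shift_axisEdge, zero_add]
        have h3 := hτ (axisEdge d k)
        split_ifs with h4 h5 h6 h6 h5 h6 <;> first | linarith | skip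
        · exact absurd h4 (by push Not; exact ⟨h5, by omega⟩)
      have hint1 : Integrable (fun ω => (lowerRate (fun e => t e ω) + η) * M) P :=
        ((h.integrable_lowerRate hd).add (integrable_const η)).mul_const _
      have hint2 : Integrable (fun ω => ∑ k ∈ Finset.range M,
          badCost η N (fun e => t ((shift (axis d k)).mapEdgeSet e) ω)) P :=
        integrable_finsetSum _ fun k _ =>
          (h.reindex (shift (axis d k)).mapEdgeSet.injective).integrable_badCost hd η N
      have hint3 : Integrable (fun ω => ∑ k ∈ Finset.Ico (M - N) M, t (axisEdge d k) ω) P :=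
        integrable_finsetSum _ fun k _ => h.integrable hd _
      have hint0 : Integrable (fun ω => minTime (fun e => t e ω) 0 (axis d M)) P := by
        refine (h.integrable_axisSum hd M).mono' (h.measurable_minTime _ _).aestronglyMeasurable
          (ae_of_all _ fun ω => ?_)
        rw [Real.norm_eq_abs, abs_of_nonneg (minTime_nonneg (fun e => h.nonneg e ω) _ _)]
        exact minTime_axis_le (τ := fun e => t e ω) (fun e => h.nonneg e ω) M
      have h1 := integral_mono_ae hint0 ((hint1.add hint2).add hint3) hpt
      have h2 := h.timeConstant_mul_le M
      have e1 : ∫ ω, (lowerRate (fun e => t e ω) + η) * M ∂P = (I + η) * M := by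
        rw [integral_mul_const, integral_add (h.integrable_lowerRate hd) (integrable_const η)]
        simp [hI]
      have e2 : ∫ ω, ∑ k ∈ Finset.range M,
          badCost η N (fun e => t ((shift (axis d k)).mapEdgeSet e) ω) ∂P = M * β := by
        rw [integral_finsetSum _ (f := fun (k : ℕ) ω =>
          badCost η N (fun e => t ((shift (axis d k)).mapEdgeSet e) ω)) fun k _ =>
          (h.reindex (shift (axis d k)).mapEdgeSet.injective).integrable_badCost hd η N]
        simp only [h.integral_badCost_shift, Finset.sum_const, Finset.card_range, nsmul_eq_mul, hβ]
      have e3 : ∫ ω, ∑ k ∈ Finset.Ico (M - N) M, t (axisEdge d k) ω ∂P ≤ N * κ := by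
        rw [integral_finsetSum _ fun k _ => h.integrable hd _]
        have hk : ∀ k : ℕ, ∫ ω, t (axisEdge d k) ω ∂P = κ := fun k =>
          (h.ident (axisEdge d k) (axisEdge d 0)).integral_eq
        simp only [hk, Finset.sum_const, Nat.card_Ico, nsmul_eq_mul]
        have hκ0 : 0 ≤ κ := integral_nonneg fun ω => h.nonneg _ ω
        refine mul_le_mul_of_nonneg_right ?_ hκ0
        exact_mod_cast (by omega : M - (M - N) ≤ N)
      have h3 : ∫ ω, (((fun ω => (lowerRate (fun e => t e ω) + η) * M) + (fun ω => ∑ k ∈ Finset.range M,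
          badCost η N (fun e => t ((shift (axis d k)).mapEdgeSet e) ω))) + fun ω =>
          ∑ k ∈ Finset.Ico (M - N) M, t (axisEdge d k) ω) ω ∂P ≤ (I + η + β) * M + N * κ := by
        rw [integral_add' (hint1.add hint2) hint3, integral_add' hint1 hint2, e1, e2]
        linarith
      exact h2.trans (h1.trans h3)
    by_contra hc
    obtain ⟨M, hMlt⟩ := exists_nat_gt (N * κ / (ν - (I + η + β)))
    rw [div_lt_iff₀ (by linarith)] at hMlt
    have := hM M
    linarith
  have := ge_of_tendsto' ((h.tendsto_integral_badCost hd hη).const_add (I + η)) key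
  linarith

/-- Almost sure convergence of the normalised passage times to the time constant. -/
theorem TailEnv.ae_tendsto [IsProbabilityMeasure P] (h : TailEnv P t M₀ f) (hd : 2 ≤ d) :
    ∀ᵐ ω ∂P, Tendsto (fun n : ℕ => minTime (fun e => t e ω) 0 (axis d n) / n) atTop
      (𝓝 (timeConstant P t)) := by
  set ν := timeConstant P t with hν
  have h1 : 0 ≤ᵐ[P] fun ω => ν - lowerRate (fun e => t e ω) := by
    filter_upwards [h.ae_lowerRate_le hd] with ω hω
    simpa using hω.2
  have h2 : ∫ ω, (ν - lowerRate (fun e => t e ω)) ∂P = 0 := by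
    refine le_antisymm ?_ (integral_nonneg_of_ae h1)
    rw [integral_sub (integrable_const _) (h.integrable_lowerRate hd)]
    have := h.timeConstant_le_integral_lowerRate hd
    simp
    linarith
  have h3 := (integral_eq_zero_iff_of_nonneg_ae h1
    ((integrable_const _).sub (h.integrable_lowerRate hd))).1 h2
  filter_upwards [h3, h.ae_eventually_le hd] with ω hω hle
  have hτ : ∀ e, 0 ≤ t e ω := fun e => h.nonneg e ω
  have hb := lowerRate_bounds (τ := fun e => t e ω) hτ (hle 1 one_pos)
  have hω' : lowerRate (fun e => t e ω) = ν := by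
    simp only [Pi.zero_apply] at hω
    linarith
  refine tendsto_of_le_liminf_of_limsup_le hω'.ge ?_ hb.1 hb.2
  refine le_of_forall_pos_le_add fun ε hε => ?_
  refine limsup_le_of_le hb.2.isCoboundedUnder_le ?_
  filter_upwards [hle ε hε, eventually_gt_atTop 0] with n hn hn0
  rw [div_le_iff₀ (by exact_mod_cast hn0)]
  exact hn

end

/-! ### Averaging over the endpoints in a cube -/

/-- The cube `{0, …, L}^d`. -/
noncomputable def cube (d L : ℕ) : Finset (Fin d → ℤ) := Fintype.piFinset fun _ => Finset.Icc (0 : ℤ) L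

theorem mem_cube {d L : ℕ} {x : Fin d → ℤ} : x ∈ cube d L ↔ ∀ j, 0 ≤ x j ∧ x j ≤ L := by
  simp [cube, Fintype.mem_piFinset]

theorem card_cube (d L : ℕ) : (cube d L).card = (L + 1) ^ d := by
  simp [cube, Fintype.card_piFinset]

theorem cube_mono {d L L' : ℕ} (h : L ≤ L') : cube d L ⊆ cube d L' := fun x hx =>
  mem_cube.2 fun j => ⟨(mem_cube.1 hx j).1, (mem_cube.1 hx j).2.trans (by exact_mod_cast h)⟩

/-- The sup-norm of a lattice point, but at least `1`. -/
def rad {d : ℕ} (x : Fin d → ℤ) : ℕ := max 1 (Finset.univ.sup fun j => (x j).natAbs)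

theorem one_le_rad {d : ℕ} (x : Fin d → ℤ) : 1 ≤ rad x := le_max_left _ _

theorem rad_le_iff {d : ℕ} {x : Fin d → ℤ} {R : ℕ} (hR : 1 ≤ R) :
    rad x ≤ R ↔ ∀ j, (x j).natAbs ≤ R := by
  simp [rad, hR]

theorem mem_cube_iff_rad {d L R : ℕ} {x : Fin d → ℤ} (hx : x ∈ cube d L) (hR : 1 ≤ R) :
    x ∈ cube d R ↔ rad x ≤ R := by
  rw [rad_le_iff hR, mem_cube]
  refine forall_congr' fun j => ?_
  have := mem_cube.1 hx j
  omega

/-- Halve the first `i` coordinates. -/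
def halve {d : ℕ} (i : ℕ) (w : Fin d → ℤ) : Fin d → ℤ := fun j => if (j : ℕ) < i then w j / 2 else w j

theorem halve_zero {d : ℕ} (w : Fin d → ℤ) : halve 0 w = w := by
  ext j; simp [halve]

theorem sum_comp_le_sum_of_injOn {ι κ : Type*} {s : Finset ι} {u : Finset κ} (g : κ → ℝ) (φ : ι → κ)
    (hφ : ∀ i ∈ s, φ i ∈ u) (hinj : Set.InjOn φ s) (hg : ∀ k, 0 ≤ g k) :
    ∑ i ∈ s, g (φ i) ≤ ∑ k ∈ u, g k := by
  classical
  rw [← Finset.sum_image hinj]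
  exact Finset.sum_le_sum_of_subset_of_nonneg (Finset.image_subset_iff.2 hφ) fun _ _ _ => hg _

section

variable {d : ℕ} {τ : Edge d → ℝ}

theorem minTime_halve_succ_le (hτ : ∀ e, 0 ≤ τ e) {L : ℕ} {w : Fin d → ℤ} (hw : w ∈ cube d L)
    (i : Fin d) :
    minTime τ (halve (i + 1) w) (halve i w) ≤
      ∑ c ∈ Finset.Icc (0 : ℤ) L, τ (edgeAt (Function.update (halve i w) i c) i) := by
  have hwi := mem_cube.1 hw i
  obtain ⟨k, hk⟩ := Int.eq_ofNat_of_zero_le (show 0 ≤ w i - w i / 2 by omega)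
  have h1 := minTime_line hτ (halve (i + 1) w) i k
  have h2 : ∀ c : ℤ, halve (i + 1) w + Pi.single i c =
      Function.update (halve i w) i (w i / 2 + c) := by
    intro c
    ext j
    by_cases hj : j = i
    · subst hj; simp [halve]
    · have : (j : ℕ) ≠ i := fun h => hj (Fin.ext h)
      simp only [halve, Pi.add_apply, Pi.single_eq_of_ne hj, Function.update_of_ne hj, add_zero]
      congr 1
      exact propext (by omega)
  have h3 : halve (i + 1) w + Pi.single i (k : ℤ) = halve i w := by
    rw [h2, ← hk]
    have : w i / 2 + (w i - w i / 2) = halve i w i := by simp [halve]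
    rw [this, Function.update_eq_self]
  rw [h3] at h1
  refine h1.trans ?_
  simp only [h2]
  refine sum_comp_le_sum_of_injOn (fun c => τ (edgeAt (Function.update (halve i w) i c) i))
    (fun l : ℕ => w i / 2 + (l : ℤ)) (fun l hl => ?_) (fun a _ b _ hab => ?_) fun _ => hτ _
  · have := Finset.mem_range.1 hl
    rw [Finset.mem_Icc]
    omega
  · have : w i / 2 + (a : ℤ) = w i / 2 + (b : ℤ) := hab
    omega

theorem mod_two_mem_cube (w : Fin d → ℤ) : (fun j => w j % 2) ∈ cube d 1 :=
  mem_cube.2 fun j => by omega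

theorem sum_minTime_halve_succ_le (hτ : ∀ e, 0 ≤ τ e) (L : ℕ) (i : Fin d) :
    ∑ w ∈ cube d L, minTime τ (halve (i + 1) w) (halve i w) ≤
      2 ^ d * (L + 1) * ∑ x ∈ cube d L, τ (edgeAt x i) := by
  refine (Finset.sum_le_sum fun w hw => minTime_halve_succ_le hτ hw i).trans ?_
  rw [← Finset.sum_product']
  -- the new point, the old `i`-th coordinate and the parities determine the old point
  refine (sum_comp_le_sum_of_injOn (u := cube d L ×ˢ (Finset.Icc (0 : ℤ) L ×ˢ cube d 1))
    (fun p => τ (edgeAt p.1 i)) (fun p : (Fin d → ℤ) × ℤ =>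
      (Function.update (halve i p.1) i p.2, (p.1 i, fun j => p.1 j % 2)))
    (fun p hp => ?_) (fun p _ q _ hpq => ?_) fun _ => hτ _).trans_eq ?_
  · obtain ⟨h1, h2⟩ := Finset.mem_product.1 hp
    rw [Finset.mem_Icc] at h2
    refine Finset.mem_product.2 ⟨mem_cube.2 fun j => ?_, Finset.mem_product.2 ⟨?_,
      mod_two_mem_cube p.1⟩⟩
    · have h3 := mem_cube.1 h1 j
      by_cases hj : j = i
      · subst hj; simpa using h2
      · simp only [Function.update_of_ne hj, halve]
        split_ifs <;> omega
    · exact Finset.mem_Icc.2 (mem_cube.1 h1 i)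
  · simp only [Prod.mk.injEq] at hpq
    obtain ⟨h1, h2, h3⟩ := hpq
    refine Prod.ext (funext fun j => ?_) ?_
    · by_cases hj : j = i
      · rw [hj, h2]
      · have h4 := congrFun h1 j
        have h5 := congrFun h3 j
        simp only [Function.update_of_ne hj, halve] at h4 h5
        split_ifs at h4 <;> omega
    · simpa using congrFun h1 i
  · rw [Finset.sum_product]
    simp only [Finset.sum_const, Finset.card_product, card_cube, Int.card_Icc, nsmul_eq_mul]
    rw [← Finset.mul_sum]
    congr 1
    have : ((L : ℤ) + 1 - 0).toNat = L + 1 := by omega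
    rw [this]
    push_cast
    ring

/-- One step of the halving recursion: every point of the cube is joined to the point with halved
coordinates, and at most `2 ^ d` points are halved to the same point. -/
theorem sum_minTime_cube_le (hτ : ∀ e, 0 ≤ τ e) (L : ℕ) :
    ∑ w ∈ cube d L, minTime τ 0 w ≤ 2 ^ d * (L + 1) * ∑ x ∈ cube d L, ∑ i, τ (edgeAt x i) +
      2 ^ d * ∑ w ∈ cube d (L / 2), minTime τ 0 w := by
  have hchain : ∀ (w : Fin d → ℤ) (k : ℕ) (hk : k ≤ d), minTime τ 0 w ≤ minTime τ 0 (halve k w) +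
      ∑ i ∈ Finset.univ.filter (fun i : Fin d => (i : ℕ) < k),
        minTime τ (halve (i + 1) w) (halve i w) := by
    intro w k hk
    induction k with
    | zero => simp [halve_zero]
    | succ k ih =>
      have h1 := minTime_triangle hτ 0 (halve (k + 1) w) (halve k w)
      have h2 : Finset.univ.filter (fun i : Fin d => (i : ℕ) < k + 1) =
          insert ⟨k, hk⟩ (Finset.univ.filter fun i : Fin d => (i : ℕ) < k) := by
        ext i
        simp [Fin.ext_iff]
        omega
      rw [h2, Finset.sum_insert (by simp)]
      have := ih (by omega)
      simp only
      linarith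
  have h1 : ∀ w : Fin d → ℤ, minTime τ 0 w ≤ minTime τ 0 (halve d w) +
      ∑ i : Fin d, minTime τ (halve (i + 1) w) (halve i w) := by
    intro w
    have := hchain w d le_rfl
    rwa [Finset.filter_true_of_mem fun i _ => i.2] at this
  refine (Finset.sum_le_sum fun w _ => h1 w).trans ?_
  rw [Finset.sum_add_distrib, add_comm, Finset.sum_comm]
  refine add_le_add ?_ ?_
  · refine (Finset.sum_le_sum fun i _ => sum_minTime_halve_succ_le hτ L i).trans ?_
    rw [← Finset.mul_sum, Finset.sum_comm]
  · refine (sum_comp_le_sum_of_injOn (u := cube d (L / 2) ×ˢ cube d 1)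
      (fun p => minTime τ 0 p.1) (fun w : Fin d → ℤ => (halve d w, fun j => w j % 2))
      (fun w hw => ?_) (fun w _ w' _ h => ?_) fun _ => minTime_nonneg hτ _ _).trans_eq ?_
    · refine Finset.mem_product.2 ⟨mem_cube.2 fun j => ?_, mod_two_mem_cube w⟩
      have := mem_cube.1 hw j
      simp only [halve, j.2, if_true]
      omega
    · ext j
      have h2 := congrFun (Prod.mk.inj h).1 j
      have h3 := congrFun (Prod.mk.inj h).2 j
      simp only [halve, j.2, if_true] at h2 h3
      omega
    · rw [Finset.sum_product]
      simp only [Finset.sum_const, card_cube, nsmul_eq_mul]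
      rw [← Finset.mul_sum]
      norm_num

/-- The passage time from the origin to a uniform point of a cube is, on average, at most a
weighted sum of edge values with weights of order `|x| ^ (-(d - 1))`, the Green-type decay of a
flow spreading out in `d` dimensions. -/
theorem sum_minTime_cube_le_weighted (hd : 2 ≤ d) (hτ : ∀ e, 0 ≤ τ e) (L : ℕ) :
    ∑ w ∈ cube d L, minTime τ 0 w ≤ (L : ℝ) ^ d * ∑ x ∈ cube d L,
      2 ^ (d + 1) * (2 / (rad x : ℝ) ^ (d - 1) - 1 / (L : ℝ) ^ (d - 1)) * ∑ i, τ (edgeAt x i) := by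
  induction L using Nat.strong_induction_on with
  | _ L ih =>
  rcases Nat.eq_zero_or_pos L with rfl | hL
  · have : ∀ w ∈ cube d 0, minTime τ 0 w = 0 := by
      intro w hw
      have : w = 0 := by
        ext j
        have := mem_cube.1 hw j
        simp at this ⊢
        omega
      rw [this, minTime_self hτ]
    rw [Finset.sum_eq_zero this]
    simp [show d ≠ 0 by omega]
  · have hL' : (0 : ℝ) < L := by exact_mod_cast hL
    have hL1 : (1 : ℝ) ≤ L := by exact_mod_cast hL
    have hLp : (0 : ℝ) < (L : ℝ) ^ (d - 1) := by positivity
    have hLd : (L : ℝ) ^ d = L ^ (d - 1) * L := by rw [← pow_succ]; congr 1; omega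
    have hS : ∀ x : Fin d → ℤ, 0 ≤ ∑ i, τ (edgeAt x i) := fun x =>
      Finset.sum_nonneg fun _ _ => hτ _
    have hq : ∀ (R : ℕ) (x : Fin d → ℤ), 1 ≤ R → rad x ≤ R →
        0 ≤ 2 / (rad x : ℝ) ^ (d - 1) - 1 / (R : ℝ) ^ (d - 1) := by
      intro R x hR hx
      have h0 : (0 : ℝ) < rad x := by exact_mod_cast one_le_rad x
      have h1 : (1 : ℝ) / (R : ℝ) ^ (d - 1) ≤ 1 / (rad x : ℝ) ^ (d - 1) := by
        gcongr
      have h2 : (0 : ℝ) < 1 / (rad x : ℝ) ^ (d - 1) := by positivity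
      have h3 : (2 : ℝ) / (rad x : ℝ) ^ (d - 1) = 2 * (1 / (rad x : ℝ) ^ (d - 1)) := by ring
      linarith
    have h1 := ih (L / 2) (by omega)
    have h2 := sum_minTime_cube_le hτ L
    have h3 : (2 : ℝ) ^ d * ((L / 2 : ℕ) : ℝ) ^ d ≤ (L : ℝ) ^ d := by
      rw [← mul_pow]
      have : (2 : ℝ) * ((L / 2 : ℕ) : ℝ) ≤ L := by
        exact_mod_cast (by omega : 2 * (L / 2) ≤ L)
      gcongr
    set Z := ∑ x ∈ cube d (L / 2), 2 ^ (d + 1) * (2 / (rad x : ℝ) ^ (d - 1) -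
      1 / ((L / 2 : ℕ) : ℝ) ^ (d - 1)) * ∑ i, τ (edgeAt x i) with hZ
    -- if `L / 2 = 0` the sum over the smaller cube vanishes and its weights are irrelevant
    have h4 : 2 ^ d * ∑ w ∈ cube d (L / 2), minTime τ 0 w ≤ (L : ℝ) ^ d *
        ∑ x ∈ cube d L, if 1 ≤ L / 2 ∧ x ∈ cube d (L / 2) then 2 ^ (d + 1) * (2 / (rad x : ℝ) ^ (d - 1) -
          1 / ((L / 2 : ℕ) : ℝ) ^ (d - 1)) * ∑ i, τ (edgeAt x i) else 0 := by
      rcases Nat.eq_zero_or_pos (L / 2) with h0 | h0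
      · have : ∑ w ∈ cube d (L / 2), minTime τ 0 w ≤ 0 := by
          refine h1.trans_eq ?_
          rw [h0]
          simp [show d ≠ 0 by omega]
        have h5 : ∀ x : Fin d → ℤ, ¬ (1 ≤ L / 2 ∧ x ∈ cube d (L / 2)) := fun x h => by omega
        simp only [h5, if_false, Finset.sum_const_zero, mul_zero]
        exact mul_nonpos_of_nonneg_of_nonpos (by positivity) this
      · have h0' : 1 ≤ L / 2 := h0
        simp only [h0', true_and]
        rw [← Finset.sum_filter, Finset.filter_mem_eq_inter,
          Finset.inter_eq_right.2 (cube_mono (Nat.div_le_self L 2)), ← hZ]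
        have hZ0 : 0 ≤ Z := Finset.sum_nonneg fun x hx => by
          have := hq (L / 2) x h0' ((mem_cube_iff_rad hx h0').1 hx)
          have := hS x
          positivity
        calc 2 ^ d * ∑ w ∈ cube d (L / 2), minTime τ 0 w
            ≤ 2 ^ d * (((L / 2 : ℕ) : ℝ) ^ d * Z) := by gcongr
          _ = 2 ^ d * ((L / 2 : ℕ) : ℝ) ^ d * Z := by ring
          _ ≤ _ := by gcongr
    have h5 : 2 ^ d * ((L : ℝ) + 1) * ∑ x ∈ cube d L, ∑ i, τ (edgeAt x i) ≤ (L : ℝ) ^ d *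
        ∑ x ∈ cube d L, 2 ^ (d + 1) * (1 / (L : ℝ) ^ (d - 1)) * ∑ i, τ (edgeAt x i) := by
      rw [← Finset.mul_sum]
      have h6 : 0 ≤ ∑ x ∈ cube d L, ∑ i, τ (edgeAt x i) := Finset.sum_nonneg fun x _ => hS x
      have h7 : (L : ℝ) ^ d * (2 ^ (d + 1) * (1 / (L : ℝ) ^ (d - 1))) = 2 ^ d * (2 * L) := by
        rw [hLd]; field_simp; ring
      rw [← mul_assoc, h7]
      gcongr
      linarith
    refine (h2.trans (add_le_add h5 h4)).trans ?_
    rw [← mul_add, ← Finset.sum_add_distrib]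
    refine mul_le_mul_of_nonneg_left (Finset.sum_le_sum fun x hx => ?_) (by positivity)
    have hx1 := (mem_cube_iff_rad hx hL).1 hx
    split_ifs with hc
    · rw [← add_mul, ← mul_add]
      refine mul_le_mul_of_nonneg_right (mul_le_mul_of_nonneg_left ?_ (by positivity)) (hS x)
      have hh : (0 : ℝ) < ((L / 2 : ℕ) : ℝ) := by exact_mod_cast hc.1
      have h6 : 2 * (1 / (L : ℝ) ^ (d - 1)) ≤ 1 / ((L / 2 : ℕ) : ℝ) ^ (d - 1) := by
        rw [mul_one_div, div_le_div_iff₀ hLp (by positivity), one_mul]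
        have : (2 : ℝ) * ((L / 2 : ℕ) : ℝ) ≤ L := by
          exact_mod_cast (by omega : 2 * (L / 2) ≤ L)
        calc (2 : ℝ) * ((L / 2 : ℕ) : ℝ) ^ (d - 1) ≤ 2 ^ (d - 1) * ((L / 2 : ℕ) : ℝ) ^ (d - 1) := by
              gcongr
              exact le_self_pow₀ one_le_two (by omega)
          _ = (2 * ((L / 2 : ℕ) : ℝ)) ^ (d - 1) := (mul_pow _ _ _).symm
          _ ≤ _ := by gcongr
      linarith
    · rw [add_zero]
      refine mul_le_mul_of_nonneg_right (mul_le_mul_of_nonneg_left ?_ (by positivity)) (hS x)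
      have h0 : (0 : ℝ) < rad x := by exact_mod_cast one_le_rad x
      have h6 : (1 : ℝ) / (L : ℝ) ^ (d - 1) ≤ 1 / (rad x : ℝ) ^ (d - 1) := by
        gcongr
      have h7 : (2 : ℝ) / (rad x : ℝ) ^ (d - 1) = 2 * (1 / (rad x : ℝ) ^ (d - 1)) := by ring
      linarith

end

/-- The total of the weights `|x| ^ (-(d - 1))` over a cube is of the order of its side length. -/
theorem sum_cube_inv_rad_le {d : ℕ} (hd : 2 ≤ d) (L : ℕ) :
    ∑ x ∈ cube d L, 1 / (rad x : ℝ) ^ (d - 1) ≤ 2 ^ (d + 1) * (L + 1) := by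
  induction L using Nat.strong_induction_on with
  | _ L ih =>
  have hle1 : ∀ x : Fin d → ℤ, 1 / (rad x : ℝ) ^ (d - 1) ≤ 1 := fun x => by
    have : (1 : ℝ) ≤ rad x := by exact_mod_cast one_le_rad x
    rw [div_le_one (by positivity)]
    exact one_le_pow₀ this
  rcases Nat.eq_zero_or_pos L with rfl | hL
  · refine (Finset.sum_le_sum fun x _ => hle1 x).trans ?_
    rw [Finset.sum_const, card_cube]
    simpa using one_le_pow₀ (one_le_two (α := ℝ))
  · have h1 := ih (L / 2) (by omega)
    rw [← Finset.sum_sdiff (cube_mono (Nat.div_le_self L 2) : cube d (L / 2) ⊆ cube d L)]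
    have hL1 : (0 : ℝ) < (L : ℝ) + 1 := by positivity
    have h2 : ∀ x ∈ cube d L \ cube d (L / 2),
        1 / (rad x : ℝ) ^ (d - 1) ≤ 2 ^ (d - 1) / ((L : ℝ) + 1) ^ (d - 1) := by
      intro x hx
      obtain ⟨hx1, hx2⟩ := Finset.mem_sdiff.1 hx
      have hr : L + 1 ≤ 2 * rad x := by
        by_contra hc
        have h3 : rad x ≤ L / 2 := by omega
        exact hx2 ((mem_cube_iff_rad hx1 ((one_le_rad x).trans h3)).2 h3)
      have hr' : (L : ℝ) + 1 ≤ 2 * rad x := by exact_mod_cast hr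
      have h0 : (0 : ℝ) < rad x := by exact_mod_cast one_le_rad x
      rw [div_le_div_iff₀ (by positivity) (by positivity), one_mul, ← mul_pow]
      gcongr
    have h3 : ∑ x ∈ cube d L \ cube d (L / 2), 1 / (rad x : ℝ) ^ (d - 1) ≤
        2 ^ (d - 1) * (L + 1) := by
      refine (Finset.sum_le_sum h2).trans ?_
      rw [Finset.sum_const, nsmul_eq_mul]
      have h4 : (((cube d L \ cube d (L / 2)).card : ℕ) : ℝ) ≤ ((L : ℝ) + 1) ^ d := by
        have := Finset.card_le_card (Finset.sdiff_subset : cube d L \ cube d (L / 2) ⊆ cube d L)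
        rw [card_cube] at this
        exact_mod_cast this
      calc _ ≤ ((L : ℝ) + 1) ^ d * (2 ^ (d - 1) / ((L : ℝ) + 1) ^ (d - 1)) := by gcongr
        _ = _ := by
          have : ((L : ℝ) + 1) ^ d = ((L : ℝ) + 1) ^ (d - 1) * (L + 1) := by
            rw [← pow_succ]; congr 1; omega
          rw [this]; field_simp
    have h5 : (2 : ℝ) ^ (d + 1) = 4 * 2 ^ (d - 1) := by
      rw [show (4 : ℝ) = 2 ^ 2 by norm_num, ← pow_add]; congr 1; omega
    have h6 : ((L / 2 : ℕ) : ℝ) * 2 ≤ L := by exact_mod_cast Nat.div_mul_le_self L 2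
    have h7 : (0 : ℝ) < 2 ^ (d - 1) := by positivity
    have h8 : (1 : ℝ) ≤ L := by exact_mod_cast hL
    rw [h5] at h1 ⊢
    nlinarith

/-- The weights `|x| ^ (-(d - 1))` restricted to `|x| < ρ`. -/
theorem sum_filter_inv_rad_le {d : ℕ} (hd : 2 ≤ d) (L : ℕ) {ρ : ℝ} (hρ : 0 ≤ ρ) :
    ∑ x ∈ (cube d L).filter (fun x => (rad x : ℝ) < ρ), 1 / (rad x : ℝ) ^ (d - 1) ≤
      2 ^ (d + 2) * ρ := by
  rcases le_or_gt ρ 1 with h1 | h1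
  · rw [Finset.filter_false_of_mem, Finset.sum_empty]
    · positivity
    · intro x _
      have : (1 : ℝ) ≤ rad x := by exact_mod_cast one_le_rad x
      linarith
  · have hR : 1 ≤ ⌊ρ⌋₊ := Nat.le_floor (by simpa using h1.le)
    have hsub : (cube d L).filter (fun x => (rad x : ℝ) < ρ) ⊆ cube d ⌊ρ⌋₊ := by
      intro x hx
      obtain ⟨h2, h3⟩ := Finset.mem_filter.1 hx
      exact (mem_cube_iff_rad h2 hR).2 (Nat.le_floor h3.le)
    refine (Finset.sum_le_sum_of_subset_of_nonneg hsub fun _ _ _ => by positivity).trans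
      ((sum_cube_inv_rad_le hd _).trans ?_)
    have h4 := Nat.floor_le hρ
    have h5 : (0 : ℝ) < 2 ^ (d + 1) := by positivity
    rw [pow_succ (2 : ℝ) (d + 1)]
    nlinarith

/-! ### Decay of the upper tail in the summable case -/

section

variable {d : ℕ} {Ω : Type*} [MeasurableSpace Ω] {P : Measure Ω}
  {t : Edge d → Ω → ℝ} {M₀ : ℝ} {f : ℝ → ℝ}

theorem rpow_weight_pow (hd : 2 ≤ d) {y : ℝ} (hy : 0 < y) :
    (1 / y ^ (1 / ((d : ℝ) - 1))) ^ (d - 1) = 1 / y := by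
  have h1 : (1 / ((d : ℝ) - 1)) = ((d - 1 : ℕ) : ℝ)⁻¹ := by
    rw [Nat.cast_sub (by omega), Nat.cast_one, one_div]
  rw [div_pow, one_pow, h1, Real.rpow_inv_natCast_pow hy.le (by omega)]

/-- For weights decaying like `β ^ (d - 1) (n / |x|) ^ (d - 1)`, the contribution of the `j`-th dyadic
layer to the logarithmic moment generating function of the weighted sum over a cube. -/
theorem TailEnv.sum_layerBound_le (h : TailEnv P t M₀ f) (hd : 2 ≤ d) {J : ℕ} (hJ : M₀ < 2 ^ J)
    {β C : ℝ} (hβ : 0 < β) (hC : 0 < C) (n L j : ℕ) :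
    ∑ x ∈ cube d L, layerBound (halfCost d f J 0)
      (fun j => β ^ (d - 1) * n ^ (d - 1) * (C / (rad x : ℝ) ^ (d - 1)) * 2 ^ (J + j + 1))
      (halfCost d f J) j ≤
    (L + 1) ^ d * Real.exp (-halfCost d f J j) +
      β ^ (d - 1) * β * n ^ d * (2 * (1 + 1 / halfCost d f J 0) * C * 2 ^ (d + 2) *
        (4 * C / Real.log 2 + 1)) * (1 / f (2 ^ (J + j)) ^ (1 / ((d : ℝ) - 1))) := by
  have hl : 0 < Real.log 2 := Real.log_pos one_lt_two
  have hb := h.halfCost_zero_pos hJ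
  have hA : M₀ < 2 ^ (J + j) := lt_of_lt_of_le hJ (pow_le_pow_right₀ one_le_two (by omega))
  have hf := h.f_pos _ hA
  set B : ℝ := 1 + 1 / halfCost d f J 0 with hB
  have hB0 : 0 < B := by positivity
  set A : ℝ := 2 ^ (J + j) with hAdef
  have hA0 : 0 < A := by positivity
  set w : ℝ := 1 / f A ^ (1 / ((d : ℝ) - 1)) with hw
  have hw0 : 0 < w := by have := Real.rpow_pos_of_pos hf (1 / ((d : ℝ) - 1)); positivity
  have hwp : w ^ (d - 1) = 1 / f A := rpow_weight_pow hd hf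
  set D : ℝ := 4 * C / Real.log 2 + 1 with hD
  have hD1 : 1 ≤ D := by
    have : 0 < 4 * C / Real.log 2 := by positivity
    linarith
  set ρ : ℝ := D * β * n * w / A with hρ
  have hρ0 : 0 ≤ ρ := by positivity
  have hn2 : (2 : ℝ) ^ (J + j + 1) = 2 * A := by rw [hAdef, pow_succ]; ring
  have hAd : A ^ d = A ^ (d - 1) * A := by rw [← pow_succ]; congr 1; omega
  have hnd : (n : ℝ) ^ d = n ^ (d - 1) * n := by rw [← pow_succ]; congr 1; omega
  have hcond : ∀ x : Fin d → ℤ, halfCost d f J j <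
      β ^ (d - 1) * n ^ (d - 1) * (C / (rad x : ℝ) ^ (d - 1)) * 2 ^ (J + j + 1) →
      (rad x : ℝ) < ρ := by
    intro x hx
    have hr : (0 : ℝ) < rad x := by exact_mod_cast one_le_rad x
    refine lt_of_pow_lt_pow_left₀ (d - 1) hρ0 ?_
    have h1 : ρ ^ (d - 1) = D ^ (d - 1) * (β ^ (d - 1) * n ^ (d - 1)) / (f A * A ^ (d - 1)) := by
      rw [hρ, div_pow, mul_pow, mul_pow, mul_pow, hwp]
      field_simp
    have h2 : D ≤ D ^ (d - 1) := le_self_pow₀ hD1 (by omega)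
    rw [h1]
    refine lt_of_lt_of_le ?_ (div_le_div_of_nonneg_right
      (mul_le_mul_of_nonneg_right h2 (by positivity)) (by positivity))
    unfold halfCost at hx
    rw [hn2, ← hAdef, hAd] at hx
    have h3 : β ^ (d - 1) * n ^ (d - 1) * (C / (rad x : ℝ) ^ (d - 1)) * (2 * A) =
        (β ^ (d - 1) * n ^ (d - 1) * C * (2 * A)) / (rad x : ℝ) ^ (d - 1) := by ring
    rw [h3, lt_div_iff₀ (by positivity)] at hx
    rw [lt_div_iff₀ (by positivity)]
    have h4 : (rad x : ℝ) ^ (d - 1) * (f A * A ^ (d - 1)) <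
        4 * C / Real.log 2 * (β ^ (d - 1) * n ^ (d - 1)) := by
      rw [div_mul_eq_mul_div, lt_div_iff₀ hl]
      have h5 : A * (Real.log 2 * ((rad x : ℝ) ^ (d - 1) * (f A * A ^ (d - 1)))) <
          A * (4 * C * (β ^ (d - 1) * n ^ (d - 1))) := by nlinarith
      have := lt_of_mul_lt_mul_left h5 hA0.le
      linarith
    have h6 : 0 ≤ β ^ (d - 1) * (n : ℝ) ^ (d - 1) := by positivity
    rw [hD]
    linarith
  unfold layerBound
  rw [Finset.sum_add_distrib]
  refine add_le_add ?_ ?_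
  · rw [Finset.sum_const, card_cube, nsmul_eq_mul]
    push_cast
    exact le_rfl
  · have hterm : ∀ x ∈ cube d L, (if halfCost d f J j <
        β ^ (d - 1) * n ^ (d - 1) * (C / (rad x : ℝ) ^ (d - 1)) * 2 ^ (J + j + 1) then
        B * (β ^ (d - 1) * n ^ (d - 1) * (C / (rad x : ℝ) ^ (d - 1)) * 2 ^ (J + j + 1)) else 0) ≤
        if (rad x : ℝ) < ρ then
          B * β ^ (d - 1) * n ^ (d - 1) * C * (2 * A) * (1 / (rad x : ℝ) ^ (d - 1)) else 0 := by
      intro x _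
      split_ifs with h1 h2 h2
      · rw [hn2]
        exact le_of_eq (by ring)
      · exact absurd (hcond x h1) h2
      · positivity
      · exact le_rfl
    refine (Finset.sum_le_sum hterm).trans ?_
    rw [← Finset.sum_filter, ← Finset.mul_sum]
    refine (mul_le_mul_of_nonneg_left (sum_filter_inv_rad_le hd L hρ0) (by positivity)).trans_eq ?_
    rw [hρ, hnd]
    field_simp

/-- If `∑ f(2 ^ n) ^ (-1 / (d - 1))` converges, then the average passage time from the origin to a
small cube is at most `ε n` with probability at least `1 - exp (-c n ^ d)`: the exponential moment of
the weighted edge sum of `sum_minTime_cube_le_weighted` splits into dyadic layers, and the `j`-th layer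
contributes at most a multiple of `n ^ d f(2 ^ j) ^ (-1 / (d - 1))`. The constants do not
change when the edges are relabelled. -/
theorem TailEnv.measure_sum_minTime_cube_le [IsProbabilityMeasure P] (h : TailEnv P t M₀ f)
    (hd : 2 ≤ d) (hsum : Summable fun n : ℕ => 1 / f (2 ^ (n + 1)) ^ (1 / ((d : ℝ) - 1)))
    {ε : ℝ} (hε : 0 < ε) :
    ∃ δ c : ℝ, 0 < δ ∧ 0 < c ∧ ∀ σ : Edge d → Edge d, Function.Injective σ →
      ∀ n L : ℕ, (L : ℝ) + 1 ≤ δ * n →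
      P {ω | (L + 1) ^ d * (ε * n) ≤ ∑ w ∈ cube d L, minTime (fun e => t (σ e) ω) 0 w} ≤
        ENNReal.ofReal (Real.exp (-(c * n ^ d))) := by
  obtain ⟨J', hJ'⟩ := pow_unbounded_of_one_lt M₀ (one_lt_two (α := ℝ))
  obtain ⟨J, hJ1, hJ⟩ : ∃ J, 1 ≤ J ∧ M₀ < (2 : ℝ) ^ J :=
    ⟨J' + 1, by omega, hJ'.trans_le (pow_le_pow_right₀ one_le_two (by omega))⟩
  have hb := h.halfCost_zero_pos hJ
  have hl : 0 < Real.log 2 := Real.log_pos one_lt_two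
  have hd0 : (0 : ℝ) < d := by exact_mod_cast (by omega : 0 < d)
  let wt : ℕ → ℝ := fun j => 1 / f (2 ^ (J + j)) ^ (1 / ((d : ℝ) - 1))
  have hwt : Summable wt := by
    have := (summable_nat_add_iff (J - 1)).2 hsum
    refine this.congr fun j => ?_
    simp only [wt]
    rw [show j + (J - 1) + 1 = J + j by omega]
  have hwt0 : ∀ j, 0 ≤ wt j := fun j => by
    have hA : M₀ < (2 : ℝ) ^ (J + j) := lt_of_lt_of_le hJ (pow_le_pow_right₀ one_le_two (by omega))
    have := Real.rpow_pos_of_pos (h.f_pos _ hA) (1 / ((d : ℝ) - 1))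
    positivity
  have hE := h.summable_exp_neg_halfCost hd hJ
  set E : ℝ := ∑' j, Real.exp (-halfCost d f J j) with hEdef
  have hE0 : 0 ≤ E := tsum_nonneg fun _ => (Real.exp_pos _).le
  set W : ℝ := ∑' j, wt j with hW
  have hW0 : 0 ≤ W := tsum_nonneg hwt0
  set C : ℝ := 2 ^ (d + 2) with hC
  have hC0 : 0 < C := by positivity
  set C₃ : ℝ := 2 * (1 + 1 / halfCost d f J 0) * C * 2 ^ (d + 2) * (4 * C / Real.log 2 + 1) with hC3
  have hC30 : 0 < C₃ := by positivity
  -- `β` makes the layers with large values, of order `β ^ d n ^ d`, small against the linear gain of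
  -- order `β ^ (d - 1) ε n ^ d`
  set β : ℝ := ε / (8 * (d * C₃ * W + 1)) with hβ
  have hβ0 : 0 < β := by positivity
  set K : ℝ := β ^ (d - 1) with hK
  have hK0 : 0 < K := by positivity
  have hβW : d * C₃ * W * β ≤ ε / 8 := by
    rw [hβ, mul_div_assoc', div_le_div_iff₀ (by positivity) (by norm_num)]
    nlinarith
  -- `δ` controls the values below `2 ^ J` and the layers that are unlikely at the given tilt; both
  -- are proportional to the size of the cube
  set δ : ℝ := min 1 (min (ε / (2 * (d * 2 ^ J * C * 2 ^ (d + 1)))) (K * ε / (8 * (d * E + 1))))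
    with hδ
  have hδ0 : 0 < δ := by
    refine lt_min one_pos (lt_min ?_ ?_) <;> positivity
  have hδ1 : δ ≤ 1 := min_le_left _ _
  have hδ2 : d * 2 ^ J * C * 2 ^ (d + 1) * δ ≤ ε / 2 := by
    have : δ ≤ ε / (2 * (d * 2 ^ J * C * 2 ^ (d + 1))) := (min_le_right _ _).trans (min_le_left _ _)
    rw [le_div_iff₀ (by positivity)] at this
    linarith
  have hδ3 : d * E * δ ≤ K * ε / 8 := by
    have h1 : δ ≤ K * ε / (8 * (d * E + 1)) := (min_le_right _ _).trans (min_le_right _ _)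
    rw [le_div_iff₀ (by positivity)] at h1
    nlinarith
  refine ⟨δ, K * ε / 4, hδ0, by positivity, ?_⟩
  intro σ hσ n L hL
  have h' := h.reindex hσ
  set u : Edge d → Ω → ℝ := fun e => t (σ e) with hu
  let s : (Fin d → ℤ) → ℝ := fun x => K * n ^ (d - 1) * (C / (rad x : ℝ) ^ (d - 1))
  have hs0 : ∀ x, 0 ≤ s x := fun x => by positivity
  let U : (Fin d → ℤ) × Fin d → Ω → ℝ := fun p ω => max (u (edgeAt p.1 p.2) ω - 2 ^ J) 0
  let S := cube d L ×ˢ (Finset.univ : Finset (Fin d))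
  have hnd : (n : ℝ) ^ d = n ^ (d - 1) * n := by rw [← pow_succ]; congr 1; omega
  -- reduction to the weighted sum of the excesses
  have hsub : {ω | ((L : ℝ) + 1) ^ d * (ε * n) ≤ ∑ w ∈ cube d L, minTime (fun e => u e ω) 0 w} ⊆
      {ω | ENNReal.ofReal (Real.exp (K * ε / 2 * n ^ d)) ≤
        ∏ p ∈ S, ENNReal.ofReal (Real.exp (s p.1 * U p ω))} := by
    intro ω hω
    rw [Set.mem_ofPred_eq] at hω ⊢
    rw [← ENNReal.ofReal_prod_of_nonneg fun _ _ => (Real.exp_pos _).le, ← Real.exp_sum]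
    refine ENNReal.ofReal_le_ofReal (Real.exp_le_exp.2 ?_)
    have hτ : ∀ e, 0 ≤ u e ω := fun e => h'.nonneg e ω
    have h1 : ∑ w ∈ cube d L, minTime (fun e => u e ω) 0 w ≤ ((L : ℝ) + 1) ^ d *
        ∑ x ∈ cube d L, C / (rad x : ℝ) ^ (d - 1) * ∑ i, u (edgeAt x i) ω := by
      refine (sum_minTime_cube_le_weighted hd (τ := fun e => u e ω) hτ L).trans ?_
      have hS : ∀ x : Fin d → ℤ, 0 ≤ ∑ i, u (edgeAt x i) ω := fun x =>
        Finset.sum_nonneg fun _ _ => hτ _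
      have h2 : ∑ x ∈ cube d L, 2 ^ (d + 1) * (2 / (rad x : ℝ) ^ (d - 1) -
          1 / (L : ℝ) ^ (d - 1)) * ∑ i, u (edgeAt x i) ω ≤
          ∑ x ∈ cube d L, C / (rad x : ℝ) ^ (d - 1) * ∑ i, u (edgeAt x i) ω := by
        refine Finset.sum_le_sum fun x _ => mul_le_mul_of_nonneg_right ?_ (hS x)
        have h3 : C / (rad x : ℝ) ^ (d - 1) = 2 ^ (d + 1) * (2 / (rad x : ℝ) ^ (d - 1)) := by
          rw [hC, pow_succ]; ring
        rw [h3]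
        have : (0 : ℝ) ≤ 1 / (L : ℝ) ^ (d - 1) := by positivity
        gcongr
        linarith
      have h4 : 0 ≤ ∑ x ∈ cube d L, C / (rad x : ℝ) ^ (d - 1) * ∑ i, u (edgeAt x i) ω :=
        Finset.sum_nonneg fun x _ => mul_nonneg (by positivity) (hS x)
      calc _ ≤ (L : ℝ) ^ d * ∑ x ∈ cube d L, C / (rad x : ℝ) ^ (d - 1) * ∑ i, u (edgeAt x i) ω := by
            gcongr
        _ ≤ _ := by
            gcongr
            linarith
    have h2 : ε * n ≤ ∑ x ∈ cube d L, C / (rad x : ℝ) ^ (d - 1) * ∑ i, u (edgeAt x i) ω :=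
      le_of_mul_le_mul_left (hω.trans h1) (by positivity)
    have h3 : ∑ x ∈ cube d L, C / (rad x : ℝ) ^ (d - 1) * ∑ i, u (edgeAt x i) ω ≤
        ∑ x ∈ cube d L, C / (rad x : ℝ) ^ (d - 1) * ∑ i, U (x, i) ω +
        d * 2 ^ J * C * ∑ x ∈ cube d L, 1 / (rad x : ℝ) ^ (d - 1) := by
      rw [Finset.mul_sum, ← Finset.sum_add_distrib]
      refine Finset.sum_le_sum fun x _ => ?_
      have h4 : ∑ i, u (edgeAt x i) ω ≤ ∑ i, U (x, i) ω + d * 2 ^ J := by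
        have : ∀ i, u (edgeAt x i) ω ≤ U (x, i) ω + 2 ^ J := fun i => by
          have := le_max_left (u (edgeAt x i) ω - 2 ^ J) 0
          simp only [U]
          linarith
        refine (Finset.sum_le_sum fun i _ => this i).trans_eq ?_
        rw [Finset.sum_add_distrib]
        simp
      refine (mul_le_mul_of_nonneg_left h4 (by positivity)).trans_eq ?_
      ring
    have h4 : d * 2 ^ J * C * ∑ x ∈ cube d L, 1 / (rad x : ℝ) ^ (d - 1) ≤ ε / 2 * n := by
      calc _ ≤ d * 2 ^ J * C * (2 ^ (d + 1) * (L + 1)) := by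
            gcongr
            exact sum_cube_inv_rad_le hd L
        _ ≤ d * 2 ^ J * C * (2 ^ (d + 1) * (δ * n)) := by gcongr
        _ = d * 2 ^ J * C * 2 ^ (d + 1) * δ * n := by ring
        _ ≤ _ := by gcongr
    have h5 : ε / 2 * n ≤ ∑ x ∈ cube d L, C / (rad x : ℝ) ^ (d - 1) * ∑ i, U (x, i) ω := by
      linarith
    have h6 : ∑ p ∈ S, s p.1 * U p ω = K * n ^ (d - 1) *
        ∑ x ∈ cube d L, C / (rad x : ℝ) ^ (d - 1) * ∑ i, U (x, i) ω := by
      rw [Finset.sum_product, Finset.mul_sum]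
      refine Finset.sum_congr rfl fun x _ => ?_
      change ∑ i, s x * U (x, i) ω = _
      rw [← Finset.mul_sum]
      simp only [s]
      ring
    rw [h6, hnd]
    calc K * ε / 2 * (n ^ (d - 1) * n) = K * n ^ (d - 1) * (ε / 2 * n) := by ring
      _ ≤ _ := by gcongr
  have hUm : ∀ p, Measurable fun ω => ENNReal.ofReal (Real.exp (s p.1 * U p ω)) := fun p =>
    (Real.measurable_exp.comp ((((h'.meas _).sub_const _).max measurable_const).const_mul _)).ennreal_ofReal
  have hindep : iIndepFun (fun p ω => ENNReal.ofReal (Real.exp (s p.1 * U p ω))) P :=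
    (h'.indep.precomp edgeAt_injective).comp
      (fun p y => ENNReal.ofReal (Real.exp (s p.1 * max (y - 2 ^ J) 0)))
      fun p => (Real.measurable_exp.comp
        (((measurable_id.sub_const _).max measurable_const).const_mul _)).ennreal_ofReal
  have hprod := lintegral_prod_eq_prod_lintegral_of_indepFun S _ hindep hUm
  let Ψ : (Fin d → ℤ) → ℝ := fun x => ∑' j, layerBound (halfCost d f J 0)
    (fun j => s x * 2 ^ (J + j + 1)) (halfCost d f J) j
  have hΨ : ∑ x ∈ cube d L, Ψ x ≤ (L + 1) ^ d * E + K * β * n ^ d * C₃ * W := by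
    simp only [Ψ]
    rw [← Summable.tsum_finsetSum fun x _ => h.summable_layerBound hd hJ (s x)]
    have h1 : (L + 1 : ℝ) ^ d * E + K * β * n ^ d * C₃ * W =
        ∑' j, ((L + 1 : ℝ) ^ d * Real.exp (-halfCost d f J j) + K * β * n ^ d * C₃ * wt j) := by
      rw [(hE.mul_left _).tsum_add (hwt.mul_left _), tsum_mul_left, tsum_mul_left]
    rw [h1]
    exact Summable.tsum_le_tsum (fun j => h.sum_layerBound_le hd hJ hβ0 hC0 n L j)
      (summable_sum fun x _ => h.summable_layerBound hd hJ (s x))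
      ((hE.mul_left _).add (hwt.mul_left _))
  have hle : ∫⁻ ω, ∏ p ∈ S, ENNReal.ofReal (Real.exp (s p.1 * U p ω)) ∂P ≤
      ENNReal.ofReal (Real.exp (K * ε / 4 * n ^ d)) := by
    rw [hprod]
    refine (Finset.prod_le_prod' fun p _ =>
      h'.lintegral_exp_excess_le hd hJ (edgeAt p.1 p.2) (hs0 p.1)).trans ?_
    rw [← ENNReal.ofReal_prod_of_nonneg fun _ _ => (Real.exp_pos _).le, ← Real.exp_sum]
    refine ENNReal.ofReal_le_ofReal (Real.exp_le_exp.2 ?_)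
    have h1 : ∑ p ∈ S, Ψ p.1 = d * ∑ x ∈ cube d L, Ψ x := by
      rw [Finset.sum_product, Finset.mul_sum]
      simp
    change ∑ p ∈ S, Ψ p.1 ≤ _
    rw [h1]
    have h2 : ((L : ℝ) + 1) ^ d ≤ δ * n ^ d := by
      calc ((L : ℝ) + 1) ^ d ≤ (δ * n) ^ d := by gcongr
        _ = δ ^ d * n ^ d := mul_pow _ _ _
        _ ≤ δ * n ^ d := by
          gcongr
          exact pow_le_of_le_one hδ0.le hδ1 (by omega)
    calc d * ∑ x ∈ cube d L, Ψ x ≤ d * (δ * n ^ d * E + K * β * n ^ d * C₃ * W) := by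
          gcongr
          exact hΨ.trans (by gcongr)
      _ = (d * E * δ) * n ^ d + K * (d * C₃ * W * β) * n ^ d := by ring
      _ ≤ (K * ε / 8) * n ^ d + K * (ε / 8) * n ^ d := by gcongr
      _ = _ := by ring
  refine (measure_mono hsub).trans ?_
  have hmk := mul_meas_ge_le_lintegral (μ := P)
    (Finset.measurable_prod S fun p _ => hUm p) (ENNReal.ofReal (Real.exp (K * ε / 2 * n ^ d)))
  have h0 : ENNReal.ofReal (Real.exp (K * ε / 2 * n ^ d)) ≠ 0 := by simp [Real.exp_pos]
  rw [mul_comm, ← ENNReal.le_div_iff_mul_le (Or.inl h0) (Or.inl ENNReal.ofReal_ne_top)] at hmk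
  refine hmk.trans ((ENNReal.div_le_div_right hle _).trans ?_)
  rw [← ENNReal.ofReal_div_of_pos (Real.exp_pos _), ← Real.exp_sub]
  refine ENNReal.ofReal_le_ofReal (Real.exp_le_exp.2 (le_of_eq ?_))
  ring

end

section

variable {d : ℕ} [NeZero d] {Ω : Type*} [MeasurableSpace Ω] {P : Measure Ω}
  {t : Edge d → Ω → ℝ} {M₀ : ℝ} {f : ℝ → ℝ}

/-- Reflecting the cube of starting points turns the last leg of the journey into a journey from the
origin in the reflected environment. -/
theorem sum_minTime_end_le {τ : Edge d → ℝ} (hτ : ∀ e, 0 ≤ τ e) (a L : ℕ) :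
    ∑ w ∈ cube d L, minTime τ (w + axis d a) (axis d (a + L : ℕ)) ≤
      ∑ w ∈ cube d L, minTime (fun e => τ ((reflect (0 : Fin d) ((a + L : ℕ) : ℤ)).mapEdgeSet e)) 0 w := by
  have h0 : reflect (0 : Fin d) ((a + L : ℕ) : ℤ) 0 = axis d (a + L : ℕ) := by
    ext j
    by_cases hj : j = 0
    · subst hj; simp [axis]
    · simp [axis, hj]
  have h1 : ∀ w : Fin d → ℤ, minTime τ (w + axis d a) (axis d (a + L : ℕ)) =
      minTime (fun e => τ ((reflect (0 : Fin d) ((a + L : ℕ) : ℤ)).mapEdgeSet e)) 0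
        (Function.update w 0 (L - w 0)) := by
    intro w
    rw [minTime_comp (reflect _ _) hτ, h0, minTime_symm hτ]
    congr 1
    ext j
    by_cases hj : j = 0
    · subst hj
      simp [axis]
      ring
    · simp [axis, hj]
  simp only [h1]
  refine sum_comp_le_sum_of_injOn _ (fun w : Fin d → ℤ => Function.update w 0 (L - w 0))
    (fun w hw => mem_cube.2 fun j => ?_) (fun w _ w' _ h => ?_)
    fun _ => minTime_nonneg (fun e => hτ _) _ _
  · have := mem_cube.1 hw j
    by_cases hj : j = 0
    · subst hj; simp; omega
    · simpa [hj] using this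
  · ext j
    have h2 := congrFun h j
    by_cases hj : j = 0
    · subst hj; simp at h2; omega
    · simpa [hj] using h2

/-- The decomposition of a journey to `(km + L, 0, …, 0)` averaged over a cube: out into the cube,
along parallel lines, and back from the translated cube. -/
theorem card_mul_minTime_le {τ : Edge d → ℝ} (hτ : ∀ e, 0 ≤ τ e) {m : ℕ} {G : (Edge d → ℝ) → ℝ}
    (hG : ∀ τ : Edge d → ℝ, (∀ e, 0 ≤ τ e) → minTime τ 0 (axis d m) ≤ G τ) (k L : ℕ) :
    ((L : ℝ) + 1) ^ d * minTime τ 0 (axis d (k * m + L : ℕ)) ≤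
      ∑ w ∈ cube d L, minTime τ 0 w +
      ∑ i ∈ Finset.range k, ∑ w ∈ cube d L,
        G (fun e => τ ((shift (w + axis d ((i * m : ℕ) : ℤ))).mapEdgeSet e)) +
      ∑ w ∈ cube d L,
        minTime (fun e => τ ((reflect (0 : Fin d) ((k * m + L : ℕ) : ℤ)).mapEdgeSet e)) 0 w := by
  have h1 : ∀ w : Fin d → ℤ, minTime τ 0 (axis d (k * m + L : ℕ)) ≤ minTime τ 0 w +
      ∑ i ∈ Finset.range k, G (fun e => τ ((shift (w + axis d ((i * m : ℕ) : ℤ))).mapEdgeSet e)) +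
      minTime τ (w + axis d (k * m : ℕ)) (axis d (k * m + L : ℕ)) := by
    intro w
    have h2 := minTime_triangle hτ 0 w (axis d (k * m + L : ℕ))
    have h3 := minTime_triangle hτ w (w + axis d (k * m : ℕ)) (axis d (k * m + L : ℕ))
    have h4 := minTime_chain hτ hG w k
    linarith
  have h2 : ((L : ℝ) + 1) ^ d * minTime τ 0 (axis d (k * m + L : ℕ)) =
      ∑ w ∈ cube d L, minTime τ 0 (axis d (k * m + L : ℕ)) := by
    rw [Finset.sum_const, card_cube, nsmul_eq_mul]
    push_cast
    ring
  rw [h2]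
  refine (Finset.sum_le_sum fun w _ => h1 w).trans ?_
  rw [Finset.sum_add_distrib, Finset.sum_add_distrib, Finset.sum_comm (s := cube d L)]
  exact add_le_add le_rfl (sum_minTime_end_le hτ (k * m) L)

/-- In the summable case the upper tail at speed larger than the time constant decays like
`exp (-c n ^ d)`. -/
theorem TailEnv.exists_upper_tail_le [IsProbabilityMeasure P] (h : TailEnv P t M₀ f)
    (hd : 2 ≤ d) (hsum : Summable fun n : ℕ => 1 / f (2 ^ (n + 1)) ^ (1 / ((d : ℝ) - 1)))
    {ε : ℝ} (hε : 0 < ε) :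
    ∃ c : ℝ, 0 < c ∧ ∀ᶠ n : ℕ in atTop,
      P {ω | (timeConstant P t + ε) * n ≤ minTime (fun e => t e ω) 0 (axis d n)} ≤
        ENNReal.ofReal (Real.exp (-(c * n ^ d))) := by
  set ν := timeConstant P t with hν
  have hν0 : 0 ≤ ν := h.timeConstant_nonneg
  obtain ⟨m, hm, hmean⟩ := exists_meanTime_lt P t (show 0 < ε / 8 by positivity)
  rw [← hν] at hmean
  have hm' : (0 : ℝ) < m := by exact_mod_cast hm
  obtain ⟨G, F, hGm, hloc, hmin, hexp, hint⟩ :=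
    h.exists_local_approx hd m (show 0 < m * (ε / 8) by positivity)
  obtain ⟨C, c₂, hC, hc₂, hdev⟩ := h.measure_sum_translates_ge_le hGm F hloc hexp
    (show 0 < m * (ε / 8) by positivity)
  set μ := ∫ ω, G (fun e => t e ω) ∂P with hμ
  obtain ⟨δ₀, c₁, hδ₀, hc₁, hconn⟩ :=
    h.measure_sum_minTime_cube_le hd hsum (show 0 < ε / 4 by positivity)
  obtain ⟨δ, hδ, hδ1, hδδ⟩ : ∃ δ : ℝ, 0 < δ ∧ δ ≤ 1 ∧ δ ≤ δ₀ :=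
    ⟨min 1 δ₀, lt_min one_pos hδ₀, min_le_left _ _, min_le_right _ _⟩
  set c : ℝ := min c₁ (c₂ * (δ / 2) ^ d) with hc
  have hc0 : 0 < c := lt_min hc₁ (by positivity)
  refine ⟨c / 2, by positivity, ?_⟩
  have hlarge1 : ∀ᶠ n : ℕ in atTop, (m : ℝ) + 1 ≤ δ / 2 * n :=
    ((tendsto_natCast_atTop_atTop (R := ℝ)).const_mul_atTop
      (show 0 < δ / 2 by positivity)).eventually_ge_atTop _
  have hlarge2 : ∀ᶠ n : ℕ in atTop, 2 + C ≤ c ^ 2 / 8 * n :=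
    ((tendsto_natCast_atTop_atTop (R := ℝ)).const_mul_atTop
      (show 0 < c ^ 2 / 8 by positivity)).eventually_ge_atTop _
  filter_upwards [hlarge1, hlarge2, eventually_ge_atTop 1] with n hn1 hn2 hn0
  have hn : (1 : ℝ) ≤ n := by exact_mod_cast hn0
  -- the side `L` of the cube, congruent to `n` modulo `m` and between `δ n / 2` and `δ n`
  obtain ⟨k, L, hkL, hL1, hL2⟩ : ∃ k L : ℕ, n = k * m + L ∧ δ / 2 * n ≤ (L : ℝ) + 1 ∧
      (L : ℝ) + 1 ≤ δ * n := by
    set k := ⌊(1 - δ / 2) * n / m⌋₊ with hk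
    have h0 : 0 ≤ (1 - δ / 2) * n / m := by
      have : 0 ≤ 1 - δ / 2 := by linarith
      positivity
    have h1 := Nat.floor_le h0
    have h2 := Nat.lt_floor_add_one ((1 - δ / 2) * n / m)
    rw [← hk, le_div_iff₀ hm'] at h1
    rw [← hk, div_lt_iff₀ hm'] at h2
    have h3 : k * m ≤ n := by
      have : (k : ℝ) * m ≤ n := h1.trans (by nlinarith)
      exact_mod_cast this
    refine ⟨k, n - k * m, by omega, ?_, ?_⟩ <;> rw [Nat.cast_sub h3] <;> push_cast <;> nlinarith
  have hkn : k ≤ n := by nlinarith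
  have hkn' : (k : ℝ) ≤ n := by exact_mod_cast hkn
  let A₁ : Set Ω := {ω | ((L : ℝ) + 1) ^ d * (ε / 4 * n) ≤
    ∑ w ∈ cube d L, minTime (fun e => t e ω) 0 w}
  let A₂ : ℕ → Set Ω := fun i => {ω | ((cube d L).card : ℝ) * (μ + m * (ε / 8)) ≤
    ∑ w ∈ cube d L, G fun e => t ((shift (w + axis d ((i * m : ℕ) : ℤ))).mapEdgeSet e) ω}
  let A₃ : Set Ω := {ω | ((L : ℝ) + 1) ^ d * (ε / 4 * n) ≤
    ∑ w ∈ cube d L, minTime (fun e => t ((reflect (0 : Fin d) (n : ℤ)).mapEdgeSet e) ω) 0 w}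
  have hP1 : P A₁ ≤ ENNReal.ofReal (Real.exp (-(c * n ^ d))) := by
    refine (hconn id Function.injective_id n L (hL2.trans (by gcongr))).trans ?_
    refine ENNReal.ofReal_le_ofReal (Real.exp_le_exp.2 (neg_le_neg ?_))
    gcongr
    exact min_le_left _ _
  have hP3 : P A₃ ≤ ENNReal.ofReal (Real.exp (-(c * n ^ d))) := by
    refine (hconn _ (reflect (0 : Fin d) (n : ℤ)).mapEdgeSet.injective n L
      (hL2.trans (by gcongr))).trans ?_
    refine ENNReal.ofReal_le_ofReal (Real.exp_le_exp.2 (neg_le_neg ?_))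
    gcongr
    exact min_le_left _ _
  have hP2 : ∀ i, P (A₂ i) ≤ ENNReal.ofReal (C * Real.exp (-(c * n ^ d))) := by
    intro i
    refine (hdev (cube d L) (fun w => w + axis d ((i * m : ℕ) : ℤ))
      (add_left_injective _).injOn).trans ?_
    refine ENNReal.ofReal_le_ofReal (mul_le_mul_of_nonneg_left
      (Real.exp_le_exp.2 (neg_le_neg ?_)) hC.le)
    rw [card_cube]
    push_cast
    calc c * n ^ d ≤ c₂ * (δ / 2) ^ d * n ^ d := by
          gcongr
          exact min_le_right _ _
      _ = c₂ * (δ / 2 * n) ^ d := by rw [mul_pow]; ring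
      _ ≤ _ := by gcongr
  have hsub : {ω | (ν + ε) * n ≤ minTime (fun e => t e ω) 0 (axis d n)} ⊆
      (A₁ ∪ A₃) ∪ ⋃ i ∈ Finset.range k, A₂ i := by
    intro ω hω
    by_contra hcon
    simp only [Set.mem_union, Set.mem_iUnion, not_or, not_exists] at hcon
    obtain ⟨⟨h1, h3⟩, h2⟩ := hcon
    simp only [A₁, A₃, A₂, Set.mem_ofPred_eq, not_le] at h1 h2 h3 hω
    have hτ : ∀ e, 0 ≤ t e ω := fun e => h.nonneg e ω
    have h4 := card_mul_minTime_le (τ := fun e => t e ω) hτ hmin k L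
    rw [← hkL] at h4
    have h5 := Finset.sum_le_sum fun i hi => (h2 i hi).le
    rw [Finset.sum_const, Finset.card_range, nsmul_eq_mul, card_cube] at h5
    simp only [Nat.cast_pow, Nat.cast_add, Nat.cast_one] at h5
    have h6 : (k : ℝ) * (μ + m * (ε / 8)) ≤ (ν + 3 * (ε / 8)) * n := by
      have h7 : (k : ℝ) * m ≤ n := by
        have : k * m ≤ n := by omega
        exact_mod_cast this
      calc (k : ℝ) * (μ + m * (ε / 8)) ≤ k * ((ν + 3 * (ε / 8)) * m) := by
            refine mul_le_mul_of_nonneg_left ?_ (Nat.cast_nonneg _)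
            linarith
        _ = (ν + 3 * (ε / 8)) * (k * m) := by ring
        _ ≤ _ := by gcongr
    have h8 : ((L : ℝ) + 1) ^ d * ((ν + ε) * n) ≤
        ((L : ℝ) + 1) ^ d * minTime (fun e => t e ω) 0 (axis d n) := by gcongr
    have h9 : (k : ℝ) * (((L : ℝ) + 1) ^ d * (μ + m * (ε / 8))) ≤
        ((L : ℝ) + 1) ^ d * ((ν + 3 * (ε / 8)) * n) := by
      calc _ = ((L : ℝ) + 1) ^ d * ((k : ℝ) * (μ + m * (ε / 8))) := by ring
        _ ≤ _ := by gcongr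
    have h10 : ((L : ℝ) + 1) ^ d * ((ν + ε) * n) <
        ((L : ℝ) + 1) ^ d * (ε / 4 * n) + ((L : ℝ) + 1) ^ d * ((ν + 3 * (ε / 8)) * n) +
        ((L : ℝ) + 1) ^ d * (ε / 4 * n) := by linarith
    rw [← mul_add, ← mul_add] at h10
    have h11 := lt_of_mul_lt_mul_left h10 (by positivity)
    nlinarith
  have hE := Real.exp_pos (-(c * (n : ℝ) ^ d))
  calc P {ω | (ν + ε) * n ≤ minTime (fun e => t e ω) 0 (axis d n)}
      ≤ P ((A₁ ∪ A₃) ∪ ⋃ i ∈ Finset.range k, A₂ i) := measure_mono hsub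
    _ ≤ (P A₁ + P A₃) + ∑ i ∈ Finset.range k, P (A₂ i) :=
        (measure_union_le _ _).trans (add_le_add (measure_union_le _ _)
          (measure_biUnion_finset_le _ _))
    _ ≤ (ENNReal.ofReal (Real.exp (-(c * n ^ d))) + ENNReal.ofReal (Real.exp (-(c * n ^ d)))) +
          ∑ i ∈ Finset.range k, ENNReal.ofReal (C * Real.exp (-(c * n ^ d))) :=
        add_le_add (add_le_add hP1 hP3) (Finset.sum_le_sum fun i _ => hP2 i)
    _ = ENNReal.ofReal ((2 + k * C) * Real.exp (-(c * n ^ d))) := by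
        rw [Finset.sum_const, Finset.card_range, nsmul_eq_mul, ← ENNReal.ofReal_natCast,
          ← ENNReal.ofReal_mul (Nat.cast_nonneg _), ← ENNReal.ofReal_add hE.le hE.le,
          ← ENNReal.ofReal_add (by positivity) (by positivity)]
        congr 1
        ring
    _ ≤ _ := by
        refine ENNReal.ofReal_le_ofReal ?_
        -- the polynomial prefactor is absorbed by half of the exponent
        have h1 : (2 + k * C : ℝ) ≤ Real.exp (c / 2 * n ^ d) := by
          have h2 : (n : ℝ) ≤ n ^ d := le_self_pow₀ hn (by omega)
          have h3 := Real.quadratic_le_exp_of_nonneg (show 0 ≤ c / 2 * n by positivity)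
          have h4 : Real.exp (c / 2 * n) ≤ Real.exp (c / 2 * n ^ d) :=
            Real.exp_le_exp.2 (by gcongr)
          have h5 : (2 + k * C : ℝ) ≤ (2 + C) * n := by nlinarith
          have h6 : (2 + C) * n ≤ (c ^ 2 / 8 * n) * n := by gcongr
          have h7 : 0 ≤ c / 2 * n := by positivity
          nlinarith
        calc (2 + k * C) * Real.exp (-(c * n ^ d))
            ≤ Real.exp (c / 2 * n ^ d) * Real.exp (-(c * n ^ d)) := by gcongr
          _ = _ := by
            rw [← Real.exp_add]
            congr 1
            ring

end

/-! ### Barriers around the origin in the non-summable case -/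

/-- The part of the interval `[2 ^ k, 2 ^ k + 2 ^ (k - 1)]` that lies below `r`. Leaving the upper
half of the dyadic block `[2 ^ k, 2 ^ (k + 1)]` free keeps the edges used by different scales apart. -/
def rampLength (k r : ℕ) : ℕ := min (r - 2 ^ k) (2 ^ (k - 1))

theorem rampLength_eq_of_log_ne {k r r' : ℕ} (hk : 1 ≤ k) (hr : 1 ≤ r) (h1 : r' ≤ r + 1)
    (h2 : r ≤ r' + 1) (hne : Nat.log 2 r ≠ k) : rampLength k r' = rampLength k r := by
  have hpow : 2 ^ k = 2 * 2 ^ (k - 1) := by rw [← pow_succ']; congr 1; omega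
  have hpos : 1 ≤ 2 ^ (k - 1) := Nat.one_le_two_pow
  unfold rampLength
  rcases lt_or_gt_of_ne hne with h | h
  · have : r < 2 ^ k := Nat.lt_pow_of_log_lt (by norm_num) h
    omega
  · have : 2 ^ (k + 1) ≤ r := Nat.pow_le_of_le_log (by omega) h
    rw [pow_succ] at this
    omega

theorem abs_rampLength_sub_le (k : ℕ) {r r' : ℕ} (h1 : r' ≤ r + 1) (h2 : r ≤ r' + 1) :
    |(rampLength k r' : ℝ) - rampLength k r| ≤ 1 := by
  have h3 : rampLength k r' ≤ rampLength k r + 1 := by unfold rampLength; omega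
  have h4 : rampLength k r ≤ rampLength k r' + 1 := by unfold rampLength; omega
  have h3' : (rampLength k r' : ℝ) ≤ rampLength k r + 1 := by exact_mod_cast h3
  have h4' : (rampLength k r : ℝ) ≤ rampLength k r' + 1 := by exact_mod_cast h4
  rw [abs_le]
  constructor <;> linarith

theorem rad_add_single_le {d : ℕ} (x : Fin d → ℤ) (i : Fin d) :
    rad (x + Pi.single i 1) ≤ rad x + 1 ∧ rad x ≤ rad (x + Pi.single i 1) + 1 := by
  have h1 := one_le_rad x
  have h2 := one_le_rad (x + Pi.single i 1)
  have h3 := (rad_le_iff h1).1 le_rfl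
  have h4 := (rad_le_iff h2).1 le_rfl
  have hs : ∀ j, (Pi.single i (1 : ℤ) : Fin d → ℤ) j = 0 ∨ (Pi.single i (1 : ℤ) : Fin d → ℤ) j = 1 := by
    intro j
    by_cases hj : j = i
    · subst hj; simp
    · simp [hj]
  constructor
  · refine (rad_le_iff (by omega)).2 fun j => ?_
    have := h3 j
    rw [Pi.add_apply]
    rcases hs j with h | h <;> rw [h] <;> omega
  · refine (rad_le_iff (by omega)).2 fun j => ?_
    have := h4 j
    rw [Pi.add_apply] at this
    rcases hs j with h | h <;> rw [h] at this <;> omega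

theorem rad_axis {d : ℕ} [NeZero d] {n : ℕ} (hn : 1 ≤ n) : rad (axis d n) = n := by
  refine le_antisymm ((rad_le_iff hn).2 fun j => ?_) ?_
  · by_cases hj : j = 0
    · subst hj; simp [axis]
    · simp [axis, hj]
  · have := (rad_le_iff (one_le_rad (axis d n))).1 le_rfl 0
    simpa [axis] using this

/-- If all edges in the dyadic shells of scales `k ∈ I` around the origin cost at least `h k`, every
path leaving these shells costs at least `∑ h k * 2 ^ (k - 1)`. -/
theorem barrier_le_minTime {d : ℕ} [NeZero d] {τ : Edge d → ℝ} (hτ : ∀ e, 0 ≤ τ e) {K n : ℕ}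
    (hn : 2 ^ K ≤ n) (I : Finset ℕ) (hI : ∀ k ∈ I, 1 ≤ k ∧ k < K) (h : ℕ → ℝ) (hh : ∀ k, 0 ≤ h k)
    (hbar : ∀ x i, Nat.log 2 (rad x) ∈ I → h (Nat.log 2 (rad x)) ≤ τ (edgeAt x i)) :
    ∑ k ∈ I, h k * 2 ^ (k - 1) ≤ minTime τ 0 (axis d n) := by
  have hn1 : 1 ≤ n := Nat.one_le_two_pow.trans hn
  let H : (Fin d → ℤ) → ℝ := fun x => ∑ k ∈ I, h k * rampLength k (rad x)
  have hH : ∀ x i, |H (x + Pi.single i 1) - H x| ≤ τ (edgeAt x i) := by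
    intro x i
    obtain ⟨h1, h2⟩ := rad_add_single_le x i
    have h3 : |H (x + Pi.single i 1) - H x| ≤
        ∑ k ∈ I, if Nat.log 2 (rad x) = k then h k else 0 := by
      rw [← Finset.sum_sub_distrib]
      refine (Finset.abs_sum_le_sum_abs _ _).trans (Finset.sum_le_sum fun k hk => ?_)
      rw [← mul_sub, abs_mul, abs_of_nonneg (hh k)]
      split_ifs with hlog
      · exact mul_le_of_le_one_right (hh k) (abs_rampLength_sub_le k h1 h2)
      · rw [rampLength_eq_of_log_ne (hI k hk).1 (one_le_rad x) h1 h2 hlog]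
        simp
    rw [Finset.sum_ite_eq] at h3
    refine h3.trans ?_
    split_ifs with hlog
    · exact hbar x i hlog
    · exact hτ _
  have h0 : H 0 = 0 := by
    refine Finset.sum_eq_zero fun k hk => ?_
    have h1 : rad (0 : Fin d → ℤ) = 1 := by
      refine le_antisymm ((rad_le_iff le_rfl).2 fun j => ?_) (one_le_rad _)
      simp
    have h2 : 1 ≤ 2 ^ k := Nat.one_le_two_pow
    have h3 : rampLength k 1 = 0 := by
      rw [rampLength, Nat.sub_eq_zero_of_le h2, Nat.zero_min]
    rw [h1, h3]
    simp
  have h1 : H (axis d n) = ∑ k ∈ I, h k * 2 ^ (k - 1) := by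
    refine Finset.sum_congr rfl fun k hk => ?_
    obtain ⟨hk1, hkK⟩ := hI k hk
    have h2 : rampLength k n = 2 ^ (k - 1) := by
      have h3 : 2 ^ (k + 1) ≤ n := (Nat.pow_le_pow_right (by norm_num) hkK).trans hn
      have hpow : 2 ^ k = 2 * 2 ^ (k - 1) := by rw [← pow_succ']; congr 1; omega
      rw [pow_succ] at h3
      unfold rampLength
      omega
    rw [rad_axis hn1, h2]
    push_cast
    ring
  refine le_ciInf fun γ => ?_
  have := sub_le_pathValue H hH γ
  rwa [h0, h1, sub_zero] at this

section

variable {d : ℕ} {Ω : Type*} [MeasurableSpace Ω] {P : Measure Ω}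
  {t : Edge d → Ω → ℝ} {M₀ : ℝ} {f : ℝ → ℝ}

/-- The probability of a barrier is bounded below by independence. -/
theorem TailEnv.le_measure_barrier [IsProbabilityMeasure P] (h : TailEnv P t M₀ f) (hM₀ : 0 < M₀)
    (I : Finset ℕ) (θ : ℕ → ℝ) (hθ : ∀ k ∈ I, M₀ < θ k) :
    ENNReal.ofReal ((2 : ℝ) ^ (-∑ k ∈ I, d * 8 ^ d * (2 ^ k) ^ d * (θ k ^ d * f (θ k)))) ≤
      P {ω | ∀ x i, Nat.log 2 (rad x) ∈ I → θ (Nat.log 2 (rad x)) < t (edgeAt x i) ω} := by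
  classical
  let box : ℕ → Finset (Fin d → ℤ) := fun R => Fintype.piFinset fun _ => Finset.Icc (-(R : ℤ)) R
  have hbox : ∀ R, 1 ≤ R → ∀ x : Fin d → ℤ, rad x ≤ R → x ∈ box R := by
    intro R hR x hx
    refine Fintype.mem_piFinset.2 fun j => Finset.mem_Icc.2 ?_
    have := (rad_le_iff hR).1 hx j
    omega
  have hcard : ∀ k, (box (2 ^ (k + 1))).card ≤ (8 * 2 ^ k) ^ d := by
    intro k
    simp only [box, Fintype.card_piFinset, Int.card_Icc, Finset.prod_const, Finset.card_univ,
      Fintype.card_fin]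
    refine Nat.pow_le_pow_left ?_ d
    have := Nat.one_le_two_pow (n := k)
    rw [pow_succ]
    generalize 2 ^ k = q at *
    omega
  let lg : (Fin d → ℤ) × Fin d → ℕ := fun p => Nat.log 2 (rad p.1)
  have hlt : ∀ p, rad p.1 < 2 ^ (lg p + 1) := fun p => Nat.lt_pow_succ_log_self (by norm_num) _
  let S : Finset ((Fin d → ℤ) × Fin d) :=
    ((box (2 ^ (I.sup id + 1))) ×ˢ Finset.univ).filter fun p => lg p ∈ I
  have hS : ∀ p, lg p ∈ I → p ∈ S := by
    intro p hp
    refine Finset.mem_filter.2 ⟨Finset.mem_product.2 ⟨hbox _ Nat.one_le_two_pow _ ?_,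
      Finset.mem_univ _⟩, hp⟩
    refine (hlt p).le.trans (Nat.pow_le_pow_right (by norm_num) ?_)
    have : lg p ≤ I.sup id := Finset.le_sup (f := id) hp
    omega
  have hfib : ∀ k ∈ I, ((S.filter fun p => lg p = k).card : ℝ) ≤ d * 8 ^ d * (2 ^ k) ^ d := by
    intro k _
    have h1 : (S.filter fun p => lg p = k) ⊆ box (2 ^ (k + 1)) ×ˢ Finset.univ := by
      intro p hp
      obtain ⟨-, hpk⟩ := Finset.mem_filter.1 hp
      refine Finset.mem_product.2 ⟨hbox _ Nat.one_le_two_pow _ ?_, Finset.mem_univ _⟩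
      rw [← hpk]
      exact (hlt p).le
    have h2 := Finset.card_le_card h1
    rw [Finset.card_product, Finset.card_univ, Fintype.card_fin] at h2
    have h3 : (S.filter fun p => lg p = k).card ≤ (8 * 2 ^ k) ^ d * d :=
      h2.trans (Nat.mul_le_mul_right d (hcard k))
    calc ((S.filter fun p => lg p = k).card : ℝ) ≤ ((8 * 2 ^ k) ^ d * d : ℕ) := by exact_mod_cast h3
      _ = _ := by push_cast; rw [mul_pow]; ring
  have hset : {ω | ∀ x i, Nat.log 2 (rad x) ∈ I → θ (Nat.log 2 (rad x)) < t (edgeAt x i) ω} =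
      ⋂ p ∈ S, (fun ω => t (edgeAt p.1 p.2) ω) ⁻¹' Set.Ioi (θ (lg p)) := by
    ext ω
    simp only [Set.mem_ofPred_eq, Set.mem_iInter, Set.mem_preimage, Set.mem_Ioi]
    exact ⟨fun hω p hp => hω p.1 p.2 (Finset.mem_filter.1 hp).2,
      fun hω x i hx => hω (x, i) (hS (x, i) hx)⟩
  have hind := (h.indep.precomp edgeAt_injective).measure_inter_preimage_eq_mul S
    (sets := fun p => Set.Ioi (θ (lg p))) fun p _ => measurableSet_Ioi
  rw [hset]
  refine le_trans ?_ hind.symm.le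
  have hprob : ∀ p ∈ S, P ((fun ω => t (edgeAt p.1 p.2) ω) ⁻¹' Set.Ioi (θ (lg p))) =
      ENNReal.ofReal ((2 : ℝ) ^ (-(θ (lg p) ^ d * f (θ (lg p))))) := fun p hp =>
    h.tail _ _ (hθ _ (Finset.mem_filter.1 hp).2)
  refine le_trans ?_ (Finset.prod_congr rfl hprob).symm.le
  rw [← ENNReal.ofReal_prod_of_nonneg fun _ _ => by positivity,
    ← Real.rpow_sum_of_pos two_pos]
  refine ENNReal.ofReal_le_ofReal (Real.rpow_le_rpow_of_exponent_le one_le_two ?_)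
  rw [Finset.sum_neg_distrib, neg_le_neg_iff,
    ← Finset.sum_fiberwise_of_maps_to (s := S) (t := I) (g := lg)
      fun p hp => (Finset.mem_filter.1 hp).2]
  refine Finset.sum_le_sum fun k hk => ?_
  have h1 : ∀ p ∈ S.filter fun p => lg p = k, θ (lg p) ^ d * f (θ (lg p)) = θ k ^ d * f (θ k) :=
    fun p hp => by rw [(Finset.mem_filter.1 hp).2]
  rw [Finset.sum_congr rfl h1, Finset.sum_const, nsmul_eq_mul]
  refine mul_le_mul_of_nonneg_right (hfib k hk) ?_
  have := h.f_pos _ (hθ k hk)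
  have := hM₀.trans (hθ k hk)
  positivity

/-- In the non-summable case, barriers whose heights at distance `n / 2 ^ j` are proportional to
`2 ^ j f(2 ^ j) ^ (-1 / (d - 1))` cost only `o(n ^ d)` in the exponent and slow down passage to any
prescribed speed. -/
theorem TailEnv.exists_upper_tail_ge [NeZero d] [IsProbabilityMeasure P] (h : TailEnv P t M₀ f)
    (hd : 2 ≤ d) (hM₀ : 0 < M₀)
    (hsum : ¬ Summable fun n : ℕ => 1 / f (2 ^ (n + 1)) ^ (1 / ((d : ℝ) - 1)))
    {A ε : ℝ} (hA : 0 < A) (hε : 0 < ε) :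
    ∀ᶠ n : ℕ in atTop, ENNReal.ofReal ((2 : ℝ) ^ (-(ε * (n : ℝ) ^ d))) ≤
      P {ω | A * n ≤ minTime (fun e => t e ω) 0 (axis d n)} := by
  obtain ⟨J', hJ'⟩ := pow_unbounded_of_one_lt M₀ (one_lt_two (α := ℝ))
  obtain ⟨J, hJ1, hJ⟩ : ∃ J, 1 ≤ J ∧ M₀ < (2 : ℝ) ^ J :=
    ⟨J' + 1, by omega, hJ'.trans_le (pow_le_pow_right₀ one_le_two (by omega))⟩
  have hd0 : (0 : ℝ) < d := by exact_mod_cast (by omega : 0 < d)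
  have hJi : ∀ i, (2 : ℝ) ^ J ≤ 2 ^ (J + i) := fun i => pow_le_pow_right₀ one_le_two (by omega)
  have hMi : ∀ i, M₀ < (2 : ℝ) ^ (J + i) := fun i => hJ.trans_le (hJi i)
  let g : ℕ → ℝ := fun i => f (2 ^ (J + i))
  have hg : ∀ i, 0 < g i := fun i => h.f_pos _ (hMi i)
  have hg0 : ∀ i, g 0 ≤ g i := fun i => h.f_mono (hMi 0) (hMi i) (hJi i)
  let w : ℕ → ℝ := fun i => 1 / g i ^ (1 / ((d : ℝ) - 1))
  have hw : ∀ i, 0 < w i := fun i => by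
    have := Real.rpow_pos_of_pos (hg i) (1 / ((d : ℝ) - 1))
    positivity
  have hwp : ∀ i, w i ^ (d - 1) = 1 / g i := fun i => rpow_weight_pow hd (hg i)
  have hw0 : ∀ i, w i ≤ w 0 := fun i => by
    refine le_of_pow_le_pow_left₀ (n := d - 1) (by omega) (hw 0).le ?_
    rw [hwp, hwp]
    exact one_div_le_one_div_of_le (hg 0) (hg0 i)
  have hwsum : ¬ Summable w := by
    intro hs
    refine hsum ((summable_nat_add_iff (J - 1)).1 (hs.congr fun i => ?_))
    simp only [w, g]
    rw [show i + (J - 1) + 1 = J + i by omega]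
  set D : ℝ := d * 8 ^ d with hD
  have hD0 : 0 < D := by positivity
  -- the outermost index, beyond which barriers of bounded height are cheap
  obtain ⟨i₁, hi₁⟩ := exists_pow_lt_of_lt_one (show 0 < ε / 2 / (D * g 0 * 2) by
    have := hg 0; positivity) (show (1 / 2 : ℝ) < 1 by norm_num)
  -- the innermost index, which makes the total weight large
  have hdiv : Tendsto (fun i₂ => ∑ i ∈ Finset.Ico i₁ i₂, w i) atTop atTop := by
    have h1 := (not_summable_iff_tendsto_nat_atTop_of_nonneg fun i => (hw i).le).1 hwsum
    refine (tendsto_atTop_add_const_right atTop (-∑ i ∈ Finset.range i₁, w i) h1).congr' ?_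
    filter_upwards [eventually_ge_atTop i₁] with i₂ hi
    rw [Finset.sum_Ico_eq_sub _ hi, sub_eq_add_neg]
  obtain ⟨i₂, hi₂⟩ := (hdiv.eventually_ge_atTop
    (max 1 (max (4 * A * w 0) (D * (4 * A) ^ d / (ε / 2))))).exists
  set W : ℝ := ∑ i ∈ Finset.Ico i₁ i₂, w i with hW
  have hW1 : 1 ≤ W := (le_max_left _ _).trans hi₂
  have hW2 : 4 * A * w 0 ≤ W := ((le_max_left _ _).trans (le_max_right _ _)).trans hi₂
  have hW3 : D * (4 * A) ^ d / (ε / 2) ≤ W := ((le_max_right _ _).trans (le_max_right _ _)).trans hi₂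
  have hW0 : 0 < W := one_pos.trans_le hW1
  let c : ℕ → ℝ := fun i => 4 * A * w i / W
  have hc0 : ∀ i, 0 < c i := fun i => by have := hw i; positivity
  have hc1 : ∀ i, c i ≤ 1 := fun i => by
    rw [div_le_one hW0]
    refine le_trans ?_ hW2
    gcongr
    exact hw0 i
  have hcsum : ∑ i ∈ Finset.Ico i₁ i₂, c i = 4 * A := by
    simp only [c]
    rw [← Finset.sum_div, ← Finset.mul_sum, ← hW]
    field_simp
  let b : ℕ → ℝ := fun i => c i * 2 ^ (J + i)
  have hb0 : ∀ i, 0 ≤ b i := fun i => mul_nonneg (hc0 i).le (by positivity)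
  have hbcost : ∀ i, b i ^ d * g i = (2 ^ (J + i)) ^ d * ((4 * A / W) ^ d * w i) := by
    intro i
    have h1 : w i ^ d * g i = w i := by
      have : w i ^ d = w i ^ (d - 1) * w i := by rw [← pow_succ]; congr 1; omega
      rw [this, hwp]
      have := (hg i).ne'
      field_simp
    have h2 : b i = 2 ^ (J + i) * (4 * A / W) * w i := by simp only [b, c]; ring
    rw [h2, mul_pow, mul_pow, mul_assoc, h1]
    ring
  let θ : ℕ → ℝ := fun i => max (b i) (2 ^ J)
  have hθcost : ∀ i, θ i ^ d * f (θ i) ≤ b i ^ d * g i + (2 ^ J) ^ d * g 0 := by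
    intro i
    have h1 : 0 ≤ b i ^ d * g i := mul_nonneg (pow_nonneg (hb0 i) d) (hg i).le
    have h2 : 0 ≤ ((2 : ℝ) ^ J) ^ d * g 0 := mul_nonneg (by positivity) (hg 0).le
    rcases le_total (b i) (2 ^ J) with h3 | h3
    · have : θ i = 2 ^ J := max_eq_right h3
      rw [this]
      have h4 : f (2 ^ J) = g 0 := rfl
      rw [h4]
      linarith
    · have : θ i = b i := max_eq_left h3
      rw [this]
      have h4 : b i ≤ 2 ^ (J + i) := mul_le_of_le_one_left (by positivity) (hc1 i)
      have h5 : f (b i) ≤ g i := h.f_mono (hJ.trans_le h3) (hMi i) h4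
      have h6 : b i ^ d * f (b i) ≤ b i ^ d * g i :=
        mul_le_mul_of_nonneg_left h5 (pow_nonneg (hb0 i) d)
      linarith
  filter_upwards [eventually_ge_atTop (2 ^ (J + i₂))] with n hn
  have hn0 : n ≠ 0 := by
    have := Nat.one_le_two_pow (n := J + i₂)
    omega
  set K := Nat.log 2 n with hK
  have hKn : 2 ^ K ≤ n := Nat.pow_log_le_self 2 hn0
  have hnK : n < 2 ^ (K + 1) := Nat.lt_pow_succ_log_self (by norm_num) n
  have hKJ : J + i₂ ≤ K := Nat.le_log_of_pow_le (by norm_num) hn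
  have hKn' : (2 : ℝ) ^ K ≤ n := by exact_mod_cast hKn
  let I : Finset ℕ := (Finset.Ico i₁ i₂).image fun i => K - (J + i)
  have hinj : Set.InjOn (fun i => K - (J + i)) (Finset.Ico i₁ i₂ : Finset ℕ) := by
    intro i hi j hj hij
    have hi := Finset.mem_Ico.1 (Finset.mem_coe.1 hi)
    have hj := Finset.mem_Ico.1 (Finset.mem_coe.1 hj)
    have hij : K - (J + i) = K - (J + j) := hij
    omega
  have hidx : ∀ i ∈ Finset.Ico i₁ i₂, K - J - (K - (J + i)) = i := by
    intro i hi
    have hi := Finset.mem_Ico.1 hi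
    omega
  have hI : ∀ k ∈ I, 1 ≤ k ∧ k < K := by
    intro k hk
    obtain ⟨i, hi, rfl⟩ := Finset.mem_image.1 hk
    have hi := Finset.mem_Ico.1 hi
    omega
  have hscale : ∀ i ∈ Finset.Ico i₁ i₂, (2 : ℝ) ^ (K - (J + i)) * 2 ^ (J + i) = 2 ^ K := by
    intro i hi
    have hi := Finset.mem_Ico.1 hi
    rw [← pow_add]
    congr 1
    omega
  have hlow := h.le_measure_barrier hM₀ I (fun k => θ (K - J - k))
    fun k _ => hJ.trans_le (le_max_right _ _)
  refine le_trans (ENNReal.ofReal_le_ofReal (Real.rpow_le_rpow_of_exponent_le one_le_two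
    (neg_le_neg ?_))) (hlow.trans (measure_mono fun ω hω => ?_))
  · -- the total cost of the barriers
    rw [Finset.sum_image hinj]
    have hterm : ∀ i ∈ Finset.Ico i₁ i₂, d * 8 ^ d * (2 ^ (K - (J + i))) ^ d *
        (θ (K - J - (K - (J + i))) ^ d * f (θ (K - J - (K - (J + i))))) ≤
        (n : ℝ) ^ d * (D * (4 * A / W) ^ d * w i + D * g 0 * (1 / 2) ^ i) := by
      intro i hi
      rw [hidx i hi, ← hD]
      have hg00 := hg 0
      have hwi := hw i
      have e1 : (1 / 2 : ℝ) ^ i = (2 ^ J) / 2 ^ (J + i) := by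
        rw [pow_add, one_div, inv_pow]; field_simp
      have e2 : ((2 : ℝ) ^ J) ^ d / (2 ^ (J + i)) ^ d ≤ (1 / 2) ^ i := by
        rw [← div_pow, e1]
        refine pow_le_of_le_one (by positivity) ?_ (by omega)
        rw [div_le_one (by positivity)]
        exact hJi i
      have e3 : ((2 : ℝ) ^ (K - (J + i))) ^ d * (2 ^ (J + i)) ^ d = (2 ^ K) ^ d := by
        rw [← mul_pow, hscale i hi]
      have e4 : ((2 : ℝ) ^ (K - (J + i))) ^ d * (2 ^ J) ^ d ≤ (2 ^ K) ^ d * (1 / 2) ^ i := by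
        calc ((2 : ℝ) ^ (K - (J + i))) ^ d * (2 ^ J) ^ d =
            ((2 : ℝ) ^ (K - (J + i))) ^ d * (2 ^ (J + i)) ^ d *
              (((2 : ℝ) ^ J) ^ d / (2 ^ (J + i)) ^ d) := by field_simp
          _ ≤ _ := by rw [e3]; gcongr
      calc D * (2 ^ (K - (J + i))) ^ d * (θ i ^ d * f (θ i))
          ≤ D * (2 ^ (K - (J + i))) ^ d * (b i ^ d * g i + (2 ^ J) ^ d * g 0) := by
            gcongr
            exact hθcost i
        _ = D * (((2 : ℝ) ^ (K - (J + i))) ^ d * (2 ^ (J + i)) ^ d) * ((4 * A / W) ^ d * w i) +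
            D * (((2 : ℝ) ^ (K - (J + i))) ^ d * (2 ^ J) ^ d) * g 0 := by
            rw [hbcost]; ring
        _ ≤ D * (2 ^ K) ^ d * ((4 * A / W) ^ d * w i) +
            D * ((2 ^ K) ^ d * (1 / 2) ^ i) * g 0 := by
            rw [e3]
            gcongr
        _ = (2 ^ K) ^ d * (D * (4 * A / W) ^ d * w i + D * g 0 * (1 / 2) ^ i) := by ring
        _ ≤ _ := by gcongr
    refine (Finset.sum_le_sum hterm).trans ?_
    rw [← Finset.mul_sum, Finset.sum_add_distrib, ← Finset.mul_sum, ← Finset.mul_sum, ← hW, mul_comm]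
    refine mul_le_mul_of_nonneg_right ?_ (by positivity)
    have h1 : D * (4 * A / W) ^ d * W ≤ ε / 2 := by
      have h2 : W ^ d = W ^ (d - 1) * W := by rw [← pow_succ]; congr 1; omega
      have h3 : W ≤ W ^ (d - 1) := le_self_pow₀ hW1 (by omega)
      rw [div_pow, h2]
      rw [div_le_iff₀ (by positivity)] at hW3
      have h4 : D * ((4 * A) ^ d / (W ^ (d - 1) * W)) * W = D * (4 * A) ^ d / W ^ (d - 1) := by
        field_simp
      rw [h4, div_le_iff₀ (by positivity)]
      nlinarith
    have h2 : D * g 0 * ∑ i ∈ Finset.Ico i₁ i₂, (1 / 2 : ℝ) ^ i ≤ ε / 2 := by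
      have h3 : ∑ i ∈ Finset.Ico i₁ i₂, (1 / 2 : ℝ) ^ i ≤ (1 / 2) ^ i₁ * 2 := by
        rw [Finset.sum_Ico_eq_sum_range]
        simp only [pow_add]
        rw [← Finset.mul_sum]
        gcongr
        exact sum_geometric_two_le _
      have hg00 := hg 0
      rw [lt_div_iff₀ (by positivity)] at hi₁
      have h4 : D * g 0 * ∑ i ∈ Finset.Ico i₁ i₂, (1 / 2 : ℝ) ^ i ≤
          D * g 0 * ((1 / 2) ^ i₁ * 2) := by gcongr
      linarith
    linarith
  · -- the barriers slow down the passage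
    have h1 := barrier_le_minTime (τ := fun e => t e ω) (fun e => h.nonneg e ω) hKn I hI
      (fun k => b (K - J - k)) (fun k => hb0 _)
      fun x i hx => (le_max_left _ _).trans (hω x i hx).le
    refine le_trans ?_ h1
    rw [Finset.sum_image hinj]
    have h2 : ∀ i ∈ Finset.Ico i₁ i₂, b (K - J - (K - (J + i))) * 2 ^ (K - (J + i) - 1) =
        c i * (2 ^ K / 2) := by
      intro i hi
      rw [hidx i hi]
      have hk := (hI _ (Finset.mem_image_of_mem _ hi)).1
      have h3 : (2 : ℝ) ^ (K - (J + i)) = 2 ^ (K - (J + i) - 1) * 2 := by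
        rw [← pow_succ]; congr 1; omega
      have h4 := hscale i hi
      rw [h3] at h4
      rw [← h4]
      simp only [b]
      ring
    rw [Finset.sum_congr rfl h2, ← Finset.sum_mul, hcsum]
    have h5 : (n : ℝ) ≤ 2 ^ K * 2 := by
      have : n ≤ 2 ^ K * 2 := by rw [← pow_succ]; exact hnK.le
      exact_mod_cast this
    nlinarith

end

/-! ### The equivalence -/

theorem coe_mul_log2_le {d n : ℕ} (hn : 1 ≤ n) {c : ℝ} {p : ℝ≥0∞}
    (hp : p ≤ ENNReal.ofReal ((2 : ℝ) ^ (-(c * (n : ℝ) ^ d)))) :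
    ((1 / (n : ℝ) ^ d : ℝ) : EReal) * log2 p ≤ ((-c : ℝ) : EReal) := by
  have hn0 : (0 : ℝ) < (n : ℝ) ^ d := by
    have : (0 : ℝ) < n := by exact_mod_cast hn
    positivity
  have h1 := (log2_le_iff _ _).2 hp
  refine (mul_le_mul_of_nonneg_left h1
    (by exact_mod_cast (by positivity : (0:ℝ) ≤ 1 / (n : ℝ) ^ d))).trans_eq ?_
  rw [← EReal.coe_mul]
  congr 1
  field_simp

theorem le_coe_mul_log2 {d n : ℕ} (hn : 1 ≤ n) {c : ℝ} {p : ℝ≥0∞}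
    (hp : ENNReal.ofReal ((2 : ℝ) ^ (-(c * (n : ℝ) ^ d))) ≤ p) :
    ((-c : ℝ) : EReal) ≤ ((1 / (n : ℝ) ^ d : ℝ) : EReal) * log2 p := by
  have hn0 : (0 : ℝ) < (n : ℝ) ^ d := by
    have : (0 : ℝ) < n := by exact_mod_cast hn
    positivity
  have h1 := (le_log2_iff _ _).2 hp
  refine le_trans (le_of_eq ?_) (mul_le_mul_of_nonneg_left h1
    (by exact_mod_cast (by positivity : (0:ℝ) ≤ 1 / (n : ℝ) ^ d)))
  rw [← EReal.coe_mul]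
  congr 1
  field_simp

section

variable {d : ℕ} [NeZero d] {Ω : Type*} [MeasurableSpace Ω] {P : Measure Ω}
  {t : Edge d → Ω → ℝ} {M₀ : ℝ} {f : ℝ → ℝ}

theorem TailEnv.limsup_log2_neg_iff [IsProbabilityMeasure P] (h : TailEnv P t M₀ f)
    (hd : 2 ≤ d) (hM₀ : 0 < M₀) {ε : ℝ} (hε : 0 < ε) :
    limsup (fun n : ℕ => ((1 / (n : ℝ) ^ d : ℝ) : EReal) *
      log2 (P {ω | (timeConstant P t + ε) * n ≤ minTime (fun e => t e ω) 0 (axis d n)})) atTop < 0 ↔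
    Summable fun n : ℕ => 1 / f (2 ^ (n + 1)) ^ (1 / ((d : ℝ) - 1)) := by
  constructor
  · intro hlim
    by_contra hsum
    refine absurd hlim (not_lt.2 ?_)
    have hA : 0 < timeConstant P t + ε := by
      have := h.timeConstant_nonneg
      linarith
    refine le_of_forall_lt fun a ha => ?_
    obtain ⟨r, har, hr0⟩ := EReal.lt_iff_exists_real_btwn.1 ha
    have hr : r < 0 := by exact_mod_cast hr0
    refine har.trans_le (le_limsup_of_frequently_le' (Eventually.frequently ?_))
    filter_upwards [h.exists_upper_tail_ge hd hM₀ hsum hA (neg_pos.2 hr), eventually_ge_atTop 1]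
      with n hn hn1
    simpa using le_coe_mul_log2 hn1 hn
  · intro hsum
    obtain ⟨c, hc, hn⟩ := h.exists_upper_tail_le hd hsum hε
    have hl : 0 < Real.log 2 := Real.log_pos one_lt_two
    refine lt_of_le_of_lt (b := ((-(c / Real.log 2) : ℝ) : EReal)) ?_ ?_
    · refine limsup_le_of_le (by isBoundedDefault) ?_
      filter_upwards [hn, eventually_ge_atTop 1] with n hn hn1
      refine coe_mul_log2_le hn1 (hn.trans_eq ?_)
      rw [Real.rpow_def_of_pos two_pos]
      congr 2
      field_simp
    · have : 0 < c / Real.log 2 := by positivity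
      exact_mod_cast neg_neg_of_pos this

end

end FPP

theorem theorem1p3 {d : ℕ} (hd : 2 ≤ d)
    {Ω : Type*} [MeasurableSpace Ω] (P : Measure Ω) [IsProbabilityMeasure P]
    -- i.i.d. nonnegative passage times on the undirected edges of `ℤ^d`
    (t : FPP.Edge d → Ω → ℝ)
    (ht_meas : ∀ e, Measurable (t e))
    (ht_nonneg : ∀ e, ∀ᵐ ω ∂P, 0 ≤ t e ω)
    (ht_indep : iIndepFun t P)
    (ht_ident : ∀ e e', IdentDistrib (t e) (t e') P P)
    -- the upper tail
    (M₀ : ℝ) (hM₀ : 0 < M₀) (f : ℝ → ℝ)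
    (hf_pos : ∀ x, M₀ < x → 0 < f x)
    (hf_mono : MonotoneOn f (Set.Ioi M₀))
    (h_tail : ∀ e, ∀ x, M₀ < x →
      FPP.log2 (P {ω | x < t e ω}) = ((-(x ^ d * f x) : ℝ) : EReal)) :
    ∃ ν : ℝ, 0 ≤ ν ∧
      (∀ᵐ ω ∂P,
        Tendsto (fun n : ℕ => FPP.passageTime (fun e => t e ω) n / (n : ℝ)) atTop (𝓝 ν)) ∧
      ∃ ε₀ : ℝ, 0 < ε₀ ∧ ∀ ε : ℝ, 0 < ε → ε < ε₀ →
        (limsup (fun n : ℕ => ((1 / (n : ℝ) ^ d : ℝ) : EReal) *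
            FPP.log2 (P {ω | (ν + ε) * (n : ℝ) ≤ FPP.passageTime (fun e => t e ω) n})) atTop < 0
          ↔ Summable fun n : ℕ => 1 / f (2 ^ (n + 1)) ^ (1 / ((d : ℝ) - 1))) := by
  have : NeZero d := ⟨by omega⟩
  have hmax : Measurable fun y : ℝ => max y 0 := measurable_id.max measurable_const
  -- the positive parts form an environment that is nonnegative everywhere
  have h : FPP.TailEnv P (fun e ω => max (t e ω) 0) M₀ f :=
    { meas := fun e => hmax.comp (ht_meas e)
      nonneg := fun _ _ => le_max_right _ _
      indep := ht_indep.comp (fun _ y => max y 0) fun _ => hmax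
      ident := fun e e' => (ht_ident e e').comp hmax
      f_pos := hf_pos
      f_mono := hf_mono
      tail := fun e x hx => by
        rw [← FPP.log2_eq_iff, ← h_tail e x hx]
        congr 2
        ext ω
        have : ¬ x < 0 := by linarith
        simp [this] }
  have hae : ∀ᵐ ω ∂P, ∀ n : ℕ, FPP.passageTime (fun e => t e ω) n =
      FPP.minTime (fun e => max (t e ω) 0) 0 (FPP.axis d n) := by
    filter_upwards [ae_all_iff.2 ht_nonneg] with ω hω n
    rw [FPP.passageTime_eq_minTime, FPP.axisPoint_eq_axis]
    congr 1
    ext e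
    exact (max_eq_left (hω e)).symm
  refine ⟨FPP.timeConstant P fun e ω => max (t e ω) 0, h.timeConstant_nonneg, ?_, 1, one_pos, ?_⟩
  · filter_upwards [h.ae_tendsto hd, hae] with ω hω he
    simpa only [he] using hω
  · intro ε hε _
    rw [← h.limsup_log2_neg_iff hd hM₀ hε]
    have hP : ∀ n : ℕ, P {ω | (FPP.timeConstant P (fun e ω => max (t e ω) 0) + ε) * (n : ℝ) ≤
        FPP.passageTime (fun e => t e ω) n} =
        P {ω | (FPP.timeConstant P (fun e ω => max (t e ω) 0) + ε) * (n : ℝ) ≤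
        FPP.minTime (fun e => max (t e ω) 0) 0 (FPP.axis d n)} := by
      intro n
      refine measure_congr ?_
      filter_upwards [hae] with ω he
      exact propext (by
        change _ ≤ FPP.passageTime (fun e => t e ω) n ↔ _ ≤ FPP.minTime _ _ _
        rw [he n])
    simp only [hP]
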